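/- **Setting.** Let $N\ge 1$ and let $sp(N)$ be the complex symplectic Lie algebra of rank $N$, realized as the $2N\times 2N$ matrices $\begin{pmatrix}a&b\\c&-a^{T}\end{pmatrix}$ with $b,c$ symmetric. With $e_{ij}$ the $2N\times2N$ matrix units put, for $1\le i,j\le N$, $$E_{i+j}=e_{i,N+j}+e_{j,N+i},\quad F_{i+j}=e_{N+i,j}+e_{N+j,i},\quad E_{i-j}=e_{i,j}-e_{N+j,N+i}\ (i\ne j),\quad H_{ii}=\tfrac12(e_{i,i}-e_{N+i,N+i}),$$ so that $F_{i-j}=E_{j-i}$. For $0\le m\le N$ let $sp(N-m)\subset sp(N)$ be the subalgebra generated by those of these generators all of whose indices are $>m$. Let $\Delta$ be the primitive coproduct and $\varepsilon$ the counit of $U(sp(N))$. All formulas are understood in $U(sp(N))^{\otimes n}[[\xi]]$ for a formal parameter $\xi$, after the rescaling $E_{i+j}\to\xi E_{i+j}$, $F_{i+j}\to\xi^{-1}F_{i+j}$ (other generators unchanged). For invertible $F$ put $\Delta_F(a)=F\Delta(a)F^{-1}$; call $a$ *primitive for* $F$ if $\Delta_F(a)=a\otimes1+1\otimes a$, and call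 an invertible $G$ a *twist for* $F$ if $G_{12}(\Delta_F\otimes\mathrm{id})(G)=G_{23}(\mathrm{id}\otimes\Delta_F)(G)$ and $(\varepsilon\otimes\mathrm{id})(G)=(\mathrm{id}\otimes\varepsilon)(G)=1$. For a system $Q$ of elements $E_{i\pm j},F_{i+j},H_{ii}\in U(sp(N))[[\xi]]$ and $1\le k\le N$ put $\sigma_{k+k}=\ln(1+\xi E_{k+k})$ and $$\mathcal F_{\mathcal E_k}(Q)=\Big(\prod_{i>k}^{\leftarrow}e^{\,\xi E_{k-i}\otimes E_{k+i}e^{-\frac12\sigma_{k+k}}}\Big)e^{H_{kk}\otimes\sigma_{k+k}},\qquad s_k(Q)=\exp\Big\{\Big(\sum_{i>k}\xi E_{k-i}E_{k+i}\Big)f(\xi E_{k+k})\Big\},\quad f(t)=-\frac{\ln(1+t)}{2t}$$ (factors with larger $i$ stand further to the left). The *$k$-th basis change* sends $Q$ to the system $$E'_{i+j}=E_{i+j}-\xi E_{k+i}E_{k+j}e^{-\sigma_{k+k}},\quad F'_{i+j}=F_{i+j}-\xi E_{k-i}E_{k-j},\quad E'_{i-j}=E_{i-j},\quad H'_{ii}=H_{ii},$$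 which is used for indices $i,j>k$ (with $i=j$ allowed in the first two formulas). Let $Q^{(0)}$ be the initial generators, let $Q^{(k)}$ be obtained from $Q^{(k-1)}$ by the $k$-th basis change, and write $\mathcal F_{\mathcal E_k}=\mathcal F_{\mathcal E_k}(Q^{(0)})$, $s_k=s_k(Q^{(0)})$, $\mathcal F_{s_k}=(s_k^{-1}\otimes s_k^{-1})\Delta_{\mathcal F_{\mathcal E_k}}(s_k)$. For $0\le m\le N$ put $$C_m=\mathcal F_{\mathcal E_m}(Q^{(m-1)})\cdots\mathcal F_{\mathcal E_1}(Q^{(0)}),\qquad G_m=\big(\mathcal F_{s_m}\mathcal F_{\mathcal E_m}\big)\cdots\big(\mathcal F_{s_1}\mathcal F_{\mathcal E_1}\big),\qquad S_m=s_1s_2\cdots s_m.$$ Thus $C_N$ is the maximal chain of extended twists on the deformed carrier spaces, and $G_N=\prod_{i=1}^{\stackrel{N}{\leftarrow}}\mathcal F_{s_i}\mathcal F_{\mathcal E_i}$ is written in the initial generators. **Proposition.** Every $s_k$, $s_k(Q^{(k-1)})$ and $S_m$ is invertible, and the following hold. 1. For $1\le k\le N$: $\mathcal F_{\mathcal E_k}$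 is a twist for $1$, and $\mathcal F_{s_k}$ is a twist for $\mathcal F_{\mathcal E_k}$. For every generator $X$ of $sp(N-k)$, with image $X'$ under the $k$-th basis change of $Q^{(0)}$, one has $X'=s_kXs_k^{-1}$; moreover $X'$ is primitive for $\mathcal F_{\mathcal E_k}$, and the original $X$ is primitive for $\mathcal F_{s_k}\mathcal F_{\mathcal E_k}$. 2. For $1\le k\le N$, put $\tilde s=s_k(Q^{(k-1)})$ and $\tilde{\mathcal F}=(\tilde s^{-1}\otimes\tilde s^{-1})\Delta_{C_k}(\tilde s)$. Then $\mathcal F_{\mathcal E_k}(Q^{(k-1)})$ is a twist for $C_{k-1}$, and $\tilde{\mathcal F}$ is a twist for $C_k$. For every generator $X$ of $sp(N-k)$ one has $X^{(k)}=\tilde sX^{(k-1)}\tilde s^{-1}$; moreover $X^{(k)}$ is primitive for $C_k$, and $X^{(k-1)}$ is primitive for $\tilde{\mathcal F}C_k$. 3. For $1\le k\le N$: $\mathcal F_{\mathcal E_k}$ is a twist for $G_{k-1}$; $\mathcal F_{s_k}=(s_k^{-1}\otimes s_k^{-1})\Delta_{\mathcal F_{\mathcal E_k}G_{k-1}}(s_k)$,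 and it is a twist for $\mathcal F_{\mathcal E_k}G_{k-1}$; and every original generator of $sp(N-k)$ is primitive for $G_k$. 4. For $0\le m\le N$: $C_m$ and $G_m$ are twists for $1$; $X^{(m)}=S_mXS_m^{-1}$ for every generator $X$ of $sp(N-m)$; and $$G_m=(S_m^{-1}\otimes S_m^{-1})\,C_m\,\Delta(S_m).$$ In particular, up to the coboundary of $S_N$, the maximal chain $C_N$ has the canonical form $\prod_{i=1}^{\stackrel{N}{\leftarrow}}\mathcal F_{s_i}\mathcal F_{\mathcal E_i}$. -/

import Mathlib

open scoped TensorProduct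

noncomputable section

namespace SpChain

/-! ### The Lie algebra `sp(N)` and its root generators -/

/-- The complex symplectic Lie algebra of rank `N`, i.e. the matrices
`[[a, b], [c, -aᵀ]]` with `b`, `c` symmetric. -/
abbrev Sp (N : ℕ) : Type := LieAlgebra.Symplectic.sp (Fin N) ℂ

/-- Labels of the generators: `E i j` is `E_{i+j}` (root `e_i + e_j`, so `E i i` is `E_{i+i}` with
root `2 e_i`), `F i j` is `F_{i+j}` (root `-e_i - e_j`), `M i j` is `E_{i-j}` (root `e_i - e_j`;
thus `F_{i-j}` is `M j i`), and `H i` is the Cartan generator `H_{ii}`. Indices start at `0`. -/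
inductive Gen (N : ℕ) : Type
  | E (i j : Fin N)
  | F (i j : Fin N)
  | M (i j : Fin N)
  | H (i : Fin N)

/-- All indices of the label are at least `m`; these are the generators of
`sp(N - m) ⊆ sp(N)`, the regular subalgebra orthogonal to the first `m` long roots. -/
def Gen.InTail {N : ℕ} (m : ℕ) : Gen N → Prop
  | .E i j => m ≤ i ∧ m ≤ j
  | .F i j => m ≤ i ∧ m ≤ j
  | .M i j => m ≤ i ∧ m ≤ j ∧ i ≠ j
  | .H i => m ≤ i

/-- The matrix of a generator, in `N × N` blocks. -/
def genMatrix {N : ℕ} : Gen N → Matrix (Fin N ⊕ Fin N) (Fin N ⊕ Fin N) ℂ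
  | .E i j => Matrix.fromBlocks 0 (Matrix.single i j 1 + Matrix.single j i 1) 0 0
  | .F i j => Matrix.fromBlocks 0 0 (Matrix.single i j 1 + Matrix.single j i 1) 0
  | .M i j => Matrix.fromBlocks (Matrix.single i j 1) 0 0 (-Matrix.single j i 1)
  | .H i => Matrix.fromBlocks (Matrix.single i i (1 / 2)) 0 0 (-Matrix.single i i (1 / 2))

theorem genMatrix_mem {N : ℕ} (g : Gen N) :
    genMatrix g ∈ LieAlgebra.Symplectic.sp (Fin N) ℂ := by
  rw [LieAlgebra.Symplectic.sp, mem_skewAdjointMatricesLieSubalgebra,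
    mem_skewAdjointMatricesSubmodule, Matrix.IsSkewAdjoint, Matrix.IsAdjointPair]
  cases g <;>
    simp [genMatrix, Matrix.J, Matrix.fromBlocks_transpose, Matrix.fromBlocks_multiply,
      Matrix.transpose_add, Matrix.transpose_single, Matrix.fromBlocks_neg, add_comm]

/-- The generator of `sp(N)` with a given label. -/
def spGen {N : ℕ} (g : Gen N) : Sp N := ⟨genMatrix g, genMatrix_mem g⟩

/-! ### The Hopf structure of `U(sp(N))` -/

/-- The universal enveloping algebra `U(sp(N))`. -/
abbrev U (N : ℕ) : Type := UniversalEnvelopingAlgebra ℂ (Sp N)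

attribute [local instance 100] LieRing.ofAssociativeRing

/-- The Lie algebra map `x ↦ x ⊗ 1 + 1 ⊗ x`. -/
def primLie (N : ℕ) : Sp N →ₗ⁅ℂ⁆ (U N ⊗[ℂ] U N) where
  toFun x := UniversalEnvelopingAlgebra.ι ℂ x ⊗ₜ[ℂ] 1 + 1 ⊗ₜ[ℂ] UniversalEnvelopingAlgebra.ι ℂ x
  map_add' x y := by
    simp only [map_add, TensorProduct.add_tmul, TensorProduct.tmul_add]; abel
  map_smul' c x := by
    simp only [map_smul, TensorProduct.smul_tmul', TensorProduct.tmul_smul, smul_add,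
      RingHom.id_apply]
  map_lie' {x y} := by
    simp only [LieHom.map_lie, LieRing.of_associative_ring_bracket, mul_add, add_mul,
      Algebra.TensorProduct.tmul_mul_tmul, one_mul, mul_one, TensorProduct.sub_tmul,
      TensorProduct.tmul_sub]
    abel

/-- The primitive coproduct `U → U ⊗ U`. -/
def comul (N : ℕ) : U N →ₐ[ℂ] U N ⊗[ℂ] U N := UniversalEnvelopingAlgebra.lift ℂ (primLie N)

/-- The counit `U → ℂ`, vanishing on the Lie algebra. -/
def counit (N : ℕ) : U N →ₐ[ℂ] ℂ := UniversalEnvelopingAlgebra.lift ℂ 0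

/-! ### Formal power series: `U[[ξ]]`, `(U ⊗ U)[[ξ]]`, `(U ⊗ U ⊗ U)[[ξ]]` -/

/-- `U(sp(N))[[ξ]]`. -/
abbrev U1 (N : ℕ) : Type := PowerSeries (U N)

/-- `(U(sp(N)) ⊗ U(sp(N)))[[ξ]]`. -/
abbrev U2 (N : ℕ) : Type := PowerSeries (U N ⊗[ℂ] U N)

/-- `(U(sp(N)) ⊗ U(sp(N)) ⊗ U(sp(N)))[[ξ]]`. -/
abbrev U3 (N : ℕ) : Type := PowerSeries ((U N ⊗[ℂ] U N) ⊗[ℂ] U N)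

/-- The value `φ(y) = ∑ₘ φₘ yᵐ` of a scalar power series `φ` at an element `y` of `A[[ξ]]` with
zero constant term. (Then `yᵐ` does not contribute to the coefficient of `ξⁿ` for `m > n`.) -/
def ev {A : Type*} [Ring A] [Algebra ℂ A] (φ : PowerSeries ℂ) (y : PowerSeries A) :
    PowerSeries A :=
  PowerSeries.mk fun n =>
    ∑ m ∈ Finset.range (n + 1), PowerSeries.coeff m φ • PowerSeries.coeff n (y ^ m)

/-- The exponential of a series with zero constant term. -/
def fexp {A : Type*} [Ring A] [Algebra ℂ A] (y : PowerSeries A) : PowerSeries A :=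
  ev (PowerSeries.exp ℂ) y

/-- `ln (1 + y)` for a series `y` with zero constant term. -/
def flog1p {A : Type*} [Ring A] [Algebra ℂ A] (y : PowerSeries A) : PowerSeries A :=
  ev (PowerSeries.log ℂ) y

/-- The scalar series `f(t) = -ln(1 + t) / (2 t)`. -/
def fSeries : PowerSeries ℂ :=
  PowerSeries.mk fun n => -(PowerSeries.coeff (n + 1) (PowerSeries.log ℂ)) / 2

theorem fSeries_spec : 2 * PowerSeries.X * fSeries = -PowerSeries.log ℂ := by
  have h2 : (2 : PowerSeries ℂ) = PowerSeries.C (2 : ℂ) := by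
    exact (map_ofNat (PowerSeries.C (R := ℂ)) 2).symm
  rw [mul_assoc, h2]
  ext n
  cases n with
  | zero => simp
  | succ n =>
    rw [PowerSeries.coeff_C_mul, PowerSeries.coeff_succ_X_mul, fSeries, PowerSeries.coeff_mk]
    rw [map_neg]; ring

/-- `a ⊗ b` for `a, b ∈ U[[ξ]]`, as an element of `(U ⊗ U)[[ξ]]`. -/
def tens {N : ℕ} (a b : U1 N) : U2 N :=
  PowerSeries.mapAlgHom (Algebra.TensorProduct.includeLeft : U N →ₐ[ℂ] U N ⊗[ℂ] U N) a *
    PowerSeries.mapAlgHom (Algebra.TensorProduct.includeRight : U N →ₐ[ℂ] U N ⊗[ℂ] U N) b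

/-- The primitive coproduct, `ξ`-linearly extended. -/
def Δ {N : ℕ} : U1 N →ₐ[ℂ] U2 N := PowerSeries.mapAlgHom (comul N)

/-- `X ↦ X₁₂`. -/
def leg12 {N : ℕ} : U2 N →ₐ[ℂ] U3 N := PowerSeries.mapAlgHom Algebra.TensorProduct.includeLeft

/-- `X ↦ X₂₃`. -/
def leg23 {N : ℕ} : U2 N →ₐ[ℂ] U3 N := PowerSeries.mapAlgHom
  ((Algebra.TensorProduct.assoc ℂ ℂ ℂ (U N) (U N) (U N)).symm.toAlgHom.comp
    Algebra.TensorProduct.includeRight)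

/-- `Δ ⊗ id`. -/
def comulId {N : ℕ} : U2 N →ₐ[ℂ] U3 N := PowerSeries.mapAlgHom
  (Algebra.TensorProduct.map (comul N) (AlgHom.id ℂ (U N)))

/-- `id ⊗ Δ`. -/
def idComul {N : ℕ} : U2 N →ₐ[ℂ] U3 N := PowerSeries.mapAlgHom
  ((Algebra.TensorProduct.assoc ℂ ℂ ℂ (U N) (U N) (U N)).symm.toAlgHom.comp
    (Algebra.TensorProduct.map (AlgHom.id ℂ (U N)) (comul N)))

/-- `ε ⊗ id`. -/
def counitId {N : ℕ} : U2 N →ₐ[ℂ] U1 N := PowerSeries.mapAlgHom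
  ((Algebra.TensorProduct.lid ℂ (U N)).toAlgHom.comp
    (Algebra.TensorProduct.map (counit N) (AlgHom.id ℂ (U N))))

/-- `id ⊗ ε`. -/
def idCounit {N : ℕ} : U2 N →ₐ[ℂ] U1 N := PowerSeries.mapAlgHom
  ((Algebra.TensorProduct.rid ℂ ℂ (U N)).toAlgHom.comp
    (Algebra.TensorProduct.map (AlgHom.id ℂ (U N)) (counit N)))

/-! ### Twists

Inverses of invertible elements are written with `Ring.inverse`. -/

/-- The twisted coproduct `Δ_F(a) = F Δ(a) F⁻¹`. -/
def twisted {N : ℕ} (F : U2 N) (a : U1 N) : U2 N := F * Δ a * Ring.inverse F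

/-- `a` is primitive for the coproduct `Δ_F`. -/
def IsPrimitive {N : ℕ} (F : U2 N) (a : U1 N) : Prop := twisted F a = tens a 1 + tens 1 a

/-- `G` is a twisting element of the algebra with coproduct `Δ_F`: it is invertible and
`G₁₂ (Δ_F ⊗ id)(G) = G₂₃ (id ⊗ Δ_F)(G)`, `(ε ⊗ id)(G) = (id ⊗ ε)(G) = 1`, where
`(Δ_F ⊗ id)(G) = F₁₂ (Δ ⊗ id)(G) F₁₂⁻¹` and `(id ⊗ Δ_F)(G) = F₂₃ (id ⊗ Δ)(G) F₂₃⁻¹`. -/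
def IsTwist {N : ℕ} (F G : U2 N) : Prop :=
  IsUnit G ∧
  leg12 G * (leg12 F * comulId G * Ring.inverse (leg12 F)) =
    leg23 G * (leg23 F * idComul G * Ring.inverse (leg23 F)) ∧
  counitId G = 1 ∧ idCounit G = 1

/-- The coboundary twist `(s⁻¹ ⊗ s⁻¹) Δ_F(s)` of the algebra with coproduct `Δ_F`. -/
def cobTwist {N : ℕ} (F : U2 N) (s : U1 N) : U2 N := tens (Ring.inverse s) (Ring.inverse s) * twisted F s

/-! ### Links and chains

Everything is written after the rescaling `E_{i+j} → ξ E_{i+j}`, `F_{i+j} → ξ⁻¹ F_{i+j}`, with the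
other generators unchanged. -/

/-- A system of (possibly nonlinear) generators in `U(sp(N))[[ξ]]`. -/
abbrev GenSys (N : ℕ) : Type := Gen N → U1 N

/-- The initial generators. -/
def initial (N : ℕ) : GenSys N := fun g =>
  PowerSeries.C (UniversalEnvelopingAlgebra.ι ℂ (spGen g))

/-- The formal parameter `ξ`. -/
def xi {N : ℕ} : U1 N := PowerSeries.X

/-- `ξ E_{k+k}`. -/
def scaledE {N : ℕ} (Q : GenSys N) (k : Fin N) : U1 N := xi * Q (.E k k)

/-- `σ_{k+k} = ln (1 + ξ E_{k+k})`. -/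
def sigma {N : ℕ} (Q : GenSys N) (k : Fin N) : U1 N := flog1p (scaledE Q k)

/-- The indices `i > k`, in decreasing order. -/
def indicesAbove {N : ℕ} (k : Fin N) : List (Fin N) :=
  ((List.finRange N).filter fun i => k < i).reverse

/-- The maximal extended jordanian twist of the `k`-th link,
`∏_{i > k} exp (ξ E_{k-i} ⊗ E_{k+i} e^{-σ_{k+k}/2}) · exp (H_{kk} ⊗ σ_{k+k})`,
with larger `i` further to the left. -/
def extTwist {N : ℕ} (Q : GenSys N) (k : Fin N) : U2 N :=
  ((indicesAbove k).map fun i =>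
      fexp (tens (Q (.M k i)) (xi * Q (.E k i) * fexp (-((1 / 2 : ℂ) • sigma Q k))))).prod *
    fexp (tens (Q (.H k)) (sigma Q k))

/-- `s_k = exp ((∑_{i > k} ξ E_{k-i} E_{k+i}) f(ξ E_{k+k}))` with `f(t) = -ln(1 + t) / (2 t)`. -/
def sElt {N : ℕ} (Q : GenSys N) (k : Fin N) : U1 N :=
  fexp ((∑ i ∈ Finset.univ.filter (fun i => k < i), xi * Q (.M k i) * Q (.E k i)) *
    ev fSeries (scaledE Q k))

/-- The `k`-th nonlinear basis change (of interest for generators with all indices `> k`). -/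
def basisChange {N : ℕ} (k : Fin N) (Q : GenSys N) : GenSys N
  | .E i j => Q (.E i j) - xi * Q (.E k i) * Q (.E k j) * fexp (-sigma Q k)
  | .F i j => Q (.F i j) - xi * Q (.M k i) * Q (.M k j)
  | .M i j => Q (.M i j)
  | .H i => Q (.H i)

/-- The first `m` indices, in increasing order. -/
def firstIndices (N m : ℕ) : List (Fin N) := (List.finRange N).take m

/-- The generators after the first `m` basis changes. -/
def deformed (N m : ℕ) : GenSys N :=
  (firstIndices N m).foldl (fun Q k => basisChange k Q) (initial N)

theorem deformed_zero (N : ℕ) : deformed N 0 = initial N := by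
  simp [deformed, firstIndices]

theorem deformed_succ {N : ℕ} (k : Fin N) :
    deformed N (k + 1) = basisChange k (deformed N k) := by
  have h : (List.finRange N).take (k + 1) = (List.finRange N).take k ++ [k] := by
    rw [List.take_add_one]; simp
  simp [deformed, firstIndices, h]

/-- The first `m` links of the chain of extended twists on the deformed carrier spaces: the `k`-th
link is the extended twist in the generators obtained after the preceding basis changes; later
links stand further to the left. -/
def deformedChain (N m : ℕ) : U2 N :=
  ((firstIndices N m).map fun k : Fin N => extTwist (deformed N k) k).reverse.prod

/-- The coboundary twist `F_{s_k} = (s_k⁻¹ ⊗ s_k⁻¹) Δ_{E_k}(s_k)` in the initial generators. -/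
def sTwist {N : ℕ} (k : Fin N) : U2 N := cobTwist (extTwist (initial N) k) (sElt (initial N) k)

/-- The first `m` links of the chain in canonical form: the `k`-th link is `F_{s_k} F_{E_k}` in the
initial generators; later links stand further to the left. -/
def canonicalChain (N m : ℕ) : U2 N :=
  ((firstIndices N m).map fun k => sTwist k * extTwist (initial N) k).reverse.prod

/-- The product `s_1 s_2 ⋯ s_m` of the first `m` elements `s_k`, in the initial generators. -/
def sProd (N m : ℕ) : U1 N := ((firstIndices N m).map fun k => sElt (initial N) k).prod

end SpChain

end

open SpChain

/-! Fix a link `k` and write a_i = E_{k-i}, b_i = E_{k+i}, e = ξE_{k+k}, σ = ln(1+e), H = H_{kk}, q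
= ∑ ξ a_i b_i. The a's commute among themselves, so do the b's, and [a_i, b_j] = δ_ij E_{k+k} is
central among them. A link is thus a Heisenberg algebra graded by H, and every computation reduces
to terminating commutators or to a geometric action of ad on an eigenvector.

Cocycle property (`link_cocycle`). The factors of the extension commute, so the link is exp(Φ)
exp(J) with Φ = ∑ a_i ⊗ ξ b_i e^{-σ/2} and J = H ⊗ σ. The twisted coproducts of a_i, ξ b_i e^{-σ/2}
and σ are explicit (`link_a`, `link_bW`, `link_sigma`). Inserting them, the cocycle equation becomes
an identity between exponentials of Φ₁₂, Φ₂₃ and Φ₁₃, which holds because e^{-σ/2}(1+e) = e^{σ/2}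
(`ext_cocycle`).

Basis change as conjugation (`sElt_conj`). ad(q) multiplies b_i by e and a_i by -e, so the exponent
q f(e) of s_k has eigenvalues -σ/2 on b_i and σ/2 on a_i. For X = E_{i+j} or F_{i+j} with i, j > k,
[q, X] is twice ξ b_i b_j or ξ a_i a_j, an eigenvector of eigenvalue -σ or σ; the other tail
generators commute with q. Summing the exponential series leaves two scalar identities for f, and f
is exactly the series satisfying them. Independently, a direct computation shows that the changed
generators are primitive for the link (`link_primitive`).

Passing to F_{s_k} F_{E_k} = (s_k⁻¹ ⊗ s_k⁻¹) F_{E_k} Δ(s_k) undoes the conjugation, so the original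
tail generators are primitive for it (`primitive_coboundary`). Being primitive also for Δ, they give
coproducts that commute with this canonical link.

That commutation drives the chain. The product of the earlier canonical links commutes with Δ of
everything from which the next link is built, so the next link in the original generators can be
multiplied on (`link_mul_cocycle`), and Δ(s_k) can be moved past the product. Joint induction gives
`canonicalChain_spec`.

The basis changes are formulas in the current system and therefore commute with conjugation. Hence
the system after m changes is the conjugate by S_m = s_1⋯s_m of the tail of the initial one
(`deformed_isConj`), the links are conjugated by S_m ⊗ S_m, and the product telescopes to G_m =
(S_m⁻¹ ⊗ S_m⁻¹) C_m Δ(S_m) (`canonicalChain_eq`). All claims about C_m are transported from G_m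
along this formula.

Twists for a twisted coproduct never need separate treatment: if F is a counital cocycle, then G is
a twist for F as soon as GF is a counital cocycle (`IsCocycle.isTwist`). -/

noncomputable section

namespace SpChain

/-! ### Calculus of formal power series over a noncommutative algebra -/

/-! ### Sums of ξ-adically convergent families. -/

section Sums

open PowerSeries Finset

variable {A : Type*} [Ring A]

/-- The `m`-th term of the family is divisible by `ξᵐ`. -/
def Adm (z : ℕ → PowerSeries A) : Prop := ∀ m n, n < m → coeff n (z m) = 0

/-- The sum of an admissible family. -/
def fsum (z : ℕ → PowerSeries A) : PowerSeries A :=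
  PowerSeries.mk fun n => ∑ m ∈ range (n + 1), coeff n (z m)

theorem coeff_fsum {z : ℕ → PowerSeries A} (hz : Adm z) {n M : ℕ} (h : n < M) :
    coeff n (fsum z) = ∑ m ∈ range M, coeff n (z m) := by
  rw [fsum, coeff_mk]
  refine sum_subset (range_subset_range.2 h) fun m _ hm => hz _ _ ?_
  simp at hm; omega

theorem coeff_mul_eq_zero {x y : PowerSeries A} {i j n : ℕ} (hx : ∀ m < i, coeff m x = 0)
    (hy : ∀ m < j, coeff m y = 0) (h : n < i + j) : coeff n (x * y) = 0 := by
  rw [coeff_mul]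
  refine sum_eq_zero fun p hp => ?_
  rw [HasAntidiagonal.mem_antidiagonal] at hp
  by_cases h1 : p.1 < i
  · rw [hx _ h1, zero_mul]
  · rw [hy _ (by omega), mul_zero]

/-- Cauchy product. No commutativity is needed, since the left and right factors keep their sides.
-/
theorem fsum_mul {z w : ℕ → PowerSeries A} (hz : Adm z) (hw : Adm w) :
    fsum z * fsum w = fsum fun n => ∑ p ∈ antidiagonal n, z p.1 * w p.2 := by
  ext n
  have h1 : coeff n (fsum z * fsum w) =
      ∑ i ∈ range (n + 1), ∑ j ∈ range (n + 1), coeff n (z i * w j) := by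
    calc _ = ∑ p ∈ antidiagonal n, (∑ i ∈ range (n + 1), coeff p.1 (z i)) *
          ∑ j ∈ range (n + 1), coeff p.2 (w j) := by
          rw [coeff_mul]
          refine sum_congr rfl fun p hp => ?_
          rw [HasAntidiagonal.mem_antidiagonal] at hp
          rw [coeff_fsum hz (show p.1 < n + 1 by omega), coeff_fsum hw (show p.2 < n + 1 by omega)]
      _ = _ := by
          simp_rw [sum_mul_sum, coeff_mul]
          rw [sum_comm]
          refine sum_congr rfl fun i _ => ?_
          rw [sum_comm]
  rw [h1, fsum, coeff_mk, ← sum_product']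
  -- The product of terms i and j is divisible by ξ^{i+j}, so in degree n the square of indices may
  -- be cut down to the triangle i + j ≤ n.
  have h2 : ∑ p ∈ range (n + 1) ×ˢ range (n + 1), coeff n (z p.1 * w p.2) =
      ∑ p ∈ (range (n + 1) ×ˢ range (n + 1)).filter (fun p => p.1 + p.2 < n + 1),
        coeff n (z p.1 * w p.2) := by
    symm
    refine sum_subset (filter_subset _ _) fun p hp hp' => ?_
    refine coeff_mul_eq_zero (hz p.1) (hw p.2) ?_
    rw [mem_filter] at hp'
    by_contra h
    exact hp' ⟨hp, by omega⟩
  rw [h2, ← sum_fiberwise_of_maps_to (g := fun p : ℕ × ℕ => p.1 + p.2) (t := range (n + 1))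
    (fun p hp => mem_range.2 (mem_filter.1 hp).2)]
  refine sum_congr rfl fun m hm => ?_
  rw [map_sum]
  refine sum_congr ?_ fun _ _ => rfl
  ext p
  simp only [mem_filter, mem_product, mem_range, HasAntidiagonal.mem_antidiagonal] at hm ⊢
  omega

theorem mul_fsum (x : PowerSeries A) {z : ℕ → PowerSeries A} (hz : Adm z) :
    x * fsum z = fsum fun n => x * z n := by
  ext n
  have hz' : Adm fun n => x * z n := fun m n h =>
    coeff_mul_eq_zero (i := 0) (by simp) (hz m) (by omega)
  rw [coeff_fsum hz' n.lt_succ_self, coeff_mul]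
  simp_rw [coeff_mul]
  rw [sum_comm]
  refine sum_congr rfl fun p hp => ?_
  rw [HasAntidiagonal.mem_antidiagonal] at hp
  rw [coeff_fsum hz (show p.2 < n + 1 by omega), mul_sum]

theorem fsum_mul_right (x : PowerSeries A) {z : ℕ → PowerSeries A} (hz : Adm z) :
    fsum z * x = fsum fun n => z n * x := by
  ext n
  have hz' : Adm fun n => z n * x := fun m n h =>
    coeff_mul_eq_zero (j := 0) (hz m) (by simp) (by omega)
  rw [coeff_fsum hz' n.lt_succ_self, coeff_mul]
  simp_rw [coeff_mul]
  rw [sum_comm]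
  refine sum_congr rfl fun p hp => ?_
  rw [HasAntidiagonal.mem_antidiagonal] at hp
  rw [coeff_fsum hz (show p.1 < n + 1 by omega), sum_mul]

theorem fsum_eq_three {z : ℕ → PowerSeries A} (hz : Adm z) (h : ∀ n, z (n + 3) = 0) :
    fsum z = z 0 + z 1 + z 2 := by
  ext n
  rw [coeff_fsum hz (show n < n + 3 by omega), add_comm n, sum_range_add]
  simp only [sum_range_succ, range_zero, sum_empty, zero_add, map_add]
  rw [sum_eq_zero, add_zero]
  intro m _
  rw [add_comm, h, map_zero]

theorem adm_pow {y : PowerSeries A} (hy : constantCoeff y = 0) : Adm fun m => y ^ m := by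
  intro m
  induction m with
  | zero => intro n h; omega
  | succ m ih =>
    intro n h
    simp only [pow_succ]
    refine coeff_mul_eq_zero (j := 1) ih ?_ h
    intro i hi
    obtain rfl : i = 0 := by omega
    simpa using hy

theorem constantCoeff_neg' {y : PowerSeries A} (hy : constantCoeff y = 0) :
    constantCoeff (-y) = 0 := by rw [map_neg, hy, neg_zero]

end Sums

/-! ### Evaluation of scalar series, exponentials and conjugation by them. -/

section Calculus

open PowerSeries Finset

variable {A B : Type*} [Ring A] [Algebra ℂ A] [Ring B] [Algebra ℂ B]

theorem ev_eq_fsum (φ : PowerSeries ℂ) (y : PowerSeries A) :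
    ev φ y = fsum fun m => coeff m φ • y ^ m := by
  ext n
  simp [ev, fsum]

theorem adm_smul_pow (c : ℕ → ℂ) {y : PowerSeries A} (hy : constantCoeff y = 0) :
    Adm fun m => c m • y ^ m := fun m n h => by
  rw [coeff_smul, adm_pow hy m n h, smul_zero]

theorem coeff_ev (φ : PowerSeries ℂ) {y : PowerSeries A} (hy : constantCoeff y = 0) {n M : ℕ}
    (h : n < M) : coeff n (ev φ y) = ∑ m ∈ range M, coeff m φ • coeff n (y ^ m) := by
  rw [ev_eq_fsum, coeff_fsum (adm_smul_pow _ hy) h]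
  simp

theorem constantCoeff_ev (φ : PowerSeries ℂ) (y : PowerSeries A) :
    constantCoeff (ev φ y) = algebraMap ℂ A (constantCoeff φ) := by
  rw [← coeff_zero_eq_constantCoeff_apply, ev, coeff_mk]
  simp [Algebra.algebraMap_eq_smul_one]

theorem ev_mul (φ ψ : PowerSeries ℂ) {y : PowerSeries A} (hy : constantCoeff y = 0) :
    ev (φ * ψ) y = ev φ y * ev ψ y := by
  rw [ev_eq_fsum, ev_eq_fsum φ, ev_eq_fsum ψ, fsum_mul (adm_smul_pow _ hy) (adm_smul_pow _ hy)]
  congr 1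
  funext n
  rw [coeff_mul, sum_smul]
  refine sum_congr rfl fun p hp => ?_
  rw [HasAntidiagonal.mem_antidiagonal] at hp
  rw [smul_mul_smul_comm, ← pow_add, hp]

theorem ev_add (φ ψ : PowerSeries ℂ) (y : PowerSeries A) : ev (φ + ψ) y = ev φ y + ev ψ y := by
  ext n; simp [ev, add_smul, sum_add_distrib]

theorem ev_neg (φ : PowerSeries ℂ) (y : PowerSeries A) : ev (-φ) y = -ev φ y := by
  ext n; simp [ev]

theorem ev_smul (c : ℂ) (φ : PowerSeries ℂ) (y : PowerSeries A) : ev (c • φ) y = c • ev φ y := by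
  ext n; simp [ev, smul_sum, mul_smul]

theorem ev_one (y : PowerSeries A) : ev 1 y = 1 := by
  ext n; simp [ev, coeff_one]

theorem ev_X {y : PowerSeries A} (hy : constantCoeff y = 0) : ev X y = y := by
  ext n
  rw [coeff_ev _ hy (show n < n + 2 by omega), sum_eq_single 1]
  · simp
  · intro m _ hm; simp [coeff_X, hm]
  · intro h; simp at h

theorem ev_pow (φ : PowerSeries ℂ) {y : PowerSeries A} (hy : constantCoeff y = 0) (m : ℕ) :
    ev (φ ^ m) y = ev φ y ^ m := by
  induction m with
  | zero => simp [ev_one]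
  | succ m ih => rw [pow_succ, ev_mul _ _ hy, ih, pow_succ]

theorem ev_zero_right (φ : PowerSeries ℂ) (hφ : constantCoeff φ = 0) :
    ev φ (0 : PowerSeries A) = 0 := by
  ext n
  rw [ev, coeff_mk, map_zero]
  refine sum_eq_zero fun m _ => ?_
  rcases m with _ | m
  · simp [hφ]
  · simp

/-- Composition of scalar series is compatible with evaluation; any identity between scalar series,
such as exp(ln(1+t)) = 1+t, thereby transfers to noncommutative coefficients. -/
theorem ev_ev (φ : PowerSeries ℂ) {ψ : PowerSeries ℂ} (hψ : constantCoeff ψ = 0)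
    {y : PowerSeries A} (hy : constantCoeff y = 0) : ev φ (ev ψ y) = ev (ev φ ψ) y := by
  have h : constantCoeff (ev ψ y) = 0 := by rw [constantCoeff_ev, hψ, map_zero]
  ext n
  rw [coeff_ev _ h n.lt_succ_self, coeff_ev _ hy n.lt_succ_self]
  have h1 : ∀ r ∈ range (n + 1), coeff r (ev φ ψ) • coeff n (y ^ r) =
      ∑ m ∈ range (n + 1), coeff m φ • coeff r (ψ ^ m) • coeff n (y ^ r) := by
    intro r hr
    rw [coeff_ev _ hψ (mem_range.1 hr), sum_smul]
    simp [mul_smul]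
  rw [sum_congr rfl h1, sum_comm]
  refine sum_congr rfl fun m _ => ?_
  rw [← ev_pow _ hy, coeff_ev _ hy n.lt_succ_self, smul_sum]

theorem ev_semiconj (φ : PowerSeries ℂ) {x y z : PowerSeries A} (hy : constantCoeff y = 0)
    (hz : constantCoeff z = 0) (h : SemiconjBy x y z) : SemiconjBy x (ev φ y) (ev φ z) := by
  rw [SemiconjBy, ev_eq_fsum, ev_eq_fsum, mul_fsum _ (adm_smul_pow _ hy),
    fsum_mul_right _ (adm_smul_pow _ hz)]
  congr 1
  funext m
  rw [mul_smul_comm, smul_mul_assoc, (h.pow_right m).eq]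

theorem map_ev (f : A →ₐ[ℂ] B) (φ : PowerSeries ℂ) (y : PowerSeries A) :
    mapAlgHom f (ev φ y) = ev φ (mapAlgHom f y) := by
  ext n
  simp [ev, mapAlgHom_apply, ← map_pow]

theorem constantCoeff_map {f : A →ₐ[ℂ] B} {y : PowerSeries A} (hy : constantCoeff y = 0) :
    constantCoeff (mapAlgHom f y) = 0 := by
  rw [← coeff_zero_eq_constantCoeff_apply] at hy ⊢
  rw [mapAlgHom_apply, coeff_map, hy, map_zero]

theorem map_fexp (f : A →ₐ[ℂ] B) (y : PowerSeries A) :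
    mapAlgHom f (fexp y) = fexp (mapAlgHom f y) := map_ev f _ y

theorem map_flog1p (f : A →ₐ[ℂ] B) (y : PowerSeries A) :
    mapAlgHom f (flog1p y) = flog1p (mapAlgHom f y) := map_ev f _ y

theorem constantCoeff_flog1p (y : PowerSeries A) : constantCoeff (flog1p y) = 0 := by
  rw [flog1p, constantCoeff_ev]; simp

theorem fexp_semiconj {x y z : PowerSeries A} (hy : constantCoeff y = 0)
    (hz : constantCoeff z = 0) (h : x * y = z * x) : x * fexp y = fexp z * x :=
  ev_semiconj _ hy hz h

theorem fexp_zero : fexp (0 : PowerSeries A) = 1 := by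
  have h : PowerSeries.exp ℂ = 1 + (PowerSeries.exp ℂ - 1) := by ring
  rw [fexp, h, ev_add, ev_one, ev_zero_right, add_zero]
  simp

theorem expTerm_succ (y : PowerSeries A) (n : ℕ) :
    ((n : ℂ) + 1) • coeff (n + 1) (PowerSeries.exp ℂ) • y ^ (n + 1) =
      y * coeff n (PowerSeries.exp ℂ) • y ^ n := by
  rw [smul_smul, mul_smul_comm, pow_succ']
  congr 1
  have : (n : ℂ) + 1 ≠ 0 := by exact_mod_cast n.succ_ne_zero
  have : (n.factorial : ℂ) ≠ 0 := by exact_mod_cast n.factorial_ne_zero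
  simp [Nat.factorial_succ]
  field_simp

/-- Since Z is divisible by ξ, each commutator with Z raises the ξ-order by at least one;
convergence of ∑ zₙ is automatic. -/
theorem adm_of_ad {Z : PowerSeries A} (hZ : constantCoeff Z = 0) {z : ℕ → PowerSeries A}
    (h : ∀ n, Z * z n = z n * Z + ((n : ℂ) + 1) • z (n + 1)) : Adm z := by
  have hne : ∀ n : ℕ, (n : ℂ) + 1 ≠ 0 := fun n => by exact_mod_cast n.succ_ne_zero
  have hZ1 : ∀ m < 1, coeff m Z = 0 := fun i hi => by
    obtain rfl : i = 0 := by omega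
    simpa using hZ
  intro m
  induction m with
  | zero => intro n h; omega
  | succ m ih =>
    intro n hn
    have h1 : z (m + 1) = ((m : ℂ) + 1)⁻¹ • (Z * z m - z m * Z) := by
      rw [h, add_sub_cancel_left, smul_smul, inv_mul_cancel₀ (hne m), one_smul]
    rw [h1, coeff_smul, map_sub, coeff_mul_eq_zero hZ1 ih (by omega),
      coeff_mul_eq_zero ih hZ1 (by omega), sub_zero, smul_zero]

/-- If `ad(Z)ⁿ z₀ / n! = zₙ` for all `n`, then `exp(Z) z₀ exp(-Z) = ∑ zₙ`. -/
theorem fexp_mul_of_ad {Z : PowerSeries A} (hZ : constantCoeff Z = 0) {z : ℕ → PowerSeries A}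
    (h : ∀ n, Z * z n = z n * Z + ((n : ℂ) + 1) • z (n + 1)) :
    fexp Z * z 0 = fsum z * fexp Z := by
  have hne : ∀ n : ℕ, (n : ℂ) + 1 ≠ 0 := fun n => by exact_mod_cast n.succ_ne_zero
  have hz := adm_of_ad hZ h
  have hE := adm_smul_pow (fun m => coeff m (PowerSeries.exp ℂ)) hZ
  rw [fexp, ev_eq_fsum, fsum_mul_right _ hE, fsum_mul hz hE]
  congr 1
  funext n
  induction n with
  | zero => simp
  | succ n ih =>
    have key : ((n : ℂ) + 1) • ((coeff (n + 1) (PowerSeries.exp ℂ) • Z ^ (n + 1)) * z 0) =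
        ((n : ℂ) + 1) • ∑ p ∈ antidiagonal (n + 1),
          z p.1 * coeff p.2 (PowerSeries.exp ℂ) • Z ^ p.2 := by
      rw [← smul_mul_assoc, expTerm_succ, mul_assoc, ih, mul_sum]
      have h2 : ∀ p ∈ antidiagonal n, Z * (z p.1 * coeff p.2 (PowerSeries.exp ℂ) • Z ^ p.2) =
          ((p.2 : ℂ) + 1) • (z p.1 * coeff (p.2 + 1) (PowerSeries.exp ℂ) • Z ^ (p.2 + 1)) +
          ((p.1 : ℂ) + 1) • (z (p.1 + 1) * coeff p.2 (PowerSeries.exp ℂ) • Z ^ p.2) := by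
        intro p _
        rw [← mul_assoc, h, add_mul, mul_assoc, ← expTerm_succ, smul_mul_assoc, mul_smul_comm]
      rw [sum_congr rfl h2, sum_add_distrib, smul_sum]
      -- The factor n + 1 is split as p.2 + p.1. Each half, after shifting the antidiagonal, matches
      -- one of the two terms produced by moving Z past `z p.1`.
      have h3 : ∀ p ∈ antidiagonal (n + 1),
          ((n : ℂ) + 1) • (z p.1 * coeff p.2 (PowerSeries.exp ℂ) • Z ^ p.2) =
          (p.2 : ℂ) • (z p.1 * coeff p.2 (PowerSeries.exp ℂ) • Z ^ p.2) +
          (p.1 : ℂ) • (z p.1 * coeff p.2 (PowerSeries.exp ℂ) • Z ^ p.2) := by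
        intro p hp
        rw [HasAntidiagonal.mem_antidiagonal] at hp
        rw [← add_smul]
        congr 1
        rw [add_comm (p.2 : ℂ)]; exact_mod_cast hp.symm
      rw [sum_congr rfl h3, sum_add_distrib, Finset.Nat.sum_antidiagonal_succ',
        Finset.Nat.sum_antidiagonal_succ
          (f := fun p => (p.1 : ℂ) • (z p.1 * coeff p.2 (PowerSeries.exp ℂ) • Z ^ p.2))]
      simp
    have := congrArg (fun t => ((n : ℂ) + 1)⁻¹ • t) key
    simpa only [smul_smul, inv_mul_cancel₀ (hne n), one_smul] using this

theorem fexp_add {y z : PowerSeries A} (hy : constantCoeff y = 0) (hz : constantCoeff z = 0)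
    (h : Commute y z) : fexp (y + z) = fexp y * fexp z := by
  have hE := fun {u : PowerSeries A} (hu : constantCoeff u = 0) =>
    adm_smul_pow (fun m => coeff m (PowerSeries.exp ℂ)) hu
  simp only [fexp, ev_eq_fsum]
  rw [fsum_mul (hE hy) (hE hz)]
  congr 1
  funext n
  rw [h.add_pow', smul_sum]
  refine sum_congr rfl fun p hp => ?_
  rw [HasAntidiagonal.mem_antidiagonal] at hp
  rw [smul_mul_smul_comm, ← Nat.cast_smul_eq_nsmul ℂ, smul_smul]
  congr 1
  subst hp
  have h1 : (p.1.factorial : ℂ) ≠ 0 := by exact_mod_cast p.1.factorial_ne_zero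
  have h2 : (p.2.factorial : ℂ) ≠ 0 := by exact_mod_cast p.2.factorial_ne_zero
  have h3 : ((p.1 + p.2).factorial : ℂ) ≠ 0 := by exact_mod_cast (p.1 + p.2).factorial_ne_zero
  have h4 := Nat.add_choose_mul_factorial_mul_factorial p.1 p.2
  rw [← Nat.choose_symm_add] at h4
  simp
  field_simp
  exact_mod_cast h4

theorem fexp_mul_fexp_neg {y : PowerSeries A} (hy : constantCoeff y = 0) :
    fexp y * fexp (-y) = 1 := by
  rw [← fexp_add hy (constantCoeff_neg' hy) (Commute.refl y).neg_right, add_neg_cancel, fexp_zero]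

theorem fexp_neg_mul_fexp {y : PowerSeries A} (hy : constantCoeff y = 0) :
    fexp (-y) * fexp y = 1 := by
  simpa using fexp_mul_fexp_neg (constantCoeff_neg' hy)

theorem isUnit_fexp {y : PowerSeries A} (hy : constantCoeff y = 0) : IsUnit (fexp y) :=
  ⟨⟨_, _, fexp_mul_fexp_neg hy, fexp_neg_mul_fexp hy⟩, rfl⟩

/-- The case ad(Z)³x = 0. With the factor 2 in `h1`, x₂ already contains the 1/2! of the exponential
series. -/
theorem fexp_mul_quadratic {Z x x₁ x₂ : PowerSeries A} (hZ : constantCoeff Z = 0)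
    (h0 : Z * x = x * Z + x₁) (h1 : Z * x₁ = x₁ * Z + (2 : ℂ) • x₂) (h2 : Z * x₂ = x₂ * Z) :
    fexp Z * x = (x + x₁ + x₂) * fexp Z := by
  let z : ℕ → PowerSeries A := fun | 0 => x | 1 => x₁ | 2 => x₂ | _ + 3 => 0
  have h : ∀ n, Z * z n = z n * Z + ((n : ℂ) + 1) • z (n + 1) := by
    rintro (_ | _ | _ | n)
    · simpa [z] using h0
    · simpa [z, one_add_one_eq_two] using h1
    · simpa [z] using h2
    · simp [z]
  have := fexp_mul_of_ad hZ h
  rwa [fsum_eq_three (adm_of_ad hZ h) (fun n => rfl)] at this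

theorem fexp_mul_linear {Z x x₁ : PowerSeries A} (hZ : constantCoeff Z = 0)
    (h0 : Z * x = x * Z + x₁) (h1 : Z * x₁ = x₁ * Z) : fexp Z * x = (x + x₁) * fexp Z := by
  have := fexp_mul_quadratic (x₂ := 0) hZ h0 (by simpa using h1) (by simp)
  rwa [add_zero] at this

/-- The scalar series `(exp t - 1) / t`. -/
def chiSeries : PowerSeries ℂ := PowerSeries.mk fun n => coeff (n + 1) (PowerSeries.exp ℂ)

theorem X_mul_chiSeries : X * chiSeries = PowerSeries.exp ℂ - 1 := by
  ext n
  rcases n with _ | n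
  · simp
  · rw [coeff_succ_X_mul, chiSeries, coeff_mk, map_sub, coeff_one, if_neg n.succ_ne_zero, sub_zero]

/-- Conjugation by `exp(Z)` of an element `x` with `[Z, x] = y g`, where `[Z, y] = y c`. -/
theorem fexp_mul_eigen {Z x y g c : PowerSeries A} (hZ : constantCoeff Z = 0)
    (hc : constantCoeff c = 0) (h0 : Z * x = x * Z + y * g) (h1 : Z * y = y * Z + y * c)
    (hZg : Commute Z g) (hZc : Commute Z c) (hgc : Commute g c) :
    fexp Z * x = (x + y * (g * ev chiSeries c)) * fexp Z := by
  -- ad(Z)^{n+1} x = y g cⁿ, and the sum of cⁿ/(n+1)! is (exp c - 1)/c.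
  let z : ℕ → PowerSeries A
    | 0 => x
    | n + 1 => coeff (n + 1) (PowerSeries.exp ℂ) • (y * g * c ^ n)
  have h2 : Z * (y * g) = y * g * Z + y * g * c := by
    rw [← mul_assoc, h1, add_mul, mul_assoc, hZg.eq, mul_assoc y c, ← hgc.eq]
    noncomm_ring
  have h : ∀ n, Z * z n = z n * Z + ((n : ℂ) + 1) • z (n + 1) := by
    rintro (_ | n)
    · simpa [z] using h0
    · have h3 : Z * (y * g * c ^ n) = y * g * c ^ n * Z + y * g * c ^ (n + 1) := by
        rw [← mul_assoc, h2, add_mul, mul_assoc, (hZc.pow_right n).eq, pow_succ']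
        noncomm_ring
      have h4 : (((n + 1 : ℕ) : ℂ) + 1) * coeff (n + 2) (PowerSeries.exp ℂ) =
          coeff (n + 1) (PowerSeries.exp ℂ) := by
        have := congrArg (coeff (n + 1)) (derivative_exp ℂ)
        rw [coeff_derivative] at this
        rw [mul_comm, ← this]
      simp only [z]
      rw [mul_smul_comm, h3, smul_add, smul_mul_assoc, smul_smul, h4]
  have h5 : fsum z = x + y * (g * ev chiSeries c) := by
    have hz := adm_of_ad hZ h
    ext n
    rw [coeff_fsum hz (show n < n + 1 + 1 by omega), sum_range_succ', ← mul_assoc, ev_eq_fsum,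
      mul_fsum _ (adm_smul_pow _ hc), map_add, coeff_fsum _ n.lt_succ_self, add_comm]
    · simp [z, chiSeries]
    · intro m i hi
      exact coeff_mul_eq_zero (i := 0) (j := m) (by simp) (adm_smul_pow (fun m => coeff m chiSeries) hc m) (by omega)
  rw [← h5]
  exact fexp_mul_of_ad hZ h

/-! ### Exponential and logarithm -/

/-- For scalar arguments this makes the chain rule for formal substitution available. -/
theorem ev_eq_subst (φ : PowerSeries ℂ) {ψ : PowerSeries ℂ} (hψ : constantCoeff ψ = 0) :
    ev φ ψ = φ.subst ψ := by
  ext n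
  rw [coeff_subst' (HasSubst.of_constantCoeff_zero' hψ), coeff_ev _ hψ n.lt_succ_self,
    finsum_eq_sum_of_support_subset]
  intro m hm
  by_contra h
  simp only [coe_range, Set.mem_Iio, not_lt] at h
  exact hm (by simp only; rw [adm_pow hψ m n (by omega), smul_zero])

theorem derivative_ev (φ : PowerSeries ℂ) {ψ : PowerSeries ℂ} (hψ : constantCoeff ψ = 0) :
    d⁄dX ℂ (ev φ ψ) = ev (d⁄dX ℂ φ) ψ * d⁄dX ℂ ψ := by
  rw [ev_eq_subst _ hψ, ev_eq_subst _ hψ, derivative_subst (HasSubst.of_constantCoeff_zero' hψ)]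

theorem one_add_X_mul_deriv_log : (1 + X) * d⁄dX ℂ (PowerSeries.log ℂ) = 1 := by
  ext n
  rw [add_mul, one_mul, deriv_log]
  rcases n with _ | n
  · simp
  · simp [coeff_succ_X_mul, coeff_one, pow_succ]

/-- With L = log' and g = exp(log), g' = gL. The product gL is constant, equal to 1, and (1+X)L = 1
then forces g = 1 + X. -/
theorem ev_exp_log : ev (PowerSeries.exp ℂ) (PowerSeries.log ℂ) = 1 + X := by
  have hl : constantCoeff (PowerSeries.log ℂ) = 0 := by simp
  set g := ev (PowerSeries.exp ℂ) (PowerSeries.log ℂ)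
  have hg : d⁄dX ℂ g = g * d⁄dX ℂ (PowerSeries.log ℂ) := by
    rw [derivative_ev _ hl, derivative_exp]
  have h1 : g * d⁄dX ℂ (PowerSeries.log ℂ) = 1 := by
    refine derivative.ext ?_ ?_
    -- Differentiating (1+X)L = 1 gives (1+X)L' = -L, so (1+X)(gL)' = gL - gL. The factor 1+X is
    -- then cancelled.
    · have h2 : (1 + X) * d⁄dX ℂ (g * d⁄dX ℂ (PowerSeries.log ℂ)) = 0 := by
        have h3 := congrArg (d⁄dX ℂ) one_add_X_mul_deriv_log
        have h4 := one_add_X_mul_deriv_log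
        simp only [Derivation.leibniz, smul_eq_mul, map_add, Derivation.map_one_eq_zero, hg,
          derivative_X] at h3 ⊢
        linear_combination g * h3 + g * d⁄dX ℂ (PowerSeries.log ℂ) * h4
      have h5 : (1 + X : PowerSeries ℂ) ≠ 0 := fun h => by
        simpa using congrArg constantCoeff h
      rw [(mul_eq_zero.1 h2).resolve_left h5, Derivation.map_one_eq_zero]
    · rw [map_mul, constantCoeff_ev]
      simp [deriv_log]
  linear_combination (1 + X) * h1 - g * one_add_X_mul_deriv_log

theorem ev_log_exp : ev (PowerSeries.log ℂ) (PowerSeries.exp ℂ - 1) = X := by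
  have he : constantCoeff (PowerSeries.exp ℂ - 1) = 0 := by simp
  refine derivative.ext ?_ ?_
  · rw [derivative_ev _ he, map_sub, derivative_exp, Derivation.map_one_eq_zero, sub_zero,
      derivative_X]
    have h := congrArg (fun t => ev t (PowerSeries.exp ℂ - 1)) one_add_X_mul_deriv_log
    simp only [ev_mul _ _ he, ev_add, ev_one, ev_X he, add_sub_cancel] at h
    rw [mul_comm, h]
  · rw [constantCoeff_ev]; simp

theorem fexp_flog1p {y : PowerSeries A} (hy : constantCoeff y = 0) :
    fexp (flog1p y) = 1 + y := by
  rw [fexp, flog1p, ev_ev _ (by simp) hy, ev_exp_log, ev_add, ev_one, ev_X hy]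

theorem flog1p_fexp {y : PowerSeries A} (hy : constantCoeff y = 0) :
    flog1p (fexp y - 1) = y := by
  have h : fexp y - 1 = ev (PowerSeries.exp ℂ - 1) y := by
    rw [sub_eq_add_neg, sub_eq_add_neg, ev_add, ev_neg, ev_one, fexp]
  rw [h, flog1p, ev_ev _ (by simp) hy, ev_log_exp, ev_X hy]

/-- `ln((1 + p)(1 + q)) = ln(1 + p) + ln(1 + q)` for commuting `p`, `q`. -/
theorem flog1p_add {p q : PowerSeries A} (hp : constantCoeff p = 0) (hq : constantCoeff q = 0)
    (h : Commute p q) : flog1p (p + q + p * q) = flog1p p + flog1p q := by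
  -- Commuting logarithms let the exponential of their sum factor; applying the logarithm to that
  -- product gives the additivity.
  have hc : Commute (flog1p p) (flog1p q) := by
    have h1 : Commute p (flog1p q) := ev_semiconj _ hq hq h
    exact (ev_semiconj (PowerSeries.log ℂ) hp hp h1.symm).symm
  have h0 : constantCoeff (flog1p p + flog1p q) = 0 := by
    rw [map_add, constantCoeff_flog1p, constantCoeff_flog1p, add_zero]
  rw [← flog1p_fexp h0, fexp_add (constantCoeff_flog1p _) (constantCoeff_flog1p _) hc,
    fexp_flog1p hp, fexp_flog1p hq]
  congr 1
  noncomm_ring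

end Calculus

/-! ### Commutation relations of the generators -/

section Relations
set_option linter.unusedSimpArgs false
set_option linter.unusedVariables false

attribute [local instance 100] LieRing.ofAssociativeRing

variable {N : ℕ}

theorem single_mul_single_ite {n : Type*} [Fintype n] [DecidableEq n] (i j k l : n) (a b : ℂ) :
    Matrix.single i j a * Matrix.single k l b = if j = k then Matrix.single i l (a * b) else 0 := by
  split_ifs with h
  · subst h; rw [Matrix.single_mul_single_same]
  · exact Matrix.single_mul_single_of_ne (h := h) ..

/-- The generator with label `g` as an element of `U(sp(N))`. -/
abbrev ug (g : Gen N) : U N := UniversalEnvelopingAlgebra.ι ℂ (spGen g)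

/-- Every commutation relation needed in the enveloping algebra becomes an identity of 2N × 2N
matrices. -/
theorem ug_mul_of_eq {g g' : Gen N} (z : Sp N)
    (h : genMatrix g * genMatrix g' = genMatrix g' * genMatrix g + z.1) :
    ug g * ug g' = ug g' * ug g + UniversalEnvelopingAlgebra.ι ℂ z := by
  have h1 : ⁅spGen g, spGen g'⁆ = z := Subtype.ext (by
    rw [← sub_eq_iff_eq_add'] at h
    exact h)
  rw [← h1, LieHom.map_lie]
  exact (add_sub_cancel _ _).symm

theorem ug_commute {g g' : Gen N} (h : genMatrix g * genMatrix g' = genMatrix g' * genMatrix g) :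
    ug g * ug g' = ug g' * ug g := by
  rw [ug_mul_of_eq 0 (by rw [h]; exact (add_zero _).symm), map_zero, add_zero]

variable {k l m i j : Fin N}

theorem M_M (hl : k ≠ l) (hm : k ≠ m) : ug (.M k l) * ug (.M k m) = ug (.M k m) * ug (.M k l) :=
  ug_commute (by
    simp [genMatrix, Matrix.fromBlocks_multiply, hl, hm, hl.symm, hm.symm])

theorem E_E (i j l m : Fin N) : ug (.E i j) * ug (.E l m) = ug (.E l m) * ug (.E i j) :=
  ug_commute (by simp [genMatrix, Matrix.fromBlocks_multiply])

theorem M_E (hl : k ≠ l) (hm : k ≠ m) : ug (.M k l) * ug (.E k m) =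
    ug (.E k m) * ug (.M k l) + if l = m then ug (.E k k) else 0 := by
  rw [ug_mul_of_eq (if l = m then spGen (.E k k) else 0)]
  · split_ifs <;> simp
  · by_cases h : l = m
    · subst h
      simp [genMatrix, spGen, Matrix.fromBlocks_multiply, single_mul_single_ite, hl, hl.symm,
        Matrix.fromBlocks_add, mul_add, add_mul]
    · simp [genMatrix, Matrix.fromBlocks_multiply, single_mul_single_ite, hl, hm, hl.symm, hm.symm,
        h, Ne.symm h, Matrix.fromBlocks_add, mul_add, add_mul]

theorem M_Ekk (hl : k ≠ l) : ug (.M k l) * ug (.E k k) = ug (.E k k) * ug (.M k l) :=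
  ug_commute (by
    simp [genMatrix, Matrix.fromBlocks_multiply, single_mul_single_ite, hl, hl.symm, mul_add, add_mul])

theorem H_M (hl : k ≠ l) : ug (.H k) * ug (.M k l) =
    ug (.M k l) * ug (.H k) + (1 / 2 : ℂ) • ug (.M k l) := by
  rw [ug_mul_of_eq ((1 / 2 : ℂ) • spGen (.M k l)), map_smul]
  simp [genMatrix, spGen, Matrix.fromBlocks_multiply, single_mul_single_ite, hl, hl.symm,
    Matrix.fromBlocks_add, Matrix.fromBlocks_smul, mul_add, add_mul]

theorem H_E (hl : k ≠ l) : ug (.H k) * ug (.E k l) =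
    ug (.E k l) * ug (.H k) + (1 / 2 : ℂ) • ug (.E k l) := by
  rw [ug_mul_of_eq ((1 / 2 : ℂ) • spGen (.E k l)), map_smul]
  simp [genMatrix, spGen, Matrix.fromBlocks_multiply, single_mul_single_ite, hl, hl.symm,
    Matrix.fromBlocks_add, Matrix.fromBlocks_smul, mul_add, add_mul]

theorem H_Ekk : ug (.H k) * ug (.E k k) = ug (.E k k) * ug (.H k) + ug (.E k k) := by
  rw [ug_mul_of_eq (spGen (.E k k))]
  simp [genMatrix, spGen, Matrix.fromBlocks_multiply, single_mul_single_ite,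
    Matrix.fromBlocks_add, mul_add, add_mul]
  simp only [Matrix.single_neg, ← Matrix.single_add]
  norm_num

/-- The index `k` does not occur in `g`, so both matrix products vanish. -/
theorem H_comm {g : Gen N} (hg : g.InTail (k + 1)) : ug (.H k) * ug g = ug g * ug (.H k) := by
  refine ug_commute ?_
  have h : ∀ {i : Fin N}, (k : ℕ) + 1 ≤ i → k ≠ i := fun h h' => by subst h'; omega
  rcases g with ⟨i, j⟩ | ⟨i, j⟩ | ⟨i, j⟩ | i
  · have h1 := h hg.1; have h2 := h hg.2
    simp [genMatrix, Matrix.fromBlocks_multiply, h1, h2, h1.symm, h2.symm, mul_add, add_mul]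
  · have h1 := h hg.1; have h2 := h hg.2
    simp [genMatrix, Matrix.fromBlocks_multiply, h1, h2, h1.symm, h2.symm, mul_add, add_mul]
  · have h1 := h hg.1; have h2 := h hg.2.1
    simp [genMatrix, Matrix.fromBlocks_multiply, h1, h2, h1.symm, h2.symm]
  · have h1 := h hg
    simp [genMatrix, Matrix.fromBlocks_multiply, h1, h1.symm]

theorem Ekk_comm {g : Gen N} (hg : g.InTail (k + 1)) :
    ug (.E k k) * ug g = ug g * ug (.E k k) := by
  refine ug_commute ?_
  have h : ∀ {i : Fin N}, (k : ℕ) + 1 ≤ i → k ≠ i := fun h h' => by subst h'; omega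
  rcases g with ⟨i, j⟩ | ⟨i, j⟩ | ⟨i, j⟩ | i
  · simp [genMatrix, Matrix.fromBlocks_multiply]
  · have h1 := h hg.1; have h2 := h hg.2
    simp [genMatrix, Matrix.fromBlocks_multiply, h1, h2, h1.symm, h2.symm, mul_add, add_mul]
  · have h1 := h hg.1; have h2 := h hg.2.1
    simp [genMatrix, Matrix.fromBlocks_multiply, h1, h2, h1.symm, h2.symm, mul_add, add_mul]
  · have h1 := h hg
    simp [genMatrix, Matrix.fromBlocks_multiply, h1, h1.symm, mul_add, add_mul]

/-- Both deltas fire when i = j = l, in keeping with the matrix of `E i i` having entry 2. This lets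
long and short roots be treated uniformly. -/
theorem M_Eij (hl : k ≠ l) (hi : k ≠ i) (hj : k ≠ j) : ug (.M k l) * ug (.E i j) =
    ug (.E i j) * ug (.M k l) +
      ((if l = i then ug (.E k j) else 0) + if l = j then ug (.E k i) else 0) := by
  rw [ug_mul_of_eq ((if l = i then spGen (.E k j) else 0) + if l = j then spGen (.E k i) else 0)]
  · split_ifs <;> simp
  · by_cases hij : i = j <;> by_cases h : l = i <;> by_cases h' : l = j <;>
      simp_all [eq_comm (a := j) (b := i), Matrix.fromBlocks_neg, genMatrix, spGen, Matrix.fromBlocks_multiply, single_mul_single_ite, hi, hj, hl,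
        hi.symm, hj.symm, hl.symm, h, h', eq_comm (a := i) (b := l), eq_comm (a := j) (b := l), Matrix.fromBlocks_add, mul_add, add_mul]
    abel

theorem M_Fij (hi : k ≠ i) (hj : k ≠ j) :
    ug (.M k l) * ug (.F i j) = ug (.F i j) * ug (.M k l) :=
  ug_commute (by
    simp [genMatrix, Matrix.fromBlocks_multiply, single_mul_single_ite, hi, hj, hi.symm, hj.symm,
      mul_add, add_mul])

theorem E_Fij (hi : k ≠ i) (hj : k ≠ j) : ug (.E k l) * ug (.F i j) =
    ug (.F i j) * ug (.E k l) +
      ((if l = i then ug (.M k j) else 0) + if l = j then ug (.M k i) else 0) := by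
  rw [ug_mul_of_eq ((if l = i then spGen (.M k j) else 0) + if l = j then spGen (.M k i) else 0)]
  · split_ifs <;> simp
  · by_cases hij : i = j <;> by_cases h : l = i <;> by_cases h' : l = j <;>
      simp_all [eq_comm (a := j) (b := i), Matrix.fromBlocks_neg, genMatrix, spGen, Matrix.fromBlocks_multiply, single_mul_single_ite, hi, hj,
        hi.symm, hj.symm, h, h', eq_comm (a := i) (b := l), eq_comm (a := j) (b := l), Matrix.fromBlocks_add, mul_add, add_mul]

theorem M_Mij (hj : k ≠ j) : ug (.M k l) * ug (.M i j) =
    ug (.M i j) * ug (.M k l) + if l = i then ug (.M k j) else 0 := by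
  rw [ug_mul_of_eq (if l = i then spGen (.M k j) else 0)]
  · split_ifs <;> simp
  · by_cases h : l = i <;>
      simp [genMatrix, spGen, Matrix.fromBlocks_multiply, single_mul_single_ite, hj,
        hj.symm, h, eq_comm (a := i) (b := l), Matrix.fromBlocks_add]

theorem E_Mij (hj : k ≠ j) : ug (.E k l) * ug (.M i j) =
    ug (.M i j) * ug (.E k l) - if l = j then ug (.E k i) else 0 := by
  rw [ug_mul_of_eq (-if l = j then spGen (.E k i) else 0), map_neg, ← sub_eq_add_neg]
  · split_ifs <;> simp
  · by_cases h : l = j <;>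
      simp [Matrix.fromBlocks_neg, genMatrix, spGen, Matrix.fromBlocks_multiply, single_mul_single_ite, hj,
        hj.symm, h, eq_comm (a := j) (b := l), Matrix.fromBlocks_add, mul_add, add_mul]

theorem M_Hi (hi : k ≠ i) : ug (.M k l) * ug (.H i) =
    ug (.H i) * ug (.M k l) + if l = i then (1 / 2 : ℂ) • ug (.M k l) else 0 := by
  rw [ug_mul_of_eq (if l = i then (1 / 2 : ℂ) • spGen (.M k l) else 0)]
  · split_ifs <;> simp
  · by_cases h : l = i <;>
      simp [genMatrix, spGen, Matrix.fromBlocks_multiply, single_mul_single_ite, hi,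
        hi.symm, h, eq_comm (a := i) (b := l), Matrix.fromBlocks_add, Matrix.fromBlocks_smul]

theorem E_Hi (hi : k ≠ i) : ug (.E k l) * ug (.H i) =
    ug (.H i) * ug (.E k l) - if l = i then (1 / 2 : ℂ) • ug (.E k l) else 0 := by
  rw [ug_mul_of_eq (-if l = i then (1 / 2 : ℂ) • spGen (.E k l) else 0), map_neg, ← sub_eq_add_neg]
  · split_ifs <;> simp
  · by_cases h : l = i <;>
      simp [genMatrix, spGen, Matrix.fromBlocks_multiply, single_mul_single_ite, hi,
        hi.symm, h, eq_comm (a := i) (b := l), Matrix.fromBlocks_add, Matrix.fromBlocks_smul, mul_add, add_mul, Matrix.fromBlocks_neg]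

end Relations

/-! ### The Heisenberg relations of a link -/

section Link

open PowerSeries Finset

variable {N : ℕ}

theorem xi_comm (x : U1 N) : x * xi = xi * x := commute_X x

theorem C_smul' (c : ℂ) (x : U N) : (C (c • x) : U1 N) = c • C x := by
  ext n
  rw [coeff_smul, coeff_C, coeff_C]
  split_ifs <;> simp

variable {k l m i j : Fin N}

theorem initial_rel {g g' : Gen N} {z : U N} (h : ug g * ug g' = ug g' * ug g + z) :
    initial N g * initial N g' = initial N g' * initial N g + C z := by
  simp only [initial]
  rw [← map_mul, h, map_add, map_mul]

theorem initial_comm {g g' : Gen N} (h : ug g * ug g' = ug g' * ug g) :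
    initial N g * initial N g' = initial N g' * initial N g := by
  simp only [initial]
  rw [← map_mul, h, map_mul]

theorem a_b (hl : k < l) (hm : k < m) : initial N (.M k l) * initial N (.E k m) =
    initial N (.E k m) * initial N (.M k l) + if l = m then initial N (.E k k) else 0 := by
  rw [initial_rel (M_E hl.ne hm.ne)]
  split_ifs <;> simp [initial]

theorem a_Eij (hl : k < l) (hi : k < i) (hj : k < j) : initial N (.M k l) * initial N (.E i j) =
    initial N (.E i j) * initial N (.M k l) +
      ((if l = i then initial N (.E k j) else 0) + if l = j then initial N (.E k i) else 0) := by
  rw [initial_rel (M_Eij hl.ne hi.ne hj.ne)]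
  split_ifs <;> simp [initial]

theorem b_Fij (hi : k < i) (hj : k < j) : initial N (.E k l) * initial N (.F i j) =
    initial N (.F i j) * initial N (.E k l) +
      ((if l = i then initial N (.M k j) else 0) + if l = j then initial N (.M k i) else 0) := by
  rw [initial_rel (E_Fij hi.ne hj.ne)]
  split_ifs <;> simp [initial]

theorem a_Mij (hj : k < j) : initial N (.M k l) * initial N (.M i j) =
    initial N (.M i j) * initial N (.M k l) + if l = i then initial N (.M k j) else 0 := by
  rw [initial_rel (M_Mij hj.ne)]
  split_ifs <;> simp [initial]

theorem b_Mij (hj : k < j) : initial N (.E k l) * initial N (.M i j) =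
    initial N (.M i j) * initial N (.E k l) - if l = j then initial N (.E k i) else 0 := by
  rw [initial_rel (z := - if l = j then ug (.E k i) else 0) (by rw [E_Mij hj.ne, sub_eq_add_neg])]
  split_ifs <;> simp [initial, sub_eq_add_neg]

theorem a_Hi (hi : k < i) : initial N (.M k l) * initial N (.H i) =
    initial N (.H i) * initial N (.M k l) +
      if l = i then (1 / 2 : ℂ) • initial N (.M k l) else 0 := by
  rw [initial_rel (M_Hi hi.ne)]
  split_ifs
  · rw [C_smul']; rfl
  · simp

theorem b_Hi (hi : k < i) : initial N (.E k l) * initial N (.H i) =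
    initial N (.H i) * initial N (.E k l) -
      if l = i then (1 / 2 : ℂ) • initial N (.E k l) else 0 := by
  rw [initial_rel (z := - if l = i then (1 / 2 : ℂ) • ug (.E k l) else 0)
    (by rw [E_Hi hi.ne, sub_eq_add_neg])]
  split_ifs
  · rw [map_neg, C_smul', sub_eq_add_neg]; rfl
  · simp

theorem h_a (hl : k < l) : initial N (.H k) * initial N (.M k l) =
    initial N (.M k l) * initial N (.H k) + (1 / 2 : ℂ) • initial N (.M k l) := by
  rw [initial_rel (H_M hl.ne), C_smul']; rfl

theorem h_b (hl : k < l) : initial N (.H k) * initial N (.E k l) =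
    initial N (.E k l) * initial N (.H k) + (1 / 2 : ℂ) • initial N (.E k l) := by
  rw [initial_rel (H_E hl.ne), C_smul']; rfl

/-! ### Exponentials e^{±σ/2} and the dressed Heisenberg relations. -/

/-- `ξ E_{k+k}` in the initial generators. -/
abbrev eE (k : Fin N) : U1 N := scaledE (initial N) k

/-- `e^{-σ/2}` in the initial generators. -/
def wE (k : Fin N) : U1 N := fexp (-((1 / 2 : ℂ) • sigma (initial N) k))

/-- `e^{σ/2}` in the initial generators. -/
def vE (k : Fin N) : U1 N := fexp ((1 / 2 : ℂ) • sigma (initial N) k)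

/-- `ξ E_{k+l} e^{-σ/2}` in the initial generators. -/
def bW (k l : Fin N) : U1 N := xi * initial N (.E k l) * wE k

theorem h_e (k : Fin N) : initial N (.H k) * eE k = eE k * initial N (.H k) + eE k := by
  have h : initial N (.H k) * initial N (.E k k) =
      initial N (.E k k) * initial N (.H k) + initial N (.E k k) := initial_rel H_Ekk
  rw [eE, scaledE, ← mul_assoc, xi_comm, mul_assoc, h, mul_add, mul_assoc]

theorem const_xi_mul (x : U1 N) : constantCoeff (xi * x) = 0 := by simp [xi]

theorem const_e (k : Fin N) : constantCoeff (eE k) = 0 := const_xi_mul _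

theorem const_sigma (k : Fin N) : constantCoeff (sigma (initial N) k) = 0 := constantCoeff_flog1p _

theorem const_smul {A : Type*} [Ring A] [Algebra ℂ A] (c : ℂ) {y : PowerSeries A}
    (hy : constantCoeff y = 0) : constantCoeff (c • y) = 0 := by
  rw [constantCoeff_smul, hy, smul_zero]

theorem const_half (k : Fin N) : constantCoeff ((1 / 2 : ℂ) • sigma (initial N) k) = 0 :=
  const_smul _ (const_sigma k)

theorem comm_ev {x : U1 N} (h : Commute x (eE k)) (φ : PowerSeries ℂ) : Commute x (ev φ (eE k)) :=
  ev_semiconj φ (const_e k) (const_e k) h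

theorem comm_sigma {x : U1 N} (h : Commute x (eE k)) : Commute x (sigma (initial N) k) :=
  comm_ev h _

theorem comm_vE {x : U1 N} (h : Commute x (eE k)) : Commute x (vE k) :=
  ev_semiconj _ (const_half k) (const_half k) ((comm_sigma h).smul_right _)

theorem comm_wE {x : U1 N} (h : Commute x (eE k)) : Commute x (wE k) :=
  ev_semiconj _ (constantCoeff_neg' (const_half k)) (constantCoeff_neg' (const_half k))
    ((comm_sigma h).smul_right _).neg_right

theorem comm_e_of {g : Gen N} (h : ug g * ug (.E k k) = ug (.E k k) * ug g) :
    Commute (initial N g) (eE k) :=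
  (commute_X (initial N g)).mul_right (initial_comm h)

theorem a_e (hl : k < l) : Commute (initial N (.M k l)) (eE k) := comm_e_of (M_Ekk hl.ne)

theorem b_e (l : Fin N) : Commute (initial N (.E k l)) (eE k) := comm_e_of (E_E _ _ _ _)

theorem tail_e {g : Gen N} (hg : g.InTail (k + 1)) : Commute (initial N g) (eE k) :=
  comm_e_of (Ekk_comm hg).symm

theorem tail_h {g : Gen N} (hg : g.InTail (k + 1)) :
    Commute (initial N g) (initial N (.H k)) := initial_comm (H_comm hg).symm

theorem a_a (hl : k < l) (hm : k < m) :
    Commute (initial N (.M k l)) (initial N (.M k m)) := initial_comm (M_M hl.ne hm.ne)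

theorem b_b (i j l m : Fin N) : Commute (initial N (.E i j)) (initial N (.E l m)) :=
  initial_comm (E_E ..)

theorem a_Fij (hi : k < i) (hj : k < j) :
    Commute (initial N (.M k l)) (initial N (.F i j)) := initial_comm (M_Fij hi.ne hj.ne)

theorem w_mul_v (k : Fin N) : wE k * vE k = 1 := fexp_neg_mul_fexp (const_half k)

theorem v_mul_w (k : Fin N) : vE k * wE k = 1 := fexp_mul_fexp_neg (const_half k)

theorem v_mul_v (k : Fin N) : vE k * vE k = 1 + eE k := by
  rw [vE, ← fexp_add (const_half k) (const_half k) (Commute.refl _), ← add_smul]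
  norm_num
  exact fexp_flog1p (const_e k)

theorem w_mul_w (k : Fin N) : wE k * wE k = fexp (-sigma (initial N) k) := by
  rw [wE, ← fexp_add (constantCoeff_neg' (const_half k)) (constantCoeff_neg' (const_half k))
    (Commute.refl _), ← neg_add, ← add_smul]
  norm_num

/-- This is e^{-σ/2} e^σ = e^{σ/2}, the one identity behind both the twisted coproducts of the link
and its cocycle equation. -/
theorem w_u (k : Fin N) : wE k * (1 + eE k) = vE k := by
  rw [← v_mul_v, ← mul_assoc, w_mul_v, one_mul]

theorem w_comm_e (k : Fin N) : Commute (wE k) (eE k) := (comm_wE (Commute.refl _)).symm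

theorem bW_e (l : Fin N) : Commute (bW k l) (eE k) :=
  ((commute_X (eE k)).symm.mul_left (b_e l)).mul_left (w_comm_e k)

/-- The Heisenberg relation survives dressing because e^{-σ/2} commutes with E_{k-l}. -/
theorem a_bW (hl : k < l) (hm : k < m) : initial N (.M k l) * bW k m =
    bW k m * initial N (.M k l) + if l = m then eE k * wE k else 0 := by
  have h1 := (comm_wE (a_e hl)).eq
  rw [bW, ← mul_assoc, ← mul_assoc, xi_comm, mul_assoc xi, a_b hl hm, mul_add, add_mul,
    mul_assoc _ (wE k), ← h1]
  congr 1
  · noncomm_ring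
  · split_ifs <;> simp [scaledE]

theorem bW_bW (l m : Fin N) : Commute (bW k l) (bW k m) := by
  have h1 : Commute (bW k m) (wE k) := comm_wE (bW_e m)
  have h2 : Commute (bW k m) (initial N (.E k l)) :=
    ((commute_X _).symm.mul_left (b_b ..)).mul_left (comm_wE (b_e l)).symm
  exact ((((commute_X (bW k m)).mul_right h2).mul_right h1)).symm

/-! ### Conjugation by `s_k` -/

/-- The quadratic element `∑ ξ E_{k-i} E_{k+i}`. -/
def quadE (k : Fin N) : U1 N :=
  ∑ i ∈ Finset.univ.filter (fun i => k < i), xi * initial N (.M k i) * initial N (.E k i)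

/-- The exponent of `s_k`. -/
def sExp (k : Fin N) : U1 N := quadE k * ev fSeries (eE k)

theorem const_sExp (k : Fin N) : constantCoeff (sExp k) = 0 := by
  have : constantCoeff (quadE k) = 0 := by
    rw [quadE, map_sum]
    exact sum_eq_zero fun i _ => by rw [mul_assoc]; exact const_xi_mul _
  rw [sExp, map_mul, this, zero_mul]

theorem quadE_e (k : Fin N) : Commute (quadE k) (eE k) :=
  Commute.sum_left _ _ _ fun i hi =>
    ((commute_X _).symm.mul_left (a_e (mem_filter.1 hi).2)).mul_left (b_e i)

theorem sExp_e (k : Fin N) : Commute (sExp k) (eE k) :=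
  (quadE_e k).mul_left (comm_ev (Commute.refl _) _).symm

/-- Commutators with `∑ ξ E_{k-i} E_{k+i}` are computed termwise. -/
theorem quadE_mul_of {x : U1 N} {p q : Fin N → U1 N}
    (ha : ∀ l, k < l → initial N (.M k l) * x = x * initial N (.M k l) + p l)
    (hb : ∀ l, k < l → initial N (.E k l) * x = x * initial N (.E k l) + q l) :
    quadE k * x = x * quadE k + ∑ l ∈ Finset.univ.filter (fun i => k < i),
      xi * (p l * initial N (.E k l) + initial N (.M k l) * q l) := by
  rw [quadE, sum_mul, mul_sum, ← sum_add_distrib]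
  refine sum_congr rfl fun l hl => ?_
  have hl := (mem_filter.1 hl).2
  calc _ = xi * (initial N (.M k l) * (initial N (.E k l) * x)) := by noncomm_ring
    _ = xi * (initial N (.M k l) * x * initial N (.E k l) + initial N (.M k l) * q l) := by
        rw [hb l hl]; noncomm_ring
    _ = xi * x * (initial N (.M k l) * initial N (.E k l)) +
        xi * (p l * initial N (.E k l) + initial N (.M k l) * q l) := by
        rw [ha l hl]; noncomm_ring
    _ = _ := by rw [← xi_comm x]; noncomm_ring

/-- Only the summand l = i fails to commute with E_{k+i}. The elements E_{k+i} and E_{k-i} are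
eigenvectors of ad(∑ ξ E_{k-l} E_{k+l}) with opposite eigenvalues, up to central functions of
E_{k+k}. -/
theorem quadE_b (hi : k < i) : quadE k * initial N (.E k i) =
    initial N (.E k i) * quadE k + initial N (.E k i) * eE k := by
  rw [quadE_mul_of (p := fun l => if l = i then initial N (.E k k) else 0) (q := fun _ => 0)
    (fun l hl => a_b hl hi) (fun l _ => by rw [add_zero]; exact b_b ..), sum_eq_single i]
  · rw [if_pos rfl, mul_zero, add_zero, ← mul_assoc, (b_e i).eq]; rfl
  · intro l _ hl; simp [hl]
  · intro h; exact absurd (mem_filter.2 ⟨mem_univ i, hi⟩) h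

theorem quadE_a (hi : k < i) : quadE k * initial N (.M k i) =
    initial N (.M k i) * quadE k - initial N (.M k i) * eE k := by
  rw [quadE_mul_of (q := fun l => - if l = i then initial N (.E k k) else 0) (p := fun _ => 0)
    (fun l hl => by rw [add_zero, (a_a hl hi).eq]) (fun l hl => by
      rw [← sub_eq_add_neg, eq_sub_iff_add_eq]
      by_cases h : l = i
      · subst h; rw [a_b hl hl]
      · have := a_b hi hl
        rw [if_neg (Ne.symm h), add_zero] at this
        rw [if_neg h, add_zero, this]), sum_eq_single i]
  · rw [if_pos rfl, zero_mul, zero_add, sub_eq_add_neg, ← mul_neg]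
    simp only [eE, scaledE]
    rw [← mul_assoc, ← xi_comm, mul_assoc, mul_neg]
  · intro l _ hl; simp [hl]
  · intro h; exact absurd (mem_filter.2 ⟨mem_univ i, hi⟩) h

theorem e_mul_f (k : Fin N) : eE k * ev fSeries (eE k) = -((1 / 2 : ℂ) • sigma (initial N) k) := by
  have h : X * fSeries = -((1 / 2 : ℂ) • PowerSeries.log ℂ) := by
    have := congrArg (fun t => (1 / 2 : ℂ) • t) fSeries_spec
    simp only [smul_neg] at this
    rw [← this, mul_assoc, two_mul, ← two_smul ℂ, smul_smul]
    norm_num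
  have h2 := congrArg (fun t => ev t (eE k)) h
  simp only [ev_mul _ _ (const_e k), ev_X (const_e k), ev_neg, ev_smul] at h2
  exact h2

/-- With σ = ln(1+t), 2f(t) = -σ/t and (e^σ - 1)/σ = t/σ. It is checked after multiplication by t,
which avoids division. -/
theorem scalar_identity_pos :
    ((2 : ℂ) • fSeries) * ev chiSeries (PowerSeries.log ℂ) = -1 := by
  have hl : constantCoeff (PowerSeries.log ℂ) = 0 := by simp
  have h := congrArg (fun t => ev t (PowerSeries.log ℂ)) X_mul_chiSeries
  simp only [ev_mul _ _ hl, ev_X hl, sub_eq_add_neg, ev_add, ev_neg, ev_one, ev_exp_log] at h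
  have h2 := fSeries_spec
  refine mul_left_cancel₀ (X_ne_zero (R := ℂ)) ?_
  rw [two_smul]
  linear_combination ev chiSeries (PowerSeries.log ℂ) * h2 - h

/-- Here (e^{-σ} - 1)/(-σ) times -σ/t is (e^{-σ} - 1)/t = -1/(1+t). This is the source of e^{-σ} in
the basis change of E_{i+j}, absent from that of F_{i+j}. -/
theorem scalar_identity_neg : ((2 : ℂ) • fSeries) * ev chiSeries (-PowerSeries.log ℂ) =
    -ev (PowerSeries.exp ℂ) (-PowerSeries.log ℂ) := by
  have hl : constantCoeff (PowerSeries.log ℂ) = 0 := by simp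
  have hl' : constantCoeff (-PowerSeries.log ℂ) = 0 := by simp
  have h := congrArg (fun t => ev t (-PowerSeries.log ℂ)) X_mul_chiSeries
  simp only [ev_mul _ _ hl', ev_X hl', sub_eq_add_neg, ev_add, ev_neg, ev_one] at h
  have h1 : ev (PowerSeries.exp ℂ) (PowerSeries.log ℂ) *
    ev (PowerSeries.exp ℂ) (-PowerSeries.log ℂ) = 1 := fexp_mul_fexp_neg hl
  rw [ev_exp_log] at h1
  have h2 := fSeries_spec
  refine mul_left_cancel₀ (X_ne_zero (R := ℂ)) ?_
  rw [two_smul]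
  linear_combination ev chiSeries (-PowerSeries.log ℂ) * h2 + h + h1

theorem g_chi_pos (k : Fin N) :
    (2 : ℂ) • ev fSeries (eE k) * ev chiSeries (sigma (initial N) k) = -1 := by
  have h := congrArg (fun t => ev t (eE k)) scalar_identity_pos
  simp only [ev_mul _ _ (const_e k), ev_smul, ev_neg, ev_one] at h
  rw [← h, ← ev_ev _ (by simp) (const_e k)]; rfl

theorem g_chi_neg (k : Fin N) :
    (2 : ℂ) • ev fSeries (eE k) * ev chiSeries (-sigma (initial N) k) =
      -fexp (-sigma (initial N) k) := by
  have h := congrArg (fun t => ev t (eE k)) scalar_identity_neg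
  simp only [ev_mul _ _ (const_e k), ev_smul, ev_neg,
    ← ev_ev _ (show constantCoeff (-PowerSeries.log ℂ) = 0 by simp) (const_e k)] at h
  exact h

/-- Conjugation by `s_k` of an element `x` with `[∑ ξ E_{k-i} E_{k+i}, x] = 2 y`. -/
theorem sElt_conj_of {x y c : U1 N} (hx : Commute x (eE k))
    (h0 : quadE k * x = x * quadE k + (2 : ℂ) • y) (h1 : sExp k * y = y * sExp k + y * c)
    (hc : constantCoeff c = 0) (hce : ∀ {z : U1 N}, Commute z (eE k) → Commute z c) :
    sElt (initial N) k * x =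
      (x + y * ((2 : ℂ) • ev fSeries (eE k) * ev chiSeries c)) * sElt (initial N) k := by
  refine fexp_mul_eigen (const_sExp k) hc ?_ h1 ((comm_ev (sExp_e k) _).smul_right _)
    (hce (sExp_e k)) ((hce (comm_ev (Commute.refl _) _).symm).smul_left _)
  change quadE k * ev fSeries (eE k) * x = x * (quadE k * ev fSeries (eE k)) + _
  rw [mul_assoc, ← (comm_ev hx fSeries).eq, ← mul_assoc, h0, add_mul, mul_assoc, smul_mul_assoc,
    mul_smul_comm]

theorem sExp_b (hi : k < i) : sExp k * initial N (.E k i) =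
    initial N (.E k i) * sExp k + initial N (.E k i) * -((1 / 2 : ℂ) • sigma (initial N) k) := by
  rw [← e_mul_f, sExp, mul_assoc, ← (comm_ev (b_e i) fSeries).eq, ← mul_assoc, quadE_b hi]
  noncomm_ring

theorem sExp_a (hi : k < i) : sExp k * initial N (.M k i) =
    initial N (.M k i) * sExp k + initial N (.M k i) * ((1 / 2 : ℂ) • sigma (initial N) k) := by
  rw [← neg_neg ((1 / 2 : ℂ) • sigma (initial N) k), ← e_mul_f, sExp, mul_assoc,
    ← (comm_ev (a_e hi) fSeries).eq, ← mul_assoc, quadE_a hi]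
  noncomm_ring

/-- Leibniz rule: eigenvalues add under multiplication. -/
theorem ad_mul {Z x y c : U1 N} (hx : Z * x = x * Z + x * c) (hy : Z * y = y * Z + y * c)
    (hc : Commute y c) : Z * (xi * x * y) = xi * x * y * Z + xi * x * y * (c + c) := by
  calc Z * (xi * x * y) = xi * (Z * x) * y := by rw [← mul_assoc, ← mul_assoc, xi_comm]; noncomm_ring
    _ = xi * x * (Z * y) + xi * x * (c * y) := by rw [hx]; noncomm_ring
    _ = _ := by rw [hy, ← hc.eq]; noncomm_ring

theorem half_add_half (x : U1 N) : (1 / 2 : ℂ) • x + (1 / 2 : ℂ) • x = x := by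
  rw [← add_smul]; norm_num

theorem sum_two_deltas {c : Fin N → U1 N} (hi : k < i) (hj : k < j) (x y : U1 N) :
    ∑ l ∈ Finset.univ.filter (fun i => k < i),
      xi * (c l * ((if l = i then x else 0) + if l = j then y else 0)) =
      xi * (c i * x) + xi * (c j * y) := by
  simp [mul_add, sum_add_distrib, mul_ite, hi, hj]

/-- Both factors of ξ E_{k+i} E_{k+j} have eigenvalue -σ/2, so the correction has eigenvalue -σ and
`g_chi_neg` evaluates the series. -/
theorem sElt_E (hi : k < i) (hj : k < j) : sElt (initial N) k * initial N (.E i j) =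
    basisChange k (initial N) (.E i j) * sElt (initial N) k := by
  have hx : Commute (initial N (.E i j)) (eE k) :=
    ((commute_X _).mul_right (b_b ..))
  have h0 : quadE k * initial N (.E i j) = initial N (.E i j) * quadE k +
      (2 : ℂ) • (xi * initial N (.E k i) * initial N (.E k j)) := by
    rw [quadE_mul_of (q := fun _ => 0) (fun l hl => a_Eij hl hi hj)
      (fun l hl => by rw [add_zero]; exact b_b ..)]
    simp only [mul_zero, add_zero]
    have h1 : ∀ l, ((if l = i then initial N (.E k j) else 0) + if l = j then initial N (.E k i) else 0)
        * initial N (.E k l) = initial N (.E k l) *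
        ((if l = i then initial N (.E k j) else 0) + if l = j then initial N (.E k i) else 0) := by
      intro l
      rw [add_mul, mul_add]
      congr 1 <;> split_ifs <;> simp [(b_b _ _ _ _).eq]
    simp only [h1]
    rw [sum_two_deltas hi hj, (b_b k j k i).eq, two_smul, mul_assoc]
  have h1 : sExp k * (xi * initial N (.E k i) * initial N (.E k j)) =
      xi * initial N (.E k i) * initial N (.E k j) * sExp k +
      xi * initial N (.E k i) * initial N (.E k j) * -sigma (initial N) k := by
    rw [ad_mul (sExp_b hi) (sExp_b hj) ((comm_sigma (b_e j)).smul_right _).neg_right, ← neg_add,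
      half_add_half]
  rw [sElt_conj_of hx h0 h1 (constantCoeff_neg' (const_sigma k))
    (fun h => (comm_sigma h).neg_right), g_chi_neg, mul_neg, ← sub_eq_add_neg]
  rfl

/-- Now the eigenvector is ξ E_{k-i} E_{k-j}, of eigenvalue σ, and `g_chi_pos` applies. -/
theorem sElt_F (hi : k < i) (hj : k < j) : sElt (initial N) k * initial N (.F i j) =
    basisChange k (initial N) (.F i j) * sElt (initial N) k := by
  have hx : Commute (initial N (.F i j)) (eE k) := tail_e (g := .F i j) ⟨hi, hj⟩
  have h0 : quadE k * initial N (.F i j) = initial N (.F i j) * quadE k +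
      (2 : ℂ) • (xi * initial N (.M k i) * initial N (.M k j)) := by
    rw [quadE_mul_of (p := fun _ => 0) (fun l hl => by rw [add_zero]; exact a_Fij hi hj)
      (fun l hl => b_Fij hi hj)]
    simp only [zero_mul, zero_add]
    rw [sum_two_deltas hi hj, (a_a hj hi).eq, two_smul, mul_assoc]
  have h1 : sExp k * (xi * initial N (.M k i) * initial N (.M k j)) =
      xi * initial N (.M k i) * initial N (.M k j) * sExp k +
      xi * initial N (.M k i) * initial N (.M k j) * sigma (initial N) k := by
    rw [ad_mul (sExp_a hi) (sExp_a hj) ((comm_sigma (a_e hj)).smul_right _), half_add_half]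
  rw [sElt_conj_of hx h0 h1 (const_sigma k) comm_sigma, g_chi_pos, mul_neg, mul_one,
    ← sub_eq_add_neg]
  rfl

theorem sElt_comm_of {x : U1 N} (hx : Commute x (eE k)) (h : quadE k * x = x * quadE k) :
    sElt (initial N) k * x = x * sElt (initial N) k := by
  have h1 : Commute x (sExp k) :=
    ((show Commute x (quadE k) from h.symm).mul_right (comm_ev hx _))
  exact (ev_semiconj _ (const_sExp k) (const_sExp k) h1).symm

/-- The quadratic element is invariant: the E_{k-l} and the E_{k+l} transform in dual ways, so the
contributions of l = i and l = j cancel. -/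
theorem quadE_M (hi : k < i) (hj : k < j) :
    quadE k * initial N (.M i j) = initial N (.M i j) * quadE k := by
  rw [quadE_mul_of (q := fun l => -if l = j then initial N (.E k i) else 0) (fun l hl => a_Mij hj)
      (fun l hl => by rw [b_Mij hj, sub_eq_add_neg])]
  simp [mul_add, sum_add_distrib, ite_mul, mul_ite, hi, hj]

theorem quadE_H (hi : k < i) : quadE k * initial N (.H i) = initial N (.H i) * quadE k := by
  rw [quadE_mul_of (q := fun l => -if l = i then (1 / 2 : ℂ) • initial N (.E k l) else 0)
      (fun l hl => a_Hi hi) (fun l hl => by rw [b_Hi hi, sub_eq_add_neg])]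
  simp [ite_mul, mul_ite]

/-- Conjugation by `s_k` is the `k`-th basis change. -/
theorem sElt_conj {g : Gen N} (hg : g.InTail (k + 1)) : sElt (initial N) k * initial N g =
    basisChange k (initial N) g * sElt (initial N) k := by
  rcases g with ⟨i, j⟩ | ⟨i, j⟩ | ⟨i, j⟩ | i
  · exact sElt_E hg.1 hg.2
  · exact sElt_F hg.1 hg.2
  · exact sElt_comm_of (tail_e hg) (quadE_M hg.1 hg.2.1)
  · exact sElt_comm_of (tail_e hg) (quadE_H hg)

theorem isUnit_sElt (k : Fin N) : IsUnit (sElt (initial N) k) := isUnit_fexp (const_sExp k)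

end Link

/-! ### The twist of a link -/

section LinkTwist

open PowerSeries Finset

variable {N : ℕ}

/-- `x ↦ x ⊗ 1`. -/
def tL : U1 N →ₐ[ℂ] U2 N :=
  PowerSeries.mapAlgHom (Algebra.TensorProduct.includeLeft : U N →ₐ[ℂ] U N ⊗[ℂ] U N)

/-- `x ↦ 1 ⊗ x`. -/
def tR : U1 N →ₐ[ℂ] U2 N :=
  PowerSeries.mapAlgHom (Algebra.TensorProduct.includeRight : U N →ₐ[ℂ] U N ⊗[ℂ] U N)

theorem tens_eq (x y : U1 N) : tens x y = tL x * tR y := rfl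

/-- Used for embeddings into disjoint tensor legs. -/
theorem map_commute {A B : Type*} [Ring A] [Algebra ℂ A] [Ring B] [Algebra ℂ B] {D : Type*}
    [Ring D] [Algebra ℂ D] {f : A →ₐ[ℂ] D} {g : B →ₐ[ℂ] D} (h : ∀ a b, Commute (f a) (g b))
    (x : PowerSeries A) (y : PowerSeries B) : Commute (mapAlgHom f x) (mapAlgHom g y) := by
  ext n
  simp only [mapAlgHom_apply, coeff_mul, coeff_map]
  rw [← Finset.Nat.sum_antidiagonal_swap]
  exact sum_congr rfl fun p _ => (h _ _).eq

theorem tL_tR (x y : U1 N) : Commute (tL x) (tR y) :=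
  map_commute (fun a b => by simp [Commute, SemiconjBy]) x y

theorem map_xi {A B : Type*} [Ring A] [Algebra ℂ A] [Ring B] [Algebra ℂ B] (f : A →ₐ[ℂ] B) :
    mapAlgHom f (X : PowerSeries A) = X := by
  rw [mapAlgHom_apply]; exact map_X _

theorem tL_xi : tL (xi : U1 N) = X := map_xi _
theorem tR_xi : tR (xi : U1 N) = X := map_xi _
theorem Δ_xi : Δ (xi : U1 N) = X := map_xi _

theorem Δ_initial (g : Gen N) : Δ (initial N g) = tL (initial N g) + tR (initial N g) := by
  have h : comul N (UniversalEnvelopingAlgebra.ι ℂ (spGen g)) =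
      UniversalEnvelopingAlgebra.ι ℂ (spGen g) ⊗ₜ[ℂ] 1 +
        1 ⊗ₜ[ℂ] UniversalEnvelopingAlgebra.ι ℂ (spGen g) := by
    rw [comul, UniversalEnvelopingAlgebra.lift_ι_apply]; rfl
  simp only [Δ, tL, tR, initial, mapAlgHom_apply, map_C]
  rw [← map_add]
  exact congrArg _ h

theorem const_tL {x : U1 N} (hx : constantCoeff x = 0) : constantCoeff (tL x) = 0 :=
  constantCoeff_map hx

theorem const_tR {x : U1 N} (hx : constantCoeff x = 0) : constantCoeff (tR x) = 0 :=
  constantCoeff_map hx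

theorem const_tens {x y : U1 N} (hy : constantCoeff y = 0) : constantCoeff (tens x y) = 0 := by
  rw [tens_eq, map_mul, const_tR hy, mul_zero]

theorem tens_mul_tL {x y z d : U1 N} (h : x * z = z * x + d) :
    tens x y * tL z = tL z * tens x y + tens d y := by
  rw [tens_eq, tens_eq, mul_assoc, ← (tL_tR z y).eq, ← mul_assoc, ← map_mul, h, map_add, map_mul]
  noncomm_ring

theorem tens_mul_tR {x y z d : U1 N} (h : y * z = z * y + d) :
    tens x y * tR z = tR z * tens x y + tens x d := by
  rw [tens_eq, tens_eq, mul_assoc, ← map_mul, h, map_add, map_mul, mul_add, ← mul_assoc,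
    ← mul_assoc, (tL_tR x z).eq]

theorem tens_comm {x y z t : U1 N} (h : Commute x z) (h' : Commute y t) :
    Commute (tens x y) (tens z t) :=
  ((h.map tL).mul_right (tL_tR x t)).mul_left ((tL_tR z y).symm.mul_right (h'.map tR))

/-! ### Extension and jordanian factor as single exponentials. -/

variable {k : Fin N}

/-- The indices of the extension of the `k`-th link. -/
abbrev above (k : Fin N) : Finset (Fin N) := Finset.univ.filter fun i => k < i

/-- The exponent of the extension: `∑ E_{k-i} ⊗ ξ E_{k+i} e^{-σ/2}`. -/
def extExp (k : Fin N) : U2 N := ∑ l ∈ above k, tens (initial N (.M k l)) (bW k l)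

/-- The exponent of the jordanian factor. -/
def jorExp (k : Fin N) : U2 N := tens (initial N (.H k)) (sigma (initial N) k)

theorem mem_above {l : Fin N} : l ∈ above k ↔ k < l := by simp

theorem const_bW (l : Fin N) : constantCoeff (bW k l) = 0 := by
  rw [bW, mul_assoc]; exact const_xi_mul _

theorem const_extExp (k : Fin N) : constantCoeff (extExp k) = 0 := by
  rw [extExp, map_sum]
  exact sum_eq_zero fun l _ => const_tens (const_bW l)

theorem const_jorExp (k : Fin N) : constantCoeff (jorExp k) = 0 := const_tens (const_sigma k)

theorem fexp_list_sum {A ι : Type*} [Ring A] [Algebra ℂ A] (l : List ι) (y : ι → PowerSeries A)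
    (h0 : ∀ i, constantCoeff (y i) = 0) (hc : ∀ i ∈ l, ∀ j ∈ l, Commute (y i) (y j)) :
    (l.map fun i => fexp (y i)).prod = fexp ((l.map y).sum) := by
  induction l with
  | nil => simp [fexp_zero]
  | cons a l ih =>
    rw [List.map_cons, List.prod_cons, List.map_cons, List.sum_cons,
      ih fun i hi j hj => hc i (by simp [hi]) j (by simp [hj]), fexp_add (h0 a)]
    · rw [map_list_sum, List.map_map]
      exact List.sum_eq_zero (by simpa using fun i _ => h0 i)
    · refine Commute.list_sum_right _ _ fun z hz => ?_
      obtain ⟨i, hi, rfl⟩ := List.mem_map.1 hz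
      exact hc a (by simp) i (by simp [hi])

/-- The factors of the extension commute pairwise, so their prescribed order is immaterial. -/
theorem extTwist_eq (k : Fin N) : extTwist (initial N) k = fexp (extExp k) * fexp (jorExp k) := by
  have hm : ∀ {i : Fin N}, i ∈ indicesAbove k ↔ k < i := by simp [indicesAbove]
  have hnd : (indicesAbove k).Nodup := by
    rw [indicesAbove, List.nodup_reverse]; exact (List.nodup_finRange N).filter _
  rw [extTwist]
  congr 1
  have := fexp_list_sum (indicesAbove k) (fun i => tens (initial N (.M k i)) (bW k i))
    (fun i => const_tens (const_bW i)) (fun i hi j hj =>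
      tens_comm (a_a (hm.1 hi) (hm.1 hj)) (bW_bW i j))
  refine this.trans ?_
  rw [extExp, ← List.sum_toFinset _ hnd]
  congr 2
  ext i
  simp [hm]

theorem isUnit_link (k : Fin N) : IsUnit (extTwist (initial N) k) := by
  rw [extTwist_eq]
  exact (isUnit_fexp (const_extExp k)).mul (isUnit_fexp (const_jorExp k))

theorem extExp_mul_tL {x : U1 N} {d : Fin N → U1 N}
    (h : ∀ l, k < l → initial N (.M k l) * x = x * initial N (.M k l) + d l) :
    extExp k * tL x = tL x * extExp k + ∑ l ∈ above k, tens (d l) (bW k l) := by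
  rw [extExp, sum_mul, mul_sum, ← sum_add_distrib]
  exact sum_congr rfl fun l hl => tens_mul_tL (h l (mem_above.1 hl))

theorem extExp_mul_tR {x : U1 N} {d : Fin N → U1 N}
    (h : ∀ l, k < l → bW k l * x = x * bW k l + d l) :
    extExp k * tR x = tR x * extExp k + ∑ l ∈ above k, tens (initial N (.M k l)) (d l) := by
  rw [extExp, sum_mul, mul_sum, ← sum_add_distrib]
  exact sum_congr rfl fun l hl => tens_mul_tR (h l (mem_above.1 hl))

theorem extExp_comm_tL {x : U1 N} (h : ∀ l, k < l → Commute (initial N (.M k l)) x) :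
    Commute (extExp k) (tL x) := by
  have := extExp_mul_tL (d := fun _ => 0) (x := x) (k := k) fun l hl => by
    rw [add_zero, (h l hl).eq]
  simpa [tens_eq, Commute, SemiconjBy] using this

theorem extExp_comm_tR {x : U1 N} (h : ∀ l, k < l → Commute (bW k l) x) :
    Commute (extExp k) (tR x) := by
  have := extExp_mul_tR (d := fun _ => 0) (x := x) (k := k) fun l hl => by
    rw [add_zero, (h l hl).eq]
  simpa [tens_eq, Commute, SemiconjBy] using this

theorem fexp_commute {A : Type*} [Ring A] [Algebra ℂ A] {x y : PowerSeries A}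
    (hy : constantCoeff y = 0) (h : Commute y x) : Commute (fexp y) x :=
  (ev_semiconj _ hy hy h.symm).symm

/-- The extension commutes with functions of `E_{k+k}` in either factor. -/
theorem ext_tL_e {φ : U1 N} (h : ∀ x : U1 N, Commute x (eE k) → Commute x φ) :
    Commute (fexp (extExp k)) (tL φ) :=
  fexp_commute (const_extExp k) (extExp_comm_tL fun _ hl => h _ (a_e hl))

theorem ext_tR_e {φ : U1 N} (h : ∀ x : U1 N, Commute x (eE k) → Commute x φ) :
    Commute (fexp (extExp k)) (tR φ) :=
  fexp_commute (const_extExp k) (extExp_comm_tR fun l _ => h _ (bW_e l))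

/-- Conjugation by the jordanian factor of an element commuting with `E_{k+k}` of weight `c`. -/
theorem jor_tL {x : U1 N} {c : ℂ}
    (h : initial N (.H k) * x = x * initial N (.H k) + c • x) :
    fexp (jorExp k) * tL x = tL x * tR (fexp (c • sigma (initial N) k)) * fexp (jorExp k) := by
  have hR : tR (fexp (c • sigma (initial N) k)) = fexp (tR (c • sigma (initial N) k)) := map_fexp _ _
  have hc : constantCoeff (tR (c • sigma (initial N) k)) = 0 :=
    const_tR (const_smul _ (const_sigma k))
  have hcom : Commute (tR (c • sigma (initial N) k)) (jorExp k) :=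
    (tL_tR _ _).symm.mul_right ((((Commute.refl _).smul_left c).map tR))
  rw [hR, mul_assoc, ← fexp_add hc (const_jorExp k) hcom]
  symm
  -- Moving x past H shifts H by c, hence shifts the exponent H ⊗ σ by c(1 ⊗ σ).
  refine fexp_semiconj (by rw [map_add, hc, const_jorExp, add_zero]) (const_jorExp k) ?_
  rw [jorExp, tens_mul_tL h, mul_add, add_comm, tens_eq (c • x), map_smul, map_smul, smul_mul_assoc,
    mul_smul_comm]

theorem jor_tR {x : U1 N} (h : Commute x (eE k)) : Commute (fexp (jorExp k)) (tR x) := by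
  refine fexp_commute (const_jorExp k) ?_
  exact (tL_tR _ _).mul_left ((comm_sigma h).symm.map tR)

theorem fexp_sigma (k : Fin N) : fexp (sigma (initial N) k) = 1 + eE k := fexp_flog1p (const_e k)

/-! ### Twisted coproducts of the elements of the link -/

theorem semiconj_of_eq {A : Type*} [Mul A] {F x y z : A} (h : SemiconjBy F x y) (e : y = z) :
    SemiconjBy F x z := e ▸ h

theorem tens_mul_tens (x y z t : U1 N) : tens x y * tens z t = tens (x * z) (y * t) := by
  simp only [tens_eq, map_mul]
  rw [mul_assoc, ← mul_assoc (tR y), ← (tL_tR z y).eq]; noncomm_ring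

theorem tens_add_left (x y z : U1 N) : tens (x + y) z = tens x z + tens y z := by
  simp only [tens_eq, map_add, add_mul]

theorem tens_add_right (x y z : U1 N) : tens x (y + z) = tens x y + tens x z := by
  simp only [tens_eq, map_add, mul_add]

theorem tens_neg_left (x y : U1 N) : tens (-x) y = -tens x y := by
  simp only [tens_eq, map_neg, neg_mul]

theorem tens_neg_right (x y : U1 N) : tens x (-y) = -tens x y := by
  simp only [tens_eq, map_neg, mul_neg]

theorem tens_zero_left (x : U1 N) : tens 0 x = 0 := by simp [tens_eq]

theorem tens_zero_right (x : U1 N) : tens x 0 = 0 := by simp [tens_eq]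

theorem tens_one_one : tens (1 : U1 N) 1 = 1 := by simp [tens_eq]

theorem tL_eq (x : U1 N) : tL x = tens x 1 := by simp [tens_eq]

theorem tR_eq (x : U1 N) : tR x = tens 1 x := by simp [tens_eq]

theorem xi_tens_left (x y : U1 N) : tens (xi * x) y = X * tens x y := by
  rw [tens_eq, map_mul, tL_xi, mul_assoc, tens_eq]

theorem xi_tens_right (x y : U1 N) : tens x (xi * y) = X * tens x y := by
  rw [tens_eq, map_mul, tR_xi, ← mul_assoc, (commute_X (tL x)).eq, mul_assoc, tens_eq]

theorem xi_tens_swap (x y : U1 N) : tens x (xi * y) = tens (xi * x) y := by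
  rw [xi_tens_left, xi_tens_right]

/-- `E_{k+l} e^{-σ/2}`, without the factor `ξ`. -/
def gW (k l : Fin N) : U1 N := initial N (.E k l) * wE k

theorem bW_eq (k l : Fin N) : bW k l = xi * gW k l := mul_assoc ..

theorem sum_above_ite {i : Fin N} (hi : k < i) (f : Fin N → U2 N) (h : ∀ l, l ≠ i → f l = 0) :
    ∑ l ∈ above k, f l = f i :=
  sum_eq_single i (fun l _ hl => h l hl) fun h' => absurd (mem_above.2 hi) h'

theorem extExp_tL_b {i : Fin N} (hi : k < i) : extExp k * tL (initial N (.E k i)) =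
    tL (initial N (.E k i)) * extExp k + tens (initial N (.E k k)) (bW k i) := by
  rw [extExp_mul_tL fun l hl => a_b hl hi, sum_above_ite hi _ fun l hl => by
    rw [if_neg hl, tens_zero_left], if_pos rfl]

theorem bW_a {l i : Fin N} (hl : k < l) (hi : k < i) : bW k l * initial N (.M k i) =
    initial N (.M k i) * bW k l + if l = i then -(eE k * wE k) else 0 := by
  rw [a_bW hi hl]
  by_cases h : l = i
  · subst h; simp
  · simp [h, Ne.symm h]

theorem extExp_tR_a {i : Fin N} (hi : k < i) : extExp k * tR (initial N (.M k i)) =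
    tR (initial N (.M k i)) * extExp k + tens (initial N (.M k i)) (-(eE k * wE k)) := by
  rw [extExp_mul_tR fun l hl => bW_a hl hi, sum_above_ite hi _ fun l hl => by
    rw [if_neg hl, tens_zero_right], if_pos rfl]

theorem extExp_comm_tens {x y : U1 N} (h : ∀ l, k < l → Commute (initial N (.M k l)) x)
    (h' : ∀ l, k < l → Commute (bW k l) y) : Commute (extExp k) (tens x y) :=
  (extExp_comm_tL h).mul_right (extExp_comm_tR h')

theorem bW_ew (l : Fin N) : Commute (bW k l) (eE k * wE k) :=
  (bW_e l).mul_right (comm_wE (bW_e l))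

theorem jor_tL_comm {x : U1 N} (h : Commute x (initial N (.H k))) :
    Commute (fexp (jorExp k)) (tL x) :=
  fexp_commute (const_jorExp k) ((h.symm.map tL).mul_left (tL_tR x _).symm)

theorem jor_a {i : Fin N} (hi : k < i) : SemiconjBy (fexp (jorExp k)) (Δ (initial N (.M k i)))
    (tL (initial N (.M k i)) * tR (vE k) + tR (initial N (.M k i))) := by
  rw [Δ_initial]
  exact SemiconjBy.add_right (jor_tL (h_a hi)) (jor_tR (a_e hi))

theorem jor_b {i : Fin N} (hi : k < i) : SemiconjBy (fexp (jorExp k)) (Δ (initial N (.E k i)))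
    (tL (initial N (.E k i)) * tR (vE k) + tR (initial N (.E k i))) := by
  rw [Δ_initial]
  exact SemiconjBy.add_right (jor_tL (h_b hi)) (jor_tR (b_e i))

/-- Equivalently, 1 + e = e^σ is grouplike for the twisted coproduct. Only the jordanian factor
acts, since e commutes with both legs of the extension. -/
theorem link_e (k : Fin N) : SemiconjBy (extTwist (initial N) k) (Δ (eE k))
    (tL (eE k) + tR (eE k) + tL (eE k) * tR (eE k)) := by
  have h1 : Δ (eE k) = tL (eE k) + tR (eE k) := by
    simp only [eE, scaledE, map_mul, Δ_initial, Δ_xi, tL_xi, tR_xi, mul_add]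
  have h2 : SemiconjBy (fexp (jorExp k)) (tL (eE k)) (tL (eE k) * tR (1 + eE k)) := by
    have := jor_tL (k := k) (x := eE k) (c := 1) (by rw [one_smul, h_e])
    rwa [one_smul, fexp_sigma] at this
  have h3 : SemiconjBy (fexp (jorExp k)) (tR (eE k)) (tR (eE k)) := jor_tR (Commute.refl _)
  have h4 : tL (eE k) + tR (eE k) + tL (eE k) * tR (eE k) =
      tL (eE k) * tR (1 + eE k) + tR (eE k) := by
    rw [map_add, map_one]; noncomm_ring
  rw [extTwist_eq, h1, h4]
  refine SemiconjBy.mul_left ?_ (h2.add_right h3)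
  have hL : Commute (fexp (extExp k)) (tL (eE k)) := ext_tL_e fun _ h => h
  have hR : Commute (fexp (extExp k)) (tR (eE k)) := ext_tR_e fun _ h => h
  rw [map_add, map_one]
  exact (hL.mul_right ((Commute.one_right _).add_right hR)).add_right hR

theorem link_sigma (k : Fin N) : SemiconjBy (extTwist (initial N) k) (Δ (sigma (initial N) k))
    (tL (sigma (initial N) k) + tR (sigma (initial N) k)) := by
  have hL := const_tL (const_e k)
  have hR := const_tR (const_e k)
  have hc : constantCoeff (tL (eE k) + tR (eE k) + tL (eE k) * tR (eE k)) = 0 := by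
    rw [map_add, map_add, map_mul, hL, hR]; simp
  have h := ev_semiconj (PowerSeries.log ℂ) (constantCoeff_map (const_e k)) hc (link_e k)
  have h1 := flog1p_add hL hR (tL_tR _ _)
  have h2 : Δ (sigma (initial N) k) = flog1p (Δ (eE k)) := map_flog1p _ _
  have h3 : tL (sigma (initial N) k) = flog1p (tL (eE k)) := map_flog1p _ _
  have h4 : tR (sigma (initial N) k) = flog1p (tR (eE k)) := map_flog1p _ _
  rw [h2, h3, h4, ← h1]
  exact h

theorem link_w (k : Fin N) : SemiconjBy (extTwist (initial N) k) (Δ (wE k))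
    (tL (wE k) * tR (wE k)) := by
  set y := -((1 / 2 : ℂ) • sigma (initial N) k)
  have hy : constantCoeff y = 0 := constantCoeff_neg' (const_half k)
  have h : SemiconjBy (extTwist (initial N) k) (Δ y) (tL y + tR y) := by
    simp only [y, map_neg, map_smul]
    rw [← neg_add, ← smul_add]
    have := link_sigma k
    refine SemiconjBy.neg_right ?_
    rw [SemiconjBy, mul_smul_comm, this.eq, smul_mul_assoc]
  have h1 := ev_semiconj (PowerSeries.exp ℂ) (constantCoeff_map hy)
    (by rw [map_add, const_tL hy, const_tR hy, add_zero]) h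
  have h2 : Δ (wE k) = fexp (Δ y) := map_fexp _ _
  have h3 : tL (wE k) = fexp (tL y) := map_fexp _ _
  have h4 : tR (wE k) = fexp (tR y) := map_fexp _ _
  rw [h2, h3, h4, ← fexp_add (const_tL hy) (const_tR hy) (tL_tR _ _)]
  exact h1

/-- The jordanian factor dresses a ⊗ 1 to a ⊗ e^{σ/2}; the extension adds -a ⊗ e·e^{-σ/2}, coming
from 1 ⊗ a, and the two combine to a ⊗ e^{-σ/2}. -/
theorem link_a {i : Fin N} (hi : k < i) : SemiconjBy (extTwist (initial N) k)
    (Δ (initial N (.M k i))) (tens (initial N (.M k i)) (wE k) + tens 1 (initial N (.M k i))) := by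
  rw [extTwist_eq]
  refine SemiconjBy.mul_left ?_ (jor_a hi)
  have h1 : Commute (fexp (extExp k)) (tL (initial N (.M k i))) :=
    fexp_commute (const_extExp k) (extExp_comm_tL fun l hl => a_a hl hi)
  have h2 : Commute (fexp (extExp k)) (tR (vE k)) := ext_tR_e fun _ h => comm_vE h
  have h3 : SemiconjBy (fexp (extExp k)) (tR (initial N (.M k i)))
      (tR (initial N (.M k i)) + tens (initial N (.M k i)) (-(eE k * wE k))) :=
    fexp_mul_linear (const_extExp k) (extExp_tR_a hi)
      (extExp_comm_tens (fun l hl => a_a hl hi) fun l _ => (bW_ew l).neg_right)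
  have h4 := (SemiconjBy.mul_right h1 h2).add_right h3
  refine semiconj_of_eq h4 ?_
  rw [← w_u, ← tens_eq, mul_add, mul_one, (w_comm_e k).eq, tens_neg_right, tens_add_right, tR_eq]
  abel

/-- Here the extension acts on the left leg. Its commutator E_{k+k} ⊗ ξE_{k+i} equals ξE_{k+k} ⊗
E_{k+i}, as the formal parameter passes across the tensor sign. -/
theorem link_b {i : Fin N} (hi : k < i) : SemiconjBy (extTwist (initial N) k)
    (Δ (initial N (.E k i)))
    (tens (initial N (.E k i)) (vE k) + tens (1 + eE k) (initial N (.E k i))) := by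
  rw [extTwist_eq]
  refine SemiconjBy.mul_left ?_ (jor_b hi)
  have h1 : SemiconjBy (fexp (extExp k)) (tL (initial N (.E k i)))
      (tL (initial N (.E k i)) + tens (initial N (.E k k)) (bW k i)) :=
    fexp_mul_linear (const_extExp k) (extExp_tL_b hi)
      (extExp_comm_tens (fun l hl => initial_comm (M_Ekk hl.ne)) fun l _ => bW_bW l i)
  have h2 : Commute (fexp (extExp k)) (tR (vE k)) := ext_tR_e fun _ h => comm_vE h
  have h3 : Commute (fexp (extExp k)) (tR (initial N (.E k i))) :=
    fexp_commute (const_extExp k) (extExp_comm_tR fun l _ =>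
      ((commute_X _).symm.mul_left (b_b ..)).mul_left (comm_wE (b_e i)).symm)
  have h4 := (SemiconjBy.mul_right h1 h2).add_right h3
  refine semiconj_of_eq h4 ?_
  have h5 : bW k i * vE k = xi * initial N (.E k i) := by rw [bW, mul_assoc, w_mul_v, mul_one]
  rw [tR_eq, tL_eq, add_mul, tens_mul_tens, tR_eq, tens_mul_tens, h5, tens_add_left, xi_tens_swap]
  simp only [mul_one, one_mul]
  rw [add_assoc, add_comm (tens 1 _)]
  rfl

/-- The version without ξ is needed because the quadratic correction to E_{i+j} carries a single ξ,
not one per factor. -/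
theorem link_g {i : Fin N} (hi : k < i) : SemiconjBy (extTwist (initial N) k)
    (Δ (gW k i)) (tens (gW k i) 1 + tens (vE k) (gW k i)) := by
  have h := SemiconjBy.mul_right (link_b hi) (link_w k)
  rw [← map_mul] at h
  refine semiconj_of_eq h ?_
  rw [← tens_eq, add_mul, tens_mul_tens, tens_mul_tens, v_mul_w, ← w_u, mul_add, add_mul, mul_one,
    one_mul, (w_comm_e k).eq]
  rfl

theorem link_bW {i : Fin N} (hi : k < i) : SemiconjBy (extTwist (initial N) k)
    (Δ (bW k i)) (tens (bW k i) 1 + tens (vE k) (bW k i)) := by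
  rw [bW_eq, map_mul, Δ_xi, xi_tens_left, xi_tens_right, ← mul_add]
  exact SemiconjBy.mul_right (commute_X _) (link_g hi)

theorem gW_comm_v (i : Fin N) : Commute (gW k i) (vE k) :=
  comm_vE ((b_e i).mul_left (w_comm_e k))

theorem gW_mul_v (i : Fin N) : gW k i * vE k = initial N (.E k i) := by
  rw [gW, mul_assoc, w_mul_v, mul_one]

theorem gW_mul_gW (i j : Fin N) : gW k i * gW k j =
    initial N (.E k i) * initial N (.E k j) * fexp (-sigma (initial N) k) := by
  rw [gW, gW, ← w_mul_w, mul_assoc, ← mul_assoc (wE k), ← (comm_wE (b_e j)).eq]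
  noncomm_ring

/-! ### Primitivity of the changed generators for one link. -/

/-- The ordinary generators become primitive after adding the quadratic correction. -/
theorem link_E {i j : Fin N} (hi : k < i) (hj : k < j) : SemiconjBy (extTwist (initial N) k)
    (Δ (basisChange k (initial N) (.E i j)))
    (tens (basisChange k (initial N) (.E i j)) 1 + tens 1 (basisChange k (initial N) (.E i j))) := by
  have hX : basisChange k (initial N) (.E i j) = initial N (.E i j) - xi * (gW k i * gW k j) := by
    rw [gW_mul_gW]; simp only [basisChange, mul_assoc]
  have hq := SemiconjBy.mul_right (link_g hi) (link_g hj)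
  rw [← map_mul] at hq
  have hq' := SemiconjBy.mul_right (commute_X (extTwist (initial N) k)) hq
  have hJ : SemiconjBy (fexp (jorExp k)) (Δ (initial N (.E i j)))
      (tL (initial N (.E i j)) + tR (initial N (.E i j))) := by
    rw [Δ_initial]
    exact (jor_tL_comm (tail_h (g := .E i j) ⟨hi, hj⟩)).add_right (jor_tR (tail_e (g := .E i j) ⟨hi, hj⟩))
  have h0 : extExp k * tL (initial N (.E i j)) = tL (initial N (.E i j)) * extExp k +
      (tens (initial N (.E k j)) (bW k i) + tens (initial N (.E k i)) (bW k j)) := by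
    rw [extExp_mul_tL fun l hl => a_Eij hl hi hj]
    simp only [tens_add_left, sum_add_distrib]
    rw [sum_above_ite hi _ fun l hl => by rw [if_neg hl, tens_zero_left],
      sum_above_ite hj _ fun l hl => by rw [if_neg hl, tens_zero_left], if_pos rfl, if_pos rfl]
  have hb : ∀ {i j : Fin N}, k < i → extExp k * tens (initial N (.E k i)) (bW k j) =
      tens (initial N (.E k i)) (bW k j) * extExp k + tens (initial N (.E k k)) (bW k i * bW k j) := by
    intro i j hi
    have h1 : Commute (extExp k) (tR (bW k j)) := extExp_comm_tR fun l _ => bW_bW l j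
    rw [tens_eq (initial N (.E k i)), ← mul_assoc, extExp_tL_b hi, add_mul, mul_assoc, h1.eq,
      tR_eq (bW k j), tens_mul_tens, mul_one]
    noncomm_ring
  -- The second commutator is 2 E_{k+k} ⊗ bW_i bW_j, one copy from each first-order term; the series
  -- stops there.
  have hΦ : SemiconjBy (fexp (extExp k)) (tL (initial N (.E i j)))
      (tL (initial N (.E i j)) + (tens (initial N (.E k j)) (bW k i) +
        tens (initial N (.E k i)) (bW k j)) + tens (initial N (.E k k)) (bW k i * bW k j)) := by
    refine fexp_mul_quadratic (const_extExp k) h0 ?_ ?_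
    · rw [mul_add, hb hi, hb hj, (bW_bW j i).eq, two_smul]; noncomm_ring
    · exact extExp_comm_tens (fun l hl => initial_comm (M_Ekk hl.ne)) fun l _ =>
        (bW_bW l i).mul_right (bW_bW l j)
  have hR : Commute (fexp (extExp k)) (tR (initial N (.E i j))) :=
    fexp_commute (const_extExp k) (extExp_comm_tR fun l _ =>
      ((commute_X _).symm.mul_left (b_b ..)).mul_left
        (comm_wE (tail_e (g := .E i j) ⟨hi, hj⟩)).symm)
  have hE := SemiconjBy.mul_left (hΦ.add_right hR) hJ
  rw [← extTwist_eq] at hE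
  rw [hX, map_sub, map_mul, Δ_xi]
  refine semiconj_of_eq (hE.sub_right hq') ?_
  have e1 : tens (initial N (.E k k)) (bW k i * bW k j) =
      X * tens (eE k) (gW k i * gW k j) := by
    rw [bW_eq, bW_eq, mul_assoc, xi_tens_swap, ← mul_assoc (gW k i), xi_comm, mul_assoc,
      xi_tens_right]
    rfl
  -- In the product of the twisted coproducts of the two g's, e^{σ/2} e^{σ/2} = 1 + e; the mixed
  -- terms and the e-term cancel those created by the extension.
  rw [e1, bW_eq, bW_eq, xi_tens_right, xi_tens_right, add_mul, mul_add (tens _ _), mul_add (tens _ _), tens_mul_tens,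
    tens_mul_tens, tens_mul_tens, tens_mul_tens, ← (gW_comm_v j).eq, gW_mul_v, gW_mul_v, v_mul_v,
    tL_eq, tR_eq]
  simp only [sub_eq_add_neg, tens_add_left, tens_add_right, tens_neg_left, tens_neg_right,
    xi_tens_left, xi_tens_right, mul_one, one_mul, mul_add]
  abel

/-- F_{i+j} commutes with every E_{k-l}, so F ⊗ 1 is untouched by the extension and only 1 ⊗ F
produces terms, again up to second order. -/
theorem link_F {i j : Fin N} (hi : k < i) (hj : k < j) : SemiconjBy (extTwist (initial N) k)
    (Δ (basisChange k (initial N) (.F i j)))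
    (tens (basisChange k (initial N) (.F i j)) 1 + tens 1 (basisChange k (initial N) (.F i j))) := by
  have hX : basisChange k (initial N) (.F i j) =
      initial N (.F i j) - xi * (initial N (.M k i) * initial N (.M k j)) := by
    simp only [basisChange, mul_assoc]
  have he : Commute (initial N (.F i j)) (eE k) := tail_e (g := .F i j) ⟨hi, hj⟩
  have hq := SemiconjBy.mul_right (link_a hi) (link_a hj)
  rw [← map_mul] at hq
  have hq' := SemiconjBy.mul_right (commute_X (extTwist (initial N) k)) hq
  have hJ : SemiconjBy (fexp (jorExp k)) (Δ (initial N (.F i j)))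
      (tL (initial N (.F i j)) + tR (initial N (.F i j))) := by
    rw [Δ_initial]
    exact (jor_tL_comm (tail_h (g := .F i j) ⟨hi, hj⟩)).add_right (jor_tR he)
  have hbF : ∀ l, k < l → bW k l * initial N (.F i j) = initial N (.F i j) * bW k l +
      ((if l = i then xi * (initial N (.M k j) * wE k) else 0) +
        if l = j then xi * (initial N (.M k i) * wE k) else 0) := by
    intro l _
    calc bW k l * initial N (.F i j)
        = xi * (initial N (.E k l) * initial N (.F i j)) * wE k := by
          rw [bW, mul_assoc, ← (comm_wE he).eq]; noncomm_ring
      _ = xi * initial N (.F i j) * initial N (.E k l) * wE k +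
          xi * (((if l = i then initial N (.M k j) else 0) +
            if l = j then initial N (.M k i) else 0) * wE k) := by
          rw [b_Fij hi hj]; noncomm_ring
      _ = _ := by
          rw [← xi_comm (initial N (.F i j)), bW]
          congr 1
          · noncomm_ring
          · split_ifs <;> simp [add_mul, mul_add]
  have h0 : extExp k * tR (initial N (.F i j)) = tR (initial N (.F i j)) * extExp k +
      (tens (initial N (.M k i)) (xi * (initial N (.M k j) * wE k)) +
        tens (initial N (.M k j)) (xi * (initial N (.M k i) * wE k))) := by
    rw [extExp_mul_tR hbF]
    simp only [tens_add_right, sum_add_distrib]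
    rw [sum_above_ite hi _ fun l hl => by rw [if_neg hl, tens_zero_right],
      sum_above_ite hj _ fun l hl => by rw [if_neg hl, tens_zero_right], if_pos rfl, if_pos rfl]
  have ha : ∀ {i j : Fin N}, k < i → k < j →
      extExp k * (X * tens (initial N (.M k i)) (initial N (.M k j) * wE k)) =
      X * tens (initial N (.M k i)) (initial N (.M k j) * wE k) * extExp k +
        -(X * tens (initial N (.M k j) * initial N (.M k i)) (eE k * wE k * wE k)) := by
    intro i j hi hj
    have h1 : Commute (extExp k) (tL (initial N (.M k i))) := extExp_comm_tL fun l hl => a_a hl hi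
    have h2 : Commute (extExp k) (tR (wE k)) := extExp_comm_tR fun l _ => comm_wE (bW_e l)
    have h3 : tens (initial N (.M k i)) (initial N (.M k j) * wE k) =
        tL (initial N (.M k i)) * tR (initial N (.M k j)) * tR (wE k) := by
      rw [tens_eq, map_mul, mul_assoc]
    have h4 : tens (initial N (.M k j) * initial N (.M k i)) (eE k * wE k * wE k) =
        tL (initial N (.M k i)) * tens (initial N (.M k j)) (eE k * wE k) * tR (wE k) := by
      rw [tL_eq, tR_eq, tens_mul_tens, tens_mul_tens, (a_a hj hi).eq, one_mul, mul_one]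
    rw [← mul_assoc, (commute_X (extExp k)).eq, mul_assoc, h3, h4]
    calc _ = X * (extExp k * tL (initial N (.M k i)) * tR (initial N (.M k j)) * tR (wE k)) := by
          noncomm_ring
      _ = X * (tL (initial N (.M k i)) * (extExp k * tR (initial N (.M k j))) * tR (wE k)) := by
          rw [h1.eq]; noncomm_ring
      _ = X * (tL (initial N (.M k i)) * (tR (initial N (.M k j)) * (extExp k * tR (wE k))) +
          tL (initial N (.M k i)) * tens (initial N (.M k j)) (-(eE k * wE k)) * tR (wE k)) := by
          rw [extExp_tR_a hj]; noncomm_ring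
      _ = _ := by rw [h2.eq, tens_neg_right]; noncomm_ring
  have hΦ : SemiconjBy (fexp (extExp k)) (tR (initial N (.F i j)))
      (tR (initial N (.F i j)) +
        (X * tens (initial N (.M k i)) (initial N (.M k j) * wE k) +
          X * tens (initial N (.M k j)) (initial N (.M k i) * wE k)) +
        -(X * tens (initial N (.M k i) * initial N (.M k j)) (eE k * wE k * wE k))) := by
    refine fexp_mul_quadratic (const_extExp k) ?_ ?_ ?_
    · rw [h0, xi_tens_right, xi_tens_right]
    · rw [mul_add, ha hi hj, ha hj hi, (a_a hj hi).eq, two_smul]; noncomm_ring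
    · exact ((commute_X _).mul_right (extExp_comm_tens (fun l hl => (a_a hl hi).mul_right (a_a hl hj))
        fun l _ => (bW_ew l).mul_right (comm_wE (bW_e l)))).neg_right
  have hL : Commute (fexp (extExp k)) (tL (initial N (.F i j))) :=
    fexp_commute (const_extExp k) (extExp_comm_tL fun l _ => a_Fij hi hj)
  have hE := SemiconjBy.mul_left (SemiconjBy.add_right hL hΦ) hJ
  rw [← extTwist_eq] at hE
  rw [hX, map_sub, map_mul, Δ_xi]
  refine semiconj_of_eq (hE.sub_right hq') ?_
  -- That is, e^{-σ}(1+e) = 1: the second-order term and the product of coproducts together leave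
  -- E_{k-i}E_{k-j} ⊗ 1.
  have hw : wE k * wE k = 1 - eE k * wE k * wE k := by
    rw [eq_sub_iff_add_eq, ← (w_comm_e k).eq, mul_assoc, ← (w_comm_e k).eq, ← mul_assoc]
    have := w_mul_v k
    rw [← w_u, mul_add, mul_one, mul_add, ← mul_assoc] at this
    exact this
  rw [add_mul, mul_add (tens _ _), mul_add (tens _ _), tens_mul_tens,
    tens_mul_tens, tens_mul_tens, tens_mul_tens, mul_one, ← (comm_wE (a_e hj)).eq, hw,
    sub_eq_add_neg, sub_eq_add_neg, sub_eq_add_neg, tens_add_left, tens_add_right, tens_add_right,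
    tens_neg_left, tens_neg_right, tens_neg_right, xi_tens_left, xi_tens_right, tL_eq, tR_eq]
  simp only [mul_one, one_mul, mul_add, mul_neg]
  abel

/-- For E_{i-j} and H_{ii} no correction is needed: hypothesis `h` says that X ⊗ 1 + 1 ⊗ X commutes
with the extension exponent. -/
theorem link_comm_of {g : Gen N} (hg : g.InTail (k + 1)) {p q : Fin N → U1 N}
    (hp : ∀ l, k < l → initial N (.M k l) * initial N g = initial N g * initial N (.M k l) + p l)
    (hq : ∀ l, k < l → initial N (.E k l) * initial N g = initial N g * initial N (.E k l) + q l)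
    (h : ∑ l ∈ above k, tens (p l) (bW k l) +
      ∑ l ∈ above k, tens (initial N (.M k l)) (xi * q l * wE k) = 0) :
    SemiconjBy (extTwist (initial N) k) (Δ (initial N g))
      (tens (initial N g) 1 + tens 1 (initial N g)) := by
  have hb : ∀ l, k < l → bW k l * initial N g = initial N g * bW k l + xi * q l * wE k := by
    intro l hl
    calc bW k l * initial N g = xi * (initial N (.E k l) * initial N g) * wE k := by
          rw [bW, mul_assoc, ← (comm_wE (tail_e hg)).eq]; noncomm_ring
      _ = xi * initial N g * initial N (.E k l) * wE k + xi * q l * wE k := by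
          rw [hq l hl]; noncomm_ring
      _ = _ := by rw [← xi_comm (initial N g), bW]; noncomm_ring
  have h1 : Commute (extExp k) (tL (initial N g) + tR (initial N g)) := by
    rw [Commute, SemiconjBy, mul_add, extExp_mul_tL hp, extExp_mul_tR hb, add_mul]
    rw [add_add_add_comm, h, add_zero]
  rw [extTwist_eq, Δ_initial, ← tL_eq, ← tR_eq]
  exact SemiconjBy.mul_left (fexp_commute (const_extExp k) h1)
    ((jor_tL_comm (tail_h hg)).add_right (jor_tR (tail_e hg)))

theorem link_M {i j : Fin N} (hij : (Gen.M i j).InTail (k + 1)) :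
    SemiconjBy (extTwist (initial N) k) (Δ (initial N (.M i j)))
      (tens (initial N (.M i j)) 1 + tens 1 (initial N (.M i j))) := by
  have hi : k < i := hij.1
  have hj : k < j := hij.2.1
  refine link_comm_of hij (fun l _ => a_Mij hj)
    (q := fun l => -if l = j then initial N (.E k i) else 0)
    (fun l _ => by rw [b_Mij hj, sub_eq_add_neg]) ?_
  rw [sum_above_ite hi _ fun l hl => by rw [if_neg hl, tens_zero_left],
    sum_above_ite hj _ fun l hl => by simp [hl, tens_zero_right], if_pos rfl, if_pos rfl, mul_neg,
    neg_mul, tens_neg_right]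
  exact add_neg_cancel _

theorem link_H {i : Fin N} (hi : k < i) :
    SemiconjBy (extTwist (initial N) k) (Δ (initial N (.H i)))
      (tens (initial N (.H i)) 1 + tens 1 (initial N (.H i))) := by
  refine link_comm_of (g := .H i) hi (fun l _ => a_Hi hi)
    (q := fun l => -if l = i then (1 / 2 : ℂ) • initial N (.E k l) else 0)
    (fun l _ => by rw [b_Hi hi, sub_eq_add_neg]) ?_
  rw [sum_above_ite hi _ fun l hl => by rw [if_neg hl, tens_zero_left],
    sum_above_ite hi _ fun l hl => by simp [hl, tens_zero_right], if_pos rfl, if_pos rfl, mul_neg,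
    neg_mul, tens_neg_right, mul_smul_comm, smul_mul_assoc, tens_eq, tens_eq, map_smul, map_smul,
    smul_mul_assoc, mul_smul_comm]
  exact add_neg_cancel _

theorem link_primitive {g : Gen N} (hg : g.InTail (k + 1)) :
    SemiconjBy (extTwist (initial N) k) (Δ (basisChange k (initial N) g))
      (tens (basisChange k (initial N) g) 1 + tens 1 (basisChange k (initial N) g)) := by
  rcases g with ⟨i, j⟩ | ⟨i, j⟩ | ⟨i, j⟩ | i
  · exact link_E hg.1 hg.2
  · exact link_F hg.1 hg.2
  · exact link_M hg
  · exact link_H hg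

end LinkTwist

/-! ### The cocycle equation of a link -/

section Cocycle

open PowerSeries Finset

variable {N : ℕ}

theorem map_map_congr {A B C D : Type*} [Ring A] [Algebra ℂ A] [Ring B] [Algebra ℂ B]
    [Ring C] [Algebra ℂ C] [Ring D] [Algebra ℂ D] {f : B →ₐ[ℂ] D} {g : A →ₐ[ℂ] B}
    {f' : C →ₐ[ℂ] D} {g' : A →ₐ[ℂ] C} (h : ∀ a, f (g a) = f' (g' a)) (x : PowerSeries A) :
    mapAlgHom f (mapAlgHom g x) = mapAlgHom f' (mapAlgHom g' x) := by
  ext n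
  simp [mapAlgHom_apply, coeff_map, h]

theorem map_map_eq {A B D : Type*} [Ring A] [Algebra ℂ A] [Ring B] [Algebra ℂ B]
    [Ring D] [Algebra ℂ D] {f : B →ₐ[ℂ] D} {g : A →ₐ[ℂ] B}
    {f' : A →ₐ[ℂ] D} (h : ∀ a, f (g a) = f' a) (x : PowerSeries A) :
    mapAlgHom f (mapAlgHom g x) = mapAlgHom f' x := by
  ext n
  simp [mapAlgHom_apply, coeff_map, h]

/-- `x ↦ x ⊗ 1 ⊗ 1`. -/
def i1 : U1 N →ₐ[ℂ] U3 N := leg12.comp tL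

/-- `x ↦ 1 ⊗ x ⊗ 1`. -/
def i2 : U1 N →ₐ[ℂ] U3 N := leg12.comp tR

/-- `x ↦ 1 ⊗ 1 ⊗ x`. -/
def i3 : U1 N →ₐ[ℂ] U3 N := PowerSeries.mapAlgHom Algebra.TensorProduct.includeRight

theorem leg12_tL (x : U1 N) : leg12 (tL x) = i1 x := rfl
theorem leg12_tR (x : U1 N) : leg12 (tR x) = i2 x := rfl

theorem leg23_tL (x : U1 N) : leg23 (tL x) = i2 x := by
  change leg23 (tL x) = leg12 (tR x)
  exact map_map_congr (fun _ => by simp) x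

theorem leg23_tR (x : U1 N) : leg23 (tR x) = i3 x :=
  map_map_eq (fun _ => by simp [Algebra.TensorProduct.one_def]) x

theorem comulId_tL (x : U1 N) : comulId (tL x) = leg12 (Δ x) := map_map_congr (fun _ => by simp) x

theorem comulId_tR (x : U1 N) : comulId (tR x) = i3 x := map_map_eq (fun _ => by simp) x

theorem idComul_tL (x : U1 N) : idComul (tL x) = i1 x := by
  change idComul (tL x) = leg12 (tL x)
  exact map_map_congr (fun _ => by simp [Algebra.TensorProduct.one_def]) x

theorem idComul_tR (x : U1 N) : idComul (tR x) = leg23 (Δ x) := map_map_congr (fun _ => by simp) x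

theorem leg12_i3 (x : U2 N) (y : U1 N) : Commute (leg12 x) (i3 y) :=
  map_commute (fun a b => by simp [Commute, SemiconjBy]) x y

theorem i1_leg23 (x : U1 N) (y : U2 N) : Commute (i1 x) (leg23 y) := by
  have h : i1 x = PowerSeries.mapAlgHom
      ((Algebra.TensorProduct.assoc ℂ ℂ ℂ (U N) (U N) (U N)).symm.toAlgHom.comp
        Algebra.TensorProduct.includeLeft) x := by
    change leg12 (tL x) = _
    exact map_map_eq (fun _ => by simp [Algebra.TensorProduct.one_def]) x
  rw [h]
  refine map_commute (fun a b => ?_) x y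
  simp only [AlgHom.comp_apply]
  exact Commute.map (by simp [Commute, SemiconjBy]) _

theorem i1_i2 (x y : U1 N) : Commute (i1 x) (i2 y) := (tL_tR x y).map leg12
theorem i1_i3 (x y : U1 N) : Commute (i1 x) (i3 y) := leg12_i3 _ _
theorem i2_i3 (x y : U1 N) : Commute (i2 x) (i3 y) := leg12_i3 _ _

/-- `x ⊗ y ⊗ z`. -/
def tri (x y z : U1 N) : U3 N := i1 x * i2 y * i3 z

theorem tri_comm {x y z x' y' z' : U1 N} (hx : Commute x x') (hy : Commute y y')
    (hz : Commute z z') : Commute (tri x y z) (tri x' y' z') := by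
  refine Commute.mul_left (Commute.mul_left ?_ ?_) ?_
  · exact ((hx.map i1).mul_right (i1_i2 _ _)).mul_right (i1_i3 _ _)
  · exact ((i1_i2 _ _).symm.mul_right (hy.map i2)).mul_right (i2_i3 _ _)
  · exact ((i1_i3 _ _).symm.mul_right (i2_i3 _ _).symm).mul_right (hz.map i3)

theorem leg12_tens (x y : U1 N) : leg12 (tens x y) = tri x y 1 := by
  rw [tens_eq, map_mul, tri, map_one, mul_one]; rfl

theorem leg23_tens (x y : U1 N) : leg23 (tens x y) = tri 1 x y := by
  rw [tens_eq, map_mul, tri, map_one, one_mul, leg23_tL, leg23_tR]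

theorem leg12_tens_mul (x y z : U1 N) : leg12 (tens x y) * i3 z = tri x y z := by
  rw [tens_eq, map_mul, tri]; rfl

theorem mul_leg23_tens (x y z : U1 N) : i1 x * leg23 (tens y z) = tri x y z := by
  rw [tens_eq, map_mul, tri, leg23_tL, leg23_tR, mul_assoc]

theorem const_i3 {x : U1 N} (hx : constantCoeff x = 0) : constantCoeff (i3 x) = 0 :=
  constantCoeff_map hx

theorem const_tri {x y z : U1 N} (hz : constantCoeff z = 0) : constantCoeff (tri x y z) = 0 := by
  rw [tri, map_mul, const_i3 hz, mul_zero]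

theorem sum_comm_sum {ι A : Type*} [Ring A] {s : Finset ι} {f g : ι → A}
    (h : ∀ i ∈ s, ∀ j ∈ s, Commute (f i) (g j)) : Commute (∑ i ∈ s, f i) (∑ j ∈ s, g j) :=
  Commute.sum_left _ _ _ fun i hi => Commute.sum_right _ _ _ fun j hj => h i hi j hj

theorem fexp_comm_fexp {A : Type*} [Ring A] [Algebra ℂ A] {x y : PowerSeries A}
    (hx : constantCoeff x = 0) (hy : constantCoeff y = 0) (h : Commute x y) :
    Commute (fexp x) (fexp y) :=
  fexp_commute hx (fexp_commute hy h.symm).symm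

/-! ### The extension on three tensor legs. -/

variable (k : Fin N)

/-- `∑ E_{k-l} ⊗ y ⊗ ξ E_{k+l} e^{-σ/2}`. -/
def ext13 (y : U1 N) : U3 N := ∑ l ∈ above k, tri (initial N (.M k l)) y (bW k l)

variable {k}

theorem const_ext13 (y : U1 N) : constantCoeff (ext13 k y) = 0 := by
  rw [ext13, map_sum]; exact sum_eq_zero fun l _ => const_tri (const_bW l)

theorem leg12_extExp : leg12 (extExp k) = ∑ l ∈ above k, tri (initial N (.M k l)) (bW k l) 1 := by
  rw [extExp, map_sum]; exact sum_congr rfl fun l _ => leg12_tens _ _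

theorem leg23_extExp : leg23 (extExp k) = ∑ l ∈ above k, tri 1 (initial N (.M k l)) (bW k l) := by
  rw [extExp, map_sum]; exact sum_congr rfl fun l _ => leg23_tens _ _

/-- Conjugation by F₁₂ replaces Δ by the twisted coproduct, so `link_a` is applied to the left leg
of each summand. -/
theorem leg12_link_mul : SemiconjBy (leg12 (extTwist (initial N) k)) (comulId (extExp k))
    (ext13 k (wE k) + leg23 (extExp k)) := by
  rw [SemiconjBy, leg23_extExp, ext13, ← sum_add_distrib, extExp, map_sum, mul_sum, sum_mul]
  refine sum_congr rfl fun l hl => ?_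
  rw [tens_eq, map_mul, comulId_tL, comulId_tR, ← mul_assoc, ← map_mul,
    (link_a (mem_above.1 hl)).eq, map_mul, mul_assoc, (leg12_i3 _ _).eq, ← mul_assoc, map_add,
    add_mul, leg12_tens_mul, leg12_tens_mul]

theorem leg23_link_mul : SemiconjBy (leg23 (extTwist (initial N) k)) (idComul (extExp k))
    (leg12 (extExp k) + ext13 k (vE k)) := by
  rw [SemiconjBy, leg12_extExp, ext13, ← sum_add_distrib, extExp, map_sum, mul_sum, sum_mul]
  refine sum_congr rfl fun l hl => ?_
  rw [tens_eq, map_mul, idComul_tL, idComul_tR, ← mul_assoc, ← (i1_leg23 _ _).eq, mul_assoc,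
    ← map_mul, (link_bW (mem_above.1 hl)).eq, map_mul, ← mul_assoc, map_add, mul_add,
    mul_leg23_tens, mul_leg23_tens]

theorem comulId_jorExp : comulId (jorExp k) =
    tri (initial N (.H k)) 1 (sigma (initial N) k) + leg23 (jorExp k) := by
  rw [jorExp, leg23_tens, tens_eq, map_mul, comulId_tL, comulId_tR, Δ_initial, tL_eq, tR_eq,
    map_add, add_mul, leg12_tens_mul, leg12_tens_mul]

theorem leg23_jor_mul : SemiconjBy (leg23 (extTwist (initial N) k)) (idComul (jorExp k))
    (leg12 (jorExp k) + tri (initial N (.H k)) 1 (sigma (initial N) k)) := by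
  rw [SemiconjBy, jorExp, leg12_tens, tens_eq, map_mul, idComul_tL, idComul_tR, ← mul_assoc,
    ← (i1_leg23 _ _).eq, mul_assoc, ← map_mul, (link_sigma k).eq, tL_eq, tR_eq, map_mul,
    ← mul_assoc, map_add, mul_add, mul_leg23_tens, mul_leg23_tens]

/-- The Heisenberg relation in the common middle leg produces a term linking legs 1 and 3. -/
theorem leg23_leg12_ext : leg23 (extExp k) * leg12 (extExp k) =
    leg12 (extExp k) * leg23 (extExp k) + ext13 k (eE k * wE k) := by
  rw [leg23_extExp, ext13, sum_mul, mul_sum, ← sum_add_distrib]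
  refine sum_congr rfl fun l hl => ?_
  have h0 : extExp k * tR (initial N (.M k l)) + tens (initial N (.M k l)) (eE k * wE k) =
      tR (initial N (.M k l)) * extExp k := by
    rw [extExp_tR_a (mem_above.1 hl), tens_neg_right, neg_add_cancel_right]
  have h := congrArg leg12 h0
  rw [map_add, map_mul, map_mul, leg12_tR] at h
  have h2 : tri 1 (initial N (.M k l)) (bW k l) = i2 (initial N (.M k l)) * i3 (bW k l) := by
    rw [tri, map_one, one_mul]
  rw [h2, ← leg12_tens_mul, mul_assoc, ← (leg12_i3 _ _).eq, ← mul_assoc, ← mul_assoc, ← h,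
    add_mul]

/-- Moving exp Φ₂₃ to the right past exp Φ₁₂ adds the commutator e·e^{-σ/2} to the middle leg of
Φ₁₃. Together with the e^{-σ/2} already there it gives e^{σ/2}. -/
theorem ext_cocycle : fexp (ext13 k (wE k) + leg23 (extExp k)) * fexp (leg12 (extExp k)) =
    fexp (leg12 (extExp k) + ext13 k (vE k)) * fexp (leg23 (extExp k)) := by
  have c12 : constantCoeff (leg12 (extExp k)) = 0 := constantCoeff_map (const_extExp k)
  have c23 : constantCoeff (leg23 (extExp k)) = 0 := constantCoeff_map (const_extExp k)
  have hbw : ∀ l, Commute (bW k l) (wE k) := fun l => comm_wE (bW_e l)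
  have h1 : Commute (ext13 k (wE k)) (leg23 (extExp k)) := by
    rw [leg23_extExp]
    exact sum_comm_sum fun i _ j hj => tri_comm (Commute.one_right _)
      (comm_wE (a_e (mem_above.1 hj))).symm (bW_bW i j)
  have h2 : Commute (leg23 (extExp k)) (ext13 k (eE k * wE k)) := by
    rw [leg23_extExp]
    exact sum_comm_sum fun i hi j hj => tri_comm (Commute.one_left _)
      ((a_e (mem_above.1 hi)).mul_right (comm_wE (a_e (mem_above.1 hi)))) (bW_bW i j)
  have h3 : Commute (ext13 k (wE k)) (leg12 (extExp k) + ext13 k (eE k * wE k)) := by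
    rw [leg12_extExp]
    refine Commute.add_right (sum_comm_sum fun i hi j hj => ?_) (sum_comm_sum fun i hi j hj => ?_)
    · exact tri_comm (a_a (mem_above.1 hi) (mem_above.1 hj)) (hbw j).symm (Commute.one_right _)
    · exact tri_comm (a_a (mem_above.1 hi) (mem_above.1 hj))
        ((w_comm_e k).mul_right (Commute.refl _)) (bW_bW i j)
  have h4 : SemiconjBy (fexp (leg23 (extExp k))) (leg12 (extExp k))
      (leg12 (extExp k) + ext13 k (eE k * wE k)) :=
    fexp_mul_linear c23 leg23_leg12_ext h2
  have c4 : constantCoeff (leg12 (extExp k) + ext13 k (eE k * wE k)) = 0 := by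
    rw [map_add, c12, const_ext13, add_zero]
  have h5 := fexp_semiconj c12 c4 h4
  have h6 : ext13 k (wE k) + (leg12 (extExp k) + ext13 k (eE k * wE k)) =
      leg12 (extExp k) + ext13 k (vE k) := by
    rw [add_left_comm, ext13, ext13, ext13, ← sum_add_distrib]
    congr 1
    refine sum_congr rfl fun l _ => ?_
    rw [← w_u, mul_add, mul_one, (w_comm_e k).eq]
    simp only [tri, map_add]
    noncomm_ring
  rw [fexp_add (const_ext13 _) c23 h1, mul_assoc, h5, ← mul_assoc, ← fexp_add (const_ext13 _) c4 h3,
    h6]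

/-- The extended twist of a link satisfies the cocycle equation. -/
theorem link_cocycle (k : Fin N) :
    leg12 (extTwist (initial N) k) * comulId (extTwist (initial N) k) =
      leg23 (extTwist (initial N) k) * idComul (extTwist (initial N) k) := by
  set F := extTwist (initial N) k with hF
  set J13 := tri (initial N (.H k)) 1 (sigma (initial N) k)
  have hFe : F = fexp (extExp k) * fexp (jorExp k) := extTwist_eq k
  have m12 : ∀ x : U2 N, leg12 (fexp x) = fexp (leg12 x) := map_fexp _
  have m23 : ∀ x : U2 N, leg23 (fexp x) = fexp (leg23 x) := map_fexp _
  have mci : ∀ x : U2 N, comulId (fexp x) = fexp (comulId x) := map_fexp _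
  have mic : ∀ x : U2 N, idComul (fexp x) = fexp (idComul x) := map_fexp _
  have j12 : constantCoeff (leg12 (jorExp k)) = 0 := constantCoeff_map (const_jorExp k)
  have j23 : constantCoeff (leg23 (jorExp k)) = 0 := constantCoeff_map (const_jorExp k)
  have j13 : constantCoeff J13 = 0 := const_tri (const_sigma k)
  have c12 : constantCoeff (leg12 (extExp k)) = 0 := constantCoeff_map (const_extExp k)
  have c23 : constantCoeff (leg23 (extExp k)) = 0 := constantCoeff_map (const_extExp k)
  have hs := Commute.refl (sigma (initial N) k)
  have k1 : Commute J13 (leg23 (jorExp k)) := by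
    rw [jorExp, leg23_tens]; exact tri_comm (Commute.one_right _) (Commute.one_left _) hs
  have k2 : Commute (leg12 (jorExp k)) J13 := by
    rw [jorExp, leg12_tens]
    exact tri_comm (Commute.refl _) (Commute.one_right _) (Commute.one_left _)
  have k3 : Commute (leg23 (extExp k)) (leg12 (jorExp k)) := by
    rw [jorExp, leg12_tens, leg23_extExp]
    exact Commute.sum_left _ _ _ fun l hl => tri_comm (Commute.one_left _)
      (comm_sigma (a_e (mem_above.1 hl))) (Commute.one_right _)
  have k4 : Commute (leg23 (extExp k)) J13 := by
    rw [leg23_extExp]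
    exact Commute.sum_left _ _ _ fun l hl => tri_comm (Commute.one_left _)
      (Commute.one_right _) (comm_sigma (bW_e l))
  have e1 : leg12 F * fexp (comulId (extExp k)) =
      fexp (ext13 k (wE k) + leg23 (extExp k)) * leg12 F :=
    fexp_semiconj (constantCoeff_map (const_extExp k))
      (by rw [map_add, const_ext13, c23, add_zero]) leg12_link_mul
  have e2 : leg23 F * fexp (idComul (extExp k)) =
      fexp (leg12 (extExp k) + ext13 k (vE k)) * leg23 F :=
    fexp_semiconj (constantCoeff_map (const_extExp k))
      (by rw [map_add, const_ext13, c12, add_zero]) leg23_link_mul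
  have e3 : leg23 F * fexp (idComul (jorExp k)) = fexp (leg12 (jorExp k) + J13) * leg23 F :=
    fexp_semiconj (constantCoeff_map (const_jorExp k))
      (by rw [map_add, j12, j13, add_zero]) leg23_jor_mul
  have f12 : leg12 F = fexp (leg12 (extExp k)) * fexp (leg12 (jorExp k)) := by
    rw [hFe, map_mul, m12, m12]
  have f23 : leg23 F = fexp (leg23 (extExp k)) * fexp (leg23 (jorExp k)) := by
    rw [hFe, map_mul, m23, m23]
  have fci : comulId F = fexp (comulId (extExp k)) * (fexp J13 * fexp (leg23 (jorExp k))) := by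
    rw [hFe, map_mul, mci, mci, comulId_jorExp, fexp_add j13 j23 k1]
  have fic : idComul F = fexp (idComul (extExp k)) * fexp (idComul (jorExp k)) := by
    rw [hFe, map_mul, mic, mic]
  rw [fci, fic, ← mul_assoc, e1, ← mul_assoc (leg23 F), e2, mul_assoc _ (leg23 F), e3, f12, f23,
    fexp_add j12 j13 k2]
  have g1 := (fexp_comm_fexp c23 j12 k3).eq
  have g2 := (fexp_comm_fexp c23 j13 k4).eq
  -- What remains after `ext_cocycle` is to move exp Φ₂₃ past exp J₁₂ and exp J₁₃, with which it
  -- commutes.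
  calc _ = fexp (ext13 k (wE k) + leg23 (extExp k)) * fexp (leg12 (extExp k)) *
        (fexp (leg12 (jorExp k)) * fexp J13 * fexp (leg23 (jorExp k))) := by noncomm_ring
    _ = fexp (leg12 (extExp k) + ext13 k (vE k)) * (fexp (leg23 (extExp k)) *
        fexp (leg12 (jorExp k)) * fexp J13 * fexp (leg23 (jorExp k))) := by
        rw [ext_cocycle]; noncomm_ring
    _ = _ := by
        rw [g1, mul_assoc _ _ (fexp J13), g2]; noncomm_ring

end Cocycle

/-! ### Cocycles and coboundaries -/

section Twists

attribute [local instance 100] LieRing.ofAssociativeRing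

open PowerSeries Finset

variable {N : ℕ}

theorem comul_ι (x : Sp N) : comul N (UniversalEnvelopingAlgebra.ι ℂ x) =
    UniversalEnvelopingAlgebra.ι ℂ x ⊗ₜ[ℂ] 1 + 1 ⊗ₜ[ℂ] UniversalEnvelopingAlgebra.ι ℂ x := by
  rw [comul, UniversalEnvelopingAlgebra.lift_ι_apply]; rfl

theorem counit_ι (x : Sp N) : counit N (UniversalEnvelopingAlgebra.ι ℂ x) = 0 := by
  rw [counit, UniversalEnvelopingAlgebra.lift_ι_apply]; rfl

theorem algHom_apply_eq {A : Type*} [Ring A] [Algebra ℂ A] {f g : U N →ₐ[ℂ] A}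
    (h : ∀ x : Sp N, f (UniversalEnvelopingAlgebra.ι ℂ x) = g (UniversalEnvelopingAlgebra.ι ℂ x))
    (a : U N) : f a = g a := by
  have : f = g := UniversalEnvelopingAlgebra.hom_ext ℂ (LieHom.ext h)
  rw [this]

theorem comulId_Δ (x : U1 N) : comulId (Δ x) = idComul (Δ x) := by
  refine map_map_congr (fun a => ?_) x
  refine algHom_apply_eq (f := (Algebra.TensorProduct.map (comul N) (AlgHom.id ℂ (U N))).comp
    (comul N)) (g := ((Algebra.TensorProduct.assoc ℂ ℂ ℂ (U N) (U N) (U N)).symm.toAlgHom.comp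
    (Algebra.TensorProduct.map (AlgHom.id ℂ (U N)) (comul N))).comp (comul N)) (fun y => ?_) a
  simp [-UniversalEnvelopingAlgebra.ι_apply, comul_ι, TensorProduct.tmul_add, TensorProduct.add_tmul, Algebra.TensorProduct.one_def,
    add_assoc]

theorem counitId_tR (x : U1 N) : counitId (tR x) = x := by
  ext n; simp [counitId, tR, mapAlgHom_apply]

theorem idCounit_tL (x : U1 N) : idCounit (tL x) = x := by
  ext n; simp [idCounit, tL, mapAlgHom_apply]

theorem idCounit_tR (x : U1 N) : idCounit (tR x) = counitId (tL x) := by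
  ext n; simp [idCounit, counitId, tR, tL, mapAlgHom_apply]

theorem counitId_Δ (x : U1 N) : counitId (Δ x) = x := by
  ext n
  simp only [counitId, Δ, mapAlgHom_apply, coeff_map]
  refine algHom_apply_eq (f := ((Algebra.TensorProduct.lid ℂ (U N)).toAlgHom.comp
    (Algebra.TensorProduct.map (counit N) (AlgHom.id ℂ (U N)))).comp (comul N))
    (g := AlgHom.id ℂ _) (fun y => ?_) _
  simp [-UniversalEnvelopingAlgebra.ι_apply, comul_ι, counit_ι]

theorem idCounit_Δ (x : U1 N) : idCounit (Δ x) = x := by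
  ext n
  simp only [idCounit, Δ, mapAlgHom_apply, coeff_map]
  refine algHom_apply_eq (f := ((Algebra.TensorProduct.rid ℂ ℂ (U N)).toAlgHom.comp
    (Algebra.TensorProduct.map (AlgHom.id ℂ (U N)) (counit N))).comp (comul N))
    (g := AlgHom.id ℂ _) (fun y => ?_) _
  simp [-UniversalEnvelopingAlgebra.ι_apply, comul_ι, counit_ι]

/-- The composite of `tL` and `counitId` serves as the counit ε with values in scalar series inside
`U1 N`. -/
theorem counitId_tens (x y : U1 N) : counitId (tens x y) = counitId (tL x) * y := by
  rw [tens_eq, map_mul, counitId_tR]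

theorem idCounit_tens (x y : U1 N) : idCounit (tens x y) = x * counitId (tL y) := by
  rw [tens_eq, map_mul, idCounit_tL, idCounit_tR]

theorem counit_initial (g : Gen N) : counitId (tL (initial N g)) = 0 := by
  simp [counitId, tL, mapAlgHom_apply, initial, map_C, counit_ι,
    -UniversalEnvelopingAlgebra.ι_apply]

/-- A counital cocycle, i.e. a twist of the primitive coproduct. -/
structure IsCocycle (F : U2 N) : Prop where
  isUnit : IsUnit F
  cocycle : leg12 F * comulId F = leg23 F * idComul F
  counit_left : counitId F = 1
  counit_right : idCounit F = 1

theorem IsCocycle.isTwist_one {F : U2 N} (h : IsCocycle F) : IsTwist 1 F := by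
  refine ⟨h.isUnit, ?_, h.counit_left, h.counit_right⟩
  simpa using h.cocycle

theorem isCocycle_one : IsCocycle (1 : U2 N) := ⟨isUnit_one, by simp, by simp, by simp⟩

/-- Multiplying the twist equation for G on the right by the invertible F₁₂(Δ⊗id)(F) = F₂₃(id⊗Δ)(F)
turns it into the cocycle equation of GF. -/
theorem IsCocycle.isTwist {F G : U2 N} (hF : IsCocycle F) (h : IsCocycle (G * F)) :
    IsTwist F G := by
  have hG : IsUnit G := by
    have := h.isUnit.mul (hF.isUnit.ringInverse)
    rwa [mul_assoc, Ring.mul_inverse_cancel _ hF.isUnit, mul_one] at this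
  have u12 : IsUnit (leg12 F) := hF.isUnit.map leg12
  have u23 : IsUnit (leg23 F) := hF.isUnit.map leg23
  refine ⟨hG, ?_, ?_, ?_⟩
  · have uc : IsUnit (leg12 F * comulId F) := u12.mul (hF.isUnit.map comulId)
    refine uc.mul_right_cancel ?_
    have h1 := h.cocycle
    simp only [map_mul] at h1
    calc _ = leg12 G * leg12 F * comulId G * (Ring.inverse (leg12 F) * leg12 F) * comulId F := by
          noncomm_ring
      _ = leg12 G * leg12 F * (comulId G * comulId F) := by
          rw [Ring.inverse_mul_cancel _ u12]; noncomm_ring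
      _ = leg23 G * leg23 F * idComul G * (Ring.inverse (leg23 F) * leg23 F) * idComul F := by
          rw [h1, Ring.inverse_mul_cancel _ u23]; noncomm_ring
      _ = _ := by rw [hF.cocycle]; noncomm_ring
  · have := h.counit_left
    rwa [map_mul, hF.counit_left, mul_one] at this
  · have := h.counit_right
    rwa [map_mul, hF.counit_right, mul_one] at this

/-- An invertible element with counit `1`. -/
structure IsNormalized (s : U1 N) : Prop where
  isUnit : IsUnit s
  counit_eq : counitId (tL s) = 1

theorem inverse_eq {A : Type*} [MonoidWithZero A] {x y : A} (h : x * y = 1) (h' : y * x = 1) :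
    Ring.inverse x = y := Ring.inverse_unit ⟨x, y, h, h'⟩

theorem IsNormalized.inverse {s : U1 N} (h : IsNormalized s) : IsNormalized (Ring.inverse s) := by
  refine ⟨h.isUnit.ringInverse, ?_⟩
  have := congrArg (fun x => counitId (tL x)) (Ring.mul_inverse_cancel _ h.isUnit)
  simpa [h.counit_eq] using this

theorem IsNormalized.mul {s t : U1 N} (hs : IsNormalized s) (ht : IsNormalized t) :
    IsNormalized (s * t) :=
  ⟨hs.isUnit.mul ht.isUnit, by rw [map_mul, map_mul, hs.counit_eq, ht.counit_eq, mul_one]⟩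

theorem isNormalized_one : IsNormalized (1 : U1 N) := ⟨isUnit_one, by simp⟩

theorem IsCocycle.coboundary {F : U2 N} (hF : IsCocycle F) {s : U1 N} (hs : IsNormalized s) :
    IsCocycle (tens (Ring.inverse s) (Ring.inverse s) * F * Δ s) := by
  have hs' := hs.inverse
  set t := Ring.inverse s
  have hst : s * t = 1 := Ring.mul_inverse_cancel _ hs.isUnit
  refine ⟨?_, ?_, ?_, ?_⟩
  · rw [tens_eq]
    exact (((hs'.isUnit.map tL).mul (hs'.isUnit.map tR)).mul hF.isUnit).mul (hs.isUnit.map Δ)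
  · have d12 : leg12 (Δ s) * leg12 (Δ t) = 1 := by rw [← map_mul, ← map_mul, hst, map_one, map_one]
    have d23 : leg23 (Δ s) * leg23 (Δ t) = 1 := by rw [← map_mul, ← map_mul, hst, map_one, map_one]
    simp only [tens_eq, map_mul, leg12_tL, leg12_tR, leg23_tL, leg23_tR, comulId_tL, comulId_tR,
      idComul_tL, idComul_tR]
    -- (Δ ⊗ id)(t ⊗ t) = Δ(t) ⊗ t, and Δ(t) cancels the Δ(s) of the first copy. Both sides reduce to
    -- (t ⊗ t ⊗ t) F₁₂ (Δ⊗id)(F) times the iterated coproduct of s.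
    calc _ = i1 t * i2 t * (leg12 F * (leg12 (Δ s) * leg12 (Δ t)) * i3 t) * comulId F *
          comulId (Δ s) := by noncomm_ring
      _ = i1 t * i2 t * i3 t * (leg12 F * comulId F) * comulId (Δ s) := by
          rw [d12, mul_one, (leg12_i3 _ _).eq]; noncomm_ring
      _ = i1 t * (i2 t * i3 t * leg23 F) * idComul F * idComul (Δ s) := by
          rw [hF.cocycle, comulId_Δ]; noncomm_ring
      _ = i2 t * i3 t * leg23 F * (leg23 (Δ s) * leg23 (Δ t)) * i1 t * idComul F *
          idComul (Δ s) := by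
          have h1 : Commute (i1 t) (i2 t * i3 t * leg23 F) :=
            ((i1_i2 _ _).mul_right (i1_i3 _ _)).mul_right (i1_leg23 _ _)
          rw [h1.eq, d23]; noncomm_ring
      _ = i2 t * i3 t * leg23 F * leg23 (Δ s) * (leg23 (Δ t) * i1 t) * idComul F *
          idComul (Δ s) := by noncomm_ring
      _ = _ := by rw [← (i1_leg23 t _).eq]; noncomm_ring
  · rw [map_mul, map_mul, hF.counit_left, counitId_Δ, counitId_tens, hs'.counit_eq, mul_one,
      one_mul, Ring.inverse_mul_cancel _ hs.isUnit]
  · rw [map_mul, map_mul, hF.counit_right, idCounit_Δ, idCounit_tens, hs'.counit_eq, mul_one,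
      mul_one, Ring.inverse_mul_cancel _ hs.isUnit]

theorem cobTwist_mul {F : U2 N} (hF : IsUnit F) (s : U1 N) :
    cobTwist F s * F = tens (Ring.inverse s) (Ring.inverse s) * F * Δ s := by
  rw [cobTwist, twisted]
  calc _ = tens (Ring.inverse s) (Ring.inverse s) * F * Δ s * (Ring.inverse F * F) := by
        noncomm_ring
    _ = _ := by rw [Ring.inverse_mul_cancel _ hF, mul_one]

theorem IsCocycle.isTwist_cobTwist {F : U2 N} (hF : IsCocycle F) {s : U1 N}
    (hs : IsNormalized s) : IsTwist F (cobTwist F s) :=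
  hF.isTwist (by rw [cobTwist_mul hF.isUnit]; exact hF.coboundary hs)

theorem isPrimitive_iff {F : U2 N} (hF : IsUnit F) (a : U1 N) :
    IsPrimitive F a ↔ F * Δ a = (tens a 1 + tens 1 a) * F := by
  rw [IsPrimitive, twisted]
  constructor
  · intro h
    rw [← h, mul_assoc _ _ F, Ring.inverse_mul_cancel _ hF, mul_one]
  · intro h
    rw [h, mul_assoc, Ring.mul_inverse_cancel _ hF, mul_one]

theorem tens_inverse_mul {s : U1 N} (hs : IsUnit s) :
    tens (Ring.inverse s) (Ring.inverse s) * tens s s = 1 := by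
  rw [tens_mul_tens, Ring.inverse_mul_cancel _ hs, tens_one_one]

theorem tens_mul_inverse {s : U1 N} (hs : IsUnit s) :
    tens s s * tens (Ring.inverse s) (Ring.inverse s) = 1 := by
  rw [tens_mul_tens, Ring.mul_inverse_cancel _ hs, tens_one_one]

/-- Passing to a coboundary twist conjugates the primitive elements. -/
theorem primitive_coboundary {F : U2 N} {s a b : U1 N} (hs : IsUnit s) (hab : s * a = b * s)
    (h : F * Δ b = (tens b 1 + tens 1 b) * F) :
    tens (Ring.inverse s) (Ring.inverse s) * F * Δ s * Δ a =
      (tens a 1 + tens 1 a) * (tens (Ring.inverse s) (Ring.inverse s) * F * Δ s) := by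
  have h1 : Ring.inverse s * b = a * Ring.inverse s := by
    calc _ = Ring.inverse s * (b * s) * Ring.inverse s := by
          rw [mul_assoc, mul_assoc b, Ring.mul_inverse_cancel _ hs, mul_one]
      _ = _ := by rw [← hab, ← mul_assoc, Ring.inverse_mul_cancel _ hs, one_mul]
  have h2 : tens (Ring.inverse s) (Ring.inverse s) * (tens b 1 + tens 1 b) =
      (tens a 1 + tens 1 a) * tens (Ring.inverse s) (Ring.inverse s) := by
    simp only [mul_add, add_mul, tens_mul_tens, h1, mul_one, one_mul]
  calc _ = tens (Ring.inverse s) (Ring.inverse s) * F * Δ (s * a) := by rw [map_mul]; noncomm_ring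
    _ = tens (Ring.inverse s) (Ring.inverse s) * (F * Δ b) * Δ s := by
        rw [hab, map_mul]; noncomm_ring
    _ = (tens (Ring.inverse s) (Ring.inverse s) * (tens b 1 + tens 1 b)) * F * Δ s := by
        rw [h]; noncomm_ring
    _ = _ := by rw [h2]; noncomm_ring

/-! ### Counits of a link; multiplying a link onto a commuting cocycle. -/

variable {k : Fin N}

theorem counitId_fexp {y : U2 N} (h : counitId y = 0) : counitId (fexp y) = 1 := by
  have h1 : counitId (fexp y) = fexp (counitId y) := map_fexp _ _
  rw [h1, h, fexp_zero]

theorem idCounit_fexp {y : U2 N} (h : idCounit y = 0) : idCounit (fexp y) = 1 := by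
  have h1 : idCounit (fexp y) = fexp (idCounit y) := map_fexp _ _
  rw [h1, h, fexp_zero]

theorem counit_e (k : Fin N) : counitId (tL (eE k)) = 0 := by
  rw [eE, scaledE, map_mul, map_mul, counit_initial, mul_zero]

theorem counit_bW (l : Fin N) : counitId (tL (bW k l)) = 0 := by
  rw [bW, map_mul, map_mul, map_mul, map_mul, counit_initial, mul_zero, zero_mul]

theorem counit_sigma (k : Fin N) : counitId (tL (sigma (initial N) k)) = 0 := by
  have h1 : tL (sigma (initial N) k) = flog1p (tL (eE k)) := map_flog1p _ _
  have h2 : counitId (flog1p (tL (eE k))) = flog1p (counitId (tL (eE k))) := map_flog1p _ _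
  rw [h1, h2, counit_e, flog1p, ev_zero_right _ (by simp)]

theorem isCocycle_link (k : Fin N) : IsCocycle (extTwist (initial N) k) := by
  refine ⟨isUnit_link k, link_cocycle k, ?_, ?_⟩
  · rw [extTwist_eq, map_mul, counitId_fexp, counitId_fexp, mul_one]
    · rw [jorExp, counitId_tens, counit_initial, zero_mul]
    · rw [extExp, map_sum]
      exact sum_eq_zero fun l _ => by rw [counitId_tens, counit_initial, zero_mul]
  · rw [extTwist_eq, map_mul, idCounit_fexp, idCounit_fexp, mul_one]
    · rw [jorExp, idCounit_tens, counit_sigma, mul_zero]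
    · rw [extExp, map_sum]
      exact sum_eq_zero fun l _ => by rw [idCounit_tens, counit_bW, mul_zero]

theorem isNormalized_sElt (k : Fin N) : IsNormalized (sElt (initial N) k) := by
  refine ⟨isUnit_sElt k, ?_⟩
  have h1 : tL (sElt (initial N) k) = fexp (tL (sExp k)) := map_fexp _ _
  rw [h1, counitId_fexp]
  have h2 : counitId (tL (quadE k)) = 0 := by
    rw [quadE, map_sum, map_sum]
    exact sum_eq_zero fun i _ => by
      rw [map_mul, map_mul, map_mul, map_mul, counit_initial, mul_zero, zero_mul]
  rw [sExp, map_mul, map_mul, h2, zero_mul]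

/-- If `G` commutes with the coproducts of all generators of `sp(N - k)`, then it commutes with those
of the elements of the `k`-th link. -/
theorem commute_Δ_link {G : U2 N} (h : ∀ g : Gen N, g.InTail k → Commute G (Δ (initial N g))) :
    Commute G (Δ (sigma (initial N) k)) ∧ Commute G (Δ (sElt (initial N) k)) ∧
      ∀ l, k < l → Commute G (Δ (bW k l)) := by
  have he : Commute G (Δ (eE k)) := by
    rw [eE, scaledE, map_mul, Δ_xi]
    exact (commute_X G).mul_right (h (.E k k) ⟨le_rfl, le_rfl⟩)
  have hev : ∀ φ, Commute G (Δ (ev φ (eE k))) := fun φ => by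
    have h1 : Δ (ev φ (eE k)) = ev φ (Δ (eE k)) := map_ev _ _ _
    have h0 : constantCoeff (Δ (eE k)) = 0 := constantCoeff_map (const_e k)
    rw [h1]; exact ev_semiconj φ h0 h0 he
  have hfe : ∀ y : U1 N, constantCoeff y = 0 → Commute G (Δ y) → Commute G (Δ (fexp y)) :=
    fun y hy hc => by
      have h1 : Δ (fexp y) = fexp (Δ y) := map_fexp _ _
      have h0 : constantCoeff (Δ y) = 0 := constantCoeff_map hy
      rw [h1]; exact ev_semiconj _ h0 h0 hc
  have hσ : Commute G (Δ (sigma (initial N) k)) := hev _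
  refine ⟨hσ, hfe _ (const_sExp k) ?_, fun l hl => ?_⟩
  · change Commute G (Δ (quadE k * ev fSeries (eE k)))
    rw [map_mul, quadE, map_sum]
    refine Commute.mul_right (Commute.sum_right _ _ _ fun i hi => ?_) (hev _)
    have hi : k < i := mem_above.1 hi
    rw [map_mul, map_mul, Δ_xi]
    exact ((commute_X G).mul_right (h (.M k i) ⟨le_rfl, hi.le, hi.ne⟩)).mul_right
      (h (.E k i) ⟨le_rfl, hi.le⟩)
  · rw [bW, map_mul, map_mul, Δ_xi]
    refine ((commute_X G).mul_right (h (.E k l) ⟨le_rfl, hl.le⟩)).mul_right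
      (hfe _ (constantCoeff_neg' (const_half k)) ?_)
    rw [map_neg, map_smul]
    exact (hσ.smul_right _).neg_right

/-- Twisting by G does not change the coproducts of the two legs of the link, so G₁₂ and G₂₃ slide
past its coproducts and the two cocycle equations multiply. -/
theorem link_mul_cocycle {G : U2 N} (hG : IsCocycle G)
    (h : ∀ g : Gen N, g.InTail k → Commute G (Δ (initial N g))) :
    IsCocycle (extTwist (initial N) k * G) := by
  have hF := isCocycle_link k
  obtain ⟨hσ, -, hb⟩ := commute_Δ_link h
  have comm_fexp : ∀ {f : U2 N →ₐ[ℂ] U3 N} {y : U2 N} {x : U3 N}, f (fexp y) = fexp (f y) →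
      constantCoeff (f y) = 0 → Commute x (f y) → Commute x (f (fexp y)) :=
    fun h1 h0 hc => by rw [h1]; exact ev_semiconj _ h0 h0 hc
  have c12 : Commute (leg12 G) (comulId (extTwist (initial N) k)) := by
    have key : ∀ (g : Gen N) y, g.InTail k → Commute (leg12 G) (comulId (tens (initial N g) y)) := by
      intro g y hg
      rw [tens_eq, map_mul, comulId_tL, comulId_tR]
      exact ((h g hg).map leg12).mul_right (leg12_i3 _ _)
    rw [extTwist_eq, map_mul]
    refine (comm_fexp (map_fexp _ _) (constantCoeff_map (const_extExp k)) ?_).mul_right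
      (comm_fexp (map_fexp _ _) (constantCoeff_map (const_jorExp k)) (key (.H k) _ le_rfl))
    rw [extExp, map_sum]
    refine Commute.sum_right _ _ _ fun l hl => ?_
    have hl := mem_above.1 hl
    exact key (.M k l) _ ⟨le_rfl, hl.le, hl.ne⟩
  have c23 : Commute (leg23 G) (idComul (extTwist (initial N) k)) := by
    have key : ∀ x y : U1 N, Commute G (Δ y) → Commute (leg23 G) (idComul (tens x y)) := by
      intro x y hy
      rw [tens_eq, map_mul, idComul_tL, idComul_tR]
      exact (i1_leg23 _ _).symm.mul_right (hy.map leg23)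
    rw [extTwist_eq, map_mul]
    refine (comm_fexp (map_fexp _ _) (constantCoeff_map (const_extExp k)) ?_).mul_right
      (comm_fexp (map_fexp _ _) (constantCoeff_map (const_jorExp k)) (key _ _ hσ))
    rw [extExp, map_sum]
    exact Commute.sum_right _ _ _ fun l hl => key _ _ (hb l (mem_above.1 hl))
  refine ⟨hF.isUnit.mul hG.isUnit, ?_, ?_, ?_⟩
  · simp only [map_mul]
    set F := extTwist (initial N) k
    calc _ = leg12 F * (leg12 G * comulId F) * comulId G := by noncomm_ring
      _ = (leg12 F * comulId F) * (leg12 G * comulId G) := by rw [c12.eq]; noncomm_ring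
      _ = leg23 F * (idComul F * leg23 G) * idComul G := by
          rw [hF.cocycle, hG.cocycle]; noncomm_ring
      _ = _ := by rw [← c23.eq]; noncomm_ring
  · rw [map_mul, hF.counit_left, hG.counit_left, mul_one]
  · rw [map_mul, hF.counit_right, hG.counit_right, mul_one]

end Twists

/-! ### Conjugated systems of generators -/

section Conjugation

open PowerSeries Finset

variable {N : ℕ}

theorem const_conj {A : Type*} [Ring A] {s t y : PowerSeries A} (hy : constantCoeff y = 0) :
    constantCoeff (s * y * t) = 0 := by simp [hy]

theorem ev_conj {A : Type*} [Ring A] [Algebra ℂ A] (φ : PowerSeries ℂ) {s t y : PowerSeries A}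
    (h : s * t = 1) (h' : t * s = 1) (hy : constantCoeff y = 0) :
    ev φ (s * y * t) = s * ev φ y * t := by
  have h1 : SemiconjBy s y (s * y * t) := by rw [SemiconjBy, mul_assoc (s * y), h', mul_one]
  rw [(ev_semiconj φ hy (const_conj hy) h1).eq, mul_assoc _ s t, h, mul_one]

theorem conj_mul {A : Type*} [Monoid A] {s t : A} (h' : t * s = 1) (x y : A) :
    s * x * t * (s * y * t) = s * (x * y) * t := by
  calc s * x * t * (s * y * t) = s * x * (t * s) * y * t := by simp only [mul_assoc]
    _ = _ := by rw [h', mul_one, mul_assoc s x y]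

theorem conj_list_prod {A ι : Type*} [Monoid A] {s t : A} (h : s * t = 1) (h' : t * s = 1)
    (l : List ι) (f : ι → A) : (l.map fun i => s * f i * t).prod = s * (l.map f).prod * t := by
  induction l with
  | nil => simp [h]
  | cons a l ih => rw [List.map_cons, List.prod_cons, ih, conj_mul h', List.map_cons, List.prod_cons]

theorem xi_conj (s t x : U1 N) : xi * (s * x * t) = s * (xi * x) * t := by
  rw [← mul_assoc, ← mul_assoc, ← xi_comm s]; noncomm_ring

theorem tens_conj (s t x y : U1 N) :
    tens (s * x * t) (s * y * t) = tens s s * tens x y * tens t t := by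
  rw [tens_mul_tens, tens_mul_tens]

variable {Q : GenSys N} {s t : U1 N} {k : Fin N}

/-- The system `Q` is the conjugate by `s = t⁻¹` of the initial generators of `sp(N - m)`. -/
structure IsConj (Q : GenSys N) (m : ℕ) (s t : U1 N) : Prop where
  mul_inv : s * t = 1
  inv_mul : t * s = 1
  eq_conj : ∀ g : Gen N, g.InTail m → Q g = s * initial N g * t

namespace IsConj

theorem scaledE_eq (h : IsConj Q k s t) : scaledE Q k = s * eE k * t := by
  rw [scaledE, h.eq_conj (.E k k) ⟨le_rfl, le_rfl⟩, xi_conj]; rfl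

theorem sigma_eq (h : IsConj Q k s t) : sigma Q k = s * sigma (initial N) k * t := by
  rw [sigma, h.scaledE_eq]
  exact ev_conj _ h.mul_inv h.inv_mul (const_e k)

theorem w_eq (h : IsConj Q k s t) : fexp (-((1 / 2 : ℂ) • sigma Q k)) = s * wE k * t := by
  have h1 : -((1 / 2 : ℂ) • sigma Q k) = s * -((1 / 2 : ℂ) • sigma (initial N) k) * t := by
    rw [h.sigma_eq, mul_neg, neg_mul, mul_smul_comm, smul_mul_assoc]
  rw [h1]
  exact ev_conj _ h.mul_inv h.inv_mul (constantCoeff_neg' (const_half k))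

theorem inv_sigma_eq (h : IsConj Q k s t) :
    fexp (-sigma Q k) = s * fexp (-sigma (initial N) k) * t := by
  have h1 : -sigma Q k = s * -sigma (initial N) k * t := by rw [h.sigma_eq, mul_neg, neg_mul]
  rw [h1]
  exact ev_conj _ h.mul_inv h.inv_mul (constantCoeff_neg' (const_sigma k))

/-- The link is a formula in the system, built from products and power series; conjugation respects
both. -/
theorem extTwist_conj (h : IsConj Q k s t) :
    extTwist Q k = tens s s * extTwist (initial N) k * tens t t := by
  have hT : tens s s * tens t t = 1 := by rw [tens_mul_tens, h.mul_inv, tens_one_one]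
  have hT' : tens t t * tens s s = 1 := by rw [tens_mul_tens, h.inv_mul, tens_one_one]
  have hm : ∀ {i : Fin N}, i ∈ indicesAbove k ↔ k < i := by simp [indicesAbove]
  have h1 : ∀ i ∈ indicesAbove k,
      fexp (tens (Q (.M k i)) (xi * Q (.E k i) * fexp (-((1 / 2 : ℂ) • sigma Q k)))) =
      tens s s * fexp (tens (initial N (.M k i)) (bW k i)) * tens t t := by
    intro i hi
    have hi := hm.1 hi
    rw [h.w_eq, h.eq_conj (.M k i) ⟨le_rfl, hi.le, hi.ne⟩, h.eq_conj (.E k i) ⟨le_rfl, hi.le⟩,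
      xi_conj, conj_mul h.inv_mul, tens_conj]
    exact ev_conj _ hT hT' (const_tens (const_bW i))
  have h2 : fexp (tens (Q (.H k)) (sigma Q k)) =
      tens s s * fexp (tens (initial N (.H k)) (sigma (initial N) k)) * tens t t := by
    rw [h.sigma_eq, h.eq_conj (.H k) le_rfl, tens_conj]
    exact ev_conj _ hT hT' (const_jorExp k)
  rw [extTwist, List.map_congr_left h1, conj_list_prod hT hT', h2, conj_mul hT']
  rfl

theorem sElt_conj (h : IsConj Q k s t) : sElt Q k = s * sElt (initial N) k * t := by
  have h1 : ∀ i ∈ above k, xi * Q (.M k i) * Q (.E k i) =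
      s * (xi * initial N (.M k i) * initial N (.E k i)) * t := by
    intro i hi
    have hi := mem_above.1 hi
    rw [h.eq_conj (.M k i) ⟨le_rfl, hi.le, hi.ne⟩, h.eq_conj (.E k i) ⟨le_rfl, hi.le⟩, xi_conj,
      conj_mul h.inv_mul]
  have h2 : ev fSeries (scaledE Q k) = s * ev fSeries (eE k) * t := by
    rw [h.scaledE_eq]; exact ev_conj _ h.mul_inv h.inv_mul (const_e k)
  rw [sElt, sum_congr rfl h1, ← sum_mul, ← mul_sum, h2, conj_mul h.inv_mul]
  exact ev_conj _ h.mul_inv h.inv_mul (const_sExp k)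

theorem basisChange_conj (h : IsConj Q k s t) {g : Gen N} (hg : g.InTail (k + 1)) :
    basisChange k Q g = s * basisChange k (initial N) g * t := by
  have conj_sub : ∀ x y : U1 N, s * x * t - s * y * t = s * (x - y) * t := fun x y => by
    rw [mul_sub, sub_mul]
  rcases g with ⟨i, j⟩ | ⟨i, j⟩ | ⟨i, j⟩ | i
  · have hi : k < i := hg.1
    have hj : k < j := hg.2
    simp only [basisChange]
    rw [h.eq_conj (.E i j) ⟨hi.le, hj.le⟩, h.eq_conj (.E k i) ⟨le_rfl, hi.le⟩,
      h.eq_conj (.E k j) ⟨le_rfl, hj.le⟩, h.inv_sigma_eq, xi_conj, conj_mul h.inv_mul,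
      conj_mul h.inv_mul, conj_sub]
  · have hi : k < i := hg.1
    have hj : k < j := hg.2
    simp only [basisChange]
    rw [h.eq_conj (.F i j) ⟨hi.le, hj.le⟩, h.eq_conj (.M k i) ⟨le_rfl, hi.le, hi.ne⟩,
      h.eq_conj (.M k j) ⟨le_rfl, hj.le, hj.ne⟩, xi_conj, conj_mul h.inv_mul, conj_sub]
  · exact h.eq_conj (.M i j) ⟨Nat.le_of_succ_le hg.1, Nat.le_of_succ_le hg.2.1, hg.2.2⟩
  · exact h.eq_conj (.H i) (Nat.le_of_succ_le hg)

end IsConj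

end Conjugation

/-! ### The chains -/

section Chains

variable {N : ℕ}

theorem firstIndices_succ (k : Fin N) :
    firstIndices N (k + 1) = firstIndices N k ++ [k] := by
  rw [firstIndices, List.take_add_one]; simp [firstIndices]

theorem deformedChain_zero (N : ℕ) : deformedChain N 0 = 1 := by
  simp [deformedChain, firstIndices]

theorem deformedChain_succ (k : Fin N) :
    deformedChain N (k + 1) = extTwist (deformed N k) k * deformedChain N k := by
  simp [deformedChain, firstIndices_succ]

theorem canonicalChain_zero (N : ℕ) : canonicalChain N 0 = 1 := by
  simp [canonicalChain, firstIndices]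

theorem canonicalChain_succ (k : Fin N) :
    canonicalChain N (k + 1) = sTwist k * extTwist (initial N) k * canonicalChain N k := by
  simp [canonicalChain, firstIndices_succ]

theorem sProd_zero (N : ℕ) : sProd N 0 = 1 := by
  simp [sProd, firstIndices]

theorem sProd_succ (k : Fin N) : sProd N (k + 1) = sProd N k * sElt (initial N) k := by
  simp [sProd, firstIndices_succ]

/-- Induction along the chain. -/
theorem chain_induction {P : ℕ → Prop} (h0 : P 0) (hs : ∀ k : Fin N, P k → P (k + 1)) {m : ℕ}
    (hm : m ≤ N) : P m := by
  induction m with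
  | zero => exact h0
  | succ m ih => exact hs ⟨m, hm⟩ (ih (Nat.le_of_succ_le hm))

theorem isNormalized_sProd {m : ℕ} (hm : m ≤ N) : IsNormalized (sProd N m) :=
  chain_induction (P := fun m => IsNormalized (sProd N m)) (by rw [sProd_zero]; exact isNormalized_one)
    (fun k h => by
      rw [sProd_succ]
      exact h.mul (isNormalized_sElt k)) hm

theorem Gen.InTail.of_succ {m : ℕ} {g : Gen N} (h : g.InTail (m + 1)) : g.InTail m := by
  rcases g with ⟨i, j⟩ | ⟨i, j⟩ | ⟨i, j⟩ | i
  · exact ⟨Nat.le_of_succ_le h.1, Nat.le_of_succ_le h.2⟩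
  · exact ⟨Nat.le_of_succ_le h.1, Nat.le_of_succ_le h.2⟩
  · exact ⟨Nat.le_of_succ_le h.1, Nat.le_of_succ_le h.2.1, h.2.2⟩
  · exact Nat.le_of_succ_le h

theorem basisChange_initial {k : Fin N} {g : Gen N} (hg : g.InTail (k + 1)) :
    basisChange k (initial N) g =
      sElt (initial N) k * initial N g * Ring.inverse (sElt (initial N) k) := by
  rw [sElt_conj hg, mul_assoc, Ring.mul_inverse_cancel _ (isUnit_sElt k), mul_one]

theorem inverse_mul_rev {A : Type*} [MonoidWithZero A] {s t : A} (hs : IsUnit s) (ht : IsUnit t) :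
    Ring.inverse (s * t) = Ring.inverse t * Ring.inverse s := by
  refine inverse_eq ?_ ?_
  · rw [mul_assoc, ← mul_assoc t, Ring.mul_inverse_cancel _ ht, one_mul, Ring.mul_inverse_cancel _ hs]
  · rw [mul_assoc, ← mul_assoc _ s, Ring.inverse_mul_cancel _ hs, one_mul,
      Ring.inverse_mul_cancel _ ht]

/-- The next basis change on a system conjugated by S is the S-conjugate of the initial one, itself
conjugation by s_k. Hence s_k multiplies S on the right. -/
theorem deformed_isConj {m : ℕ} (hm : m ≤ N) :
    IsConj (deformed N m) m (sProd N m) (Ring.inverse (sProd N m)) := by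
  have hu := (isNormalized_sProd hm).isUnit
  refine ⟨Ring.mul_inverse_cancel _ hu, Ring.inverse_mul_cancel _ hu, ?_⟩
  clear hu
  refine chain_induction (P := fun m => ∀ g : Gen N, g.InTail m → deformed N m g =
    sProd N m * initial N g * Ring.inverse (sProd N m)) (fun g _ => ?_) (fun k ih g hg => ?_) hm
  · rw [deformed_zero, sProd_zero, Ring.inverse_one]; simp
  · have hu := (isNormalized_sProd k.2.le).isUnit
    have hc : IsConj (deformed N k) k (sProd N k) (Ring.inverse (sProd N k)) :=
      ⟨Ring.mul_inverse_cancel _ hu, Ring.inverse_mul_cancel _ hu, ih⟩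
    rw [deformed_succ, hc.basisChange_conj hg, basisChange_initial hg, sProd_succ,
      inverse_mul_rev hu (isUnit_sElt k)]
    noncomm_ring

theorem sTwist_mul (k : Fin N) : sTwist k * extTwist (initial N) k =
    tens (Ring.inverse (sElt (initial N) k)) (Ring.inverse (sElt (initial N) k)) *
      extTwist (initial N) k * Δ (sElt (initial N) k) :=
  cobTwist_mul (isUnit_link k) _

/-- The initial generators of `sp(N - k)` are primitive for the canonical form of the link. -/
theorem canonicalLink_primitive {k : Fin N} {g : Gen N} (hg : g.InTail (k + 1)) :
    sTwist k * extTwist (initial N) k * Δ (initial N g) =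
      (tens (initial N g) 1 + tens 1 (initial N g)) * (sTwist k * extTwist (initial N) k) := by
  rw [sTwist_mul]
  exact primitive_coboundary (isUnit_sElt k) (sElt_conj hg) (link_primitive hg)

theorem canonicalChain_succ' {k : Fin N}
    (h : Commute (canonicalChain N k) (Δ (sElt (initial N) k))) :
    canonicalChain N (k + 1) =
      tens (Ring.inverse (sElt (initial N) k)) (Ring.inverse (sElt (initial N) k)) *
        (extTwist (initial N) k * canonicalChain N k) * Δ (sElt (initial N) k) := by
  rw [canonicalChain_succ, sTwist_mul, mul_assoc _ _ (canonicalChain N k), ← h.eq]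
  noncomm_ring

/-- The two claims are proved together: the cocycle property of the next product uses commutation
with the coproducts of the current tail, which includes the whole next link. -/
theorem canonicalChain_spec {m : ℕ} (hm : m ≤ N) : IsCocycle (canonicalChain N m) ∧
    ∀ g : Gen N, g.InTail m → Commute (canonicalChain N m) (Δ (initial N g)) := by
  refine chain_induction (P := fun m => IsCocycle (canonicalChain N m) ∧
    ∀ g : Gen N, g.InTail m → Commute (canonicalChain N m) (Δ (initial N g))) ?_ ?_ hm
  · rw [canonicalChain_zero]
    exact ⟨isCocycle_one, fun g _ => Commute.one_left _⟩
  · rintro k ⟨hG, hc⟩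
    refine ⟨?_, fun g hg => ?_⟩
    · rw [canonicalChain_succ' (commute_Δ_link hc).2.1]
      exact (link_mul_cocycle hG hc).coboundary (isNormalized_sElt k)
    · have h1 : Commute (sTwist k * extTwist (initial N) k) (Δ (initial N g)) := by
        rw [Commute, SemiconjBy, canonicalLink_primitive hg, Δ_initial, tL_eq, tR_eq]
      rw [canonicalChain_succ]
      exact h1.mul_left (hc g hg.of_succ)

theorem sTwist_isUnit (k : Fin N) : IsUnit (sTwist k) :=
  ((isCocycle_link k).isTwist_cobTwist (isNormalized_sElt k)).1

theorem canonicalChain_primitive {m : ℕ} (hm : m ≤ N) {g : Gen N} (hg : g.InTail m) :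
    canonicalChain N m * Δ (initial N g) =
      (tens (initial N g) 1 + tens 1 (initial N g)) * canonicalChain N m := by
  rw [((canonicalChain_spec hm).2 g hg).eq, Δ_initial, tL_eq, tR_eq]

theorem canonicalChain_eq {m : ℕ} (hm : m ≤ N) : canonicalChain N m =
    tens (Ring.inverse (sProd N m)) (Ring.inverse (sProd N m)) * deformedChain N m *
      Δ (sProd N m) := by
  refine chain_induction (P := fun m => canonicalChain N m =
    tens (Ring.inverse (sProd N m)) (Ring.inverse (sProd N m)) * deformedChain N m *
      Δ (sProd N m)) ?_ (fun k ih => ?_) hm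
  · rw [canonicalChain_zero, deformedChain_zero, sProd_zero, Ring.inverse_one, tens_one_one, map_one]
    simp
  · have hu := (isNormalized_sProd k.2.le).isUnit
    have hc := canonicalChain_spec k.2.le
    rw [canonicalChain_succ' (commute_Δ_link hc.2).2.1, deformedChain_succ,
      (deformed_isConj k.2.le).extTwist_conj, sProd_succ, inverse_mul_rev hu (isUnit_sElt k),
      map_mul, ← tens_mul_tens, ih]
    set T := tens (Ring.inverse (sProd N k)) (Ring.inverse (sProd N k))
    set D := deformedChain N k
    set τ := tens (Ring.inverse (sElt (initial N) k)) (Ring.inverse (sElt (initial N) k))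
    -- This is the telescoping: S⁻¹ ⊗ S⁻¹ cancels the left conjugator of the new link, and the right
    -- conjugator supplies the one required by the induction hypothesis.
    have hT : T * tens (sProd N k) (sProd N k) = 1 := tens_inverse_mul hu
    calc _ = τ * (1 * extTwist (initial N) k * T * D * Δ (sProd N k)) *
          Δ (sElt (initial N) k) := by noncomm_ring
      _ = _ := by rw [← hT]; noncomm_ring

theorem deformedChain_eq {m : ℕ} (hm : m ≤ N) : deformedChain N m =
    tens (sProd N m) (sProd N m) * canonicalChain N m * Δ (Ring.inverse (sProd N m)) := by
  have hu := (isNormalized_sProd hm).isUnit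
  rw [canonicalChain_eq hm]
  calc _ = 1 * deformedChain N m * Δ (sProd N m * Ring.inverse (sProd N m)) := by
        rw [Ring.mul_inverse_cancel _ hu, map_one, one_mul, mul_one]
    _ = _ := by rw [← tens_mul_inverse hu, map_mul]; noncomm_ring

theorem inverse_inverse' {A : Type*} [MonoidWithZero A] {s : A} (h : IsUnit s) :
    Ring.inverse (Ring.inverse s) = s :=
  inverse_eq (Ring.inverse_mul_cancel _ h) (Ring.mul_inverse_cancel _ h)

/-- The double inverse exhibits the chain as the coboundary transform of the canonical one by S⁻¹,
the form required by `IsCocycle.coboundary` and `primitive_coboundary`. -/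
theorem deformedChain_eq' {m : ℕ} (hm : m ≤ N) : deformedChain N m =
    tens (Ring.inverse (Ring.inverse (sProd N m))) (Ring.inverse (Ring.inverse (sProd N m))) *
      canonicalChain N m * Δ (Ring.inverse (sProd N m)) := by
  rw [inverse_inverse' (isNormalized_sProd hm).isUnit]
  exact deformedChain_eq hm

theorem isCocycle_deformedChain {m : ℕ} (hm : m ≤ N) : IsCocycle (deformedChain N m) := by
  rw [deformedChain_eq' hm]
  exact (canonicalChain_spec hm).1.coboundary (isNormalized_sProd hm).inverse

theorem deformedChain_primitive {m : ℕ} (hm : m ≤ N) {g : Gen N} (hg : g.InTail m) :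
    deformedChain N m * Δ (deformed N m g) =
      (tens (deformed N m g) 1 + tens 1 (deformed N m g)) * deformedChain N m := by
  have hu := (isNormalized_sProd hm).isUnit
  rw [deformedChain_eq' hm]
  refine primitive_coboundary hu.ringInverse ?_ (canonicalChain_primitive hm hg)
  rw [(deformed_isConj hm).eq_conj g hg, ← mul_assoc, ← mul_assoc, Ring.inverse_mul_cancel _ hu,
    one_mul]

theorem isNormalized_deformed (k : Fin N) : IsNormalized (sElt (deformed N k) k) := by
  have h := isNormalized_sProd k.2.le
  rw [(deformed_isConj k.2.le).sElt_conj]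
  exact (h.mul (isNormalized_sElt k)).mul h.inverse

theorem deformed_succ_mul {k : Fin N} {g : Gen N} (hg : g.InTail (k + 1)) :
    sElt (deformed N k) k * deformed N k g = deformed N (k + 1) g * sElt (deformed N k) k := by
  have hc := deformed_isConj k.2.le
  rw [deformed_succ, hc.basisChange_conj hg, hc.eq_conj g hg.of_succ, hc.sElt_conj,
    conj_mul hc.inv_mul, conj_mul hc.inv_mul, sElt_conj hg]

end Chains

end SpChain

end

open SpChain
theorem mainTheorem4 (N : ℕ) :
    -- the `k`-th link in the initial generators of `sp(N - k + 1)`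
    (∀ k : Fin N,
      IsUnit (sElt (initial N) k) ∧
      IsTwist 1 (extTwist (initial N) k) ∧
      IsTwist (extTwist (initial N) k) (sTwist k) ∧
      ∀ g : Gen N, g.InTail (k + 1) →
        basisChange k (initial N) g =
          sElt (initial N) k * initial N g * Ring.inverse (sElt (initial N) k) ∧
        IsPrimitive (extTwist (initial N) k) (basisChange k (initial N) g) ∧
        IsPrimitive (sTwist k * extTwist (initial N) k) (initial N g)) ∧
    -- the `k`-th step of the chain on the deformed carrier spaces
    (∀ k : Fin N,
      IsUnit (sElt (deformed N k) k) ∧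
      IsTwist (deformedChain N k) (extTwist (deformed N k) k) ∧
      IsTwist (deformedChain N (k + 1))
        (cobTwist (deformedChain N (k + 1)) (sElt (deformed N k) k)) ∧
      ∀ g : Gen N, g.InTail (k + 1) →
        deformed N (k + 1) g =
          sElt (deformed N k) k * deformed N k g * Ring.inverse (sElt (deformed N k) k) ∧
        IsPrimitive (deformedChain N (k + 1)) (deformed N (k + 1) g) ∧
        IsPrimitive
          (cobTwist (deformedChain N (k + 1)) (sElt (deformed N k) k) * deformedChain N (k + 1))
          (deformed N k g)) ∧
    -- the `k`-th step of the chain in canonical form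
    (∀ k : Fin N,
      IsTwist (canonicalChain N k) (extTwist (initial N) k) ∧
      cobTwist (extTwist (initial N) k * canonicalChain N k) (sElt (initial N) k) = sTwist k ∧
      IsTwist (extTwist (initial N) k * canonicalChain N k) (sTwist k) ∧
      ∀ g : Gen N, g.InTail (k + 1) → IsPrimitive (canonicalChain N (k + 1)) (initial N g)) ∧
    -- both chains are twists of `U(sp(N))`, and they are the same up to the coboundary of `sProd`
    (∀ m : ℕ, m ≤ N →
      IsTwist 1 (deformedChain N m) ∧
      IsTwist 1 (canonicalChain N m) ∧
      IsUnit (sProd N m) ∧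
      (∀ g : Gen N, g.InTail m →
        deformed N m g = sProd N m * initial N g * Ring.inverse (sProd N m)) ∧
      canonicalChain N m =
        tens (Ring.inverse (sProd N m)) (Ring.inverse (sProd N m)) *
          deformedChain N m * Δ (sProd N m)) := by
  refine ⟨fun k => ⟨isUnit_sElt k, (isCocycle_link k).isTwist_one,
      (isCocycle_link k).isTwist_cobTwist (isNormalized_sElt k), fun g hg =>
      ⟨basisChange_initial hg, (isPrimitive_iff (isUnit_link k) _).2 (link_primitive hg),
        (isPrimitive_iff ((sTwist_isUnit k).mul (isUnit_link k)) _).2 (canonicalLink_primitive hg)⟩⟩,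
    fun k => ?_, fun k => ?_, fun m hm => ⟨(isCocycle_deformedChain hm).isTwist_one,
      (canonicalChain_spec hm).1.isTwist_one, (isNormalized_sProd hm).isUnit,
      (deformed_isConj hm).eq_conj, canonicalChain_eq hm⟩⟩
  · have hC := isCocycle_deformedChain (N := N) (m := k + 1) k.2
    have hs := isNormalized_deformed k
    refine ⟨hs.isUnit, (isCocycle_deformedChain k.2.le).isTwist (deformedChain_succ k ▸ hC),
      hC.isTwist_cobTwist hs, fun g hg => ?_⟩
    have hp := deformedChain_primitive (N := N) (m := k + 1) k.2 hg
    refine ⟨?_, (isPrimitive_iff hC.isUnit _).2 hp, ?_⟩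
    · rw [deformed_succ_mul hg, mul_assoc, Ring.mul_inverse_cancel _ hs.isUnit, mul_one]
    · rw [cobTwist_mul hC.isUnit, isPrimitive_iff (hC.coboundary hs).isUnit]
      exact primitive_coboundary hs.isUnit (deformed_succ_mul hg) hp
  · obtain ⟨hG, hc⟩ := canonicalChain_spec (N := N) k.2.le
    have hFG := link_mul_cocycle hG hc
    have hs := isNormalized_sElt k
    -- The earlier links commute with Δ(s_k), so they drop out of the twisted coproduct of s_k.
    have he : cobTwist (extTwist (initial N) k * canonicalChain N k) (sElt (initial N) k) =
        sTwist k := by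
      refine hFG.isUnit.mul_right_cancel ?_
      rw [cobTwist_mul hFG.isUnit, ← mul_assoc (sTwist k), sTwist_mul]
      have h1 := (commute_Δ_link hc).2.1
      rw [mul_assoc _ _ (canonicalChain N k), ← h1.eq]
      simp only [mul_assoc]
    have hG' := canonicalChain_spec (N := N) (m := k + 1) k.2
    exact ⟨hG.isTwist hFG, he, he ▸ hFG.isTwist_cobTwist hs, fun g hg =>
      (isPrimitive_iff hG'.1.isUnit _).2 (canonicalChain_primitive k.2 hg)⟩
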